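/- **Setting.** Let $d\ge 1$, let $\Omega\subset\mathbb R^d$ be a bounded open polygonal domain and let $\mathcal T_h$ be a finite subdivision of $\Omega$ into non-overlapping open $d$-simplices $E$ (hanging nodes are allowed) with diameters $h_E$. The faces are the sets $e=\bar E^+\cap\bar E^-\setminus\partial\Omega$ of positive $(d-1)$-dimensional measure (interior faces, $h_e=\min(h_{E^+},h_{E^-})$) and the boundary faces $e\subset\partial E\cap\partial\Omega$ ($h_e=h_E$); $\mathcal E_h^o$, $\Gamma$ and $\mathcal E_h$ denote the sets of interior, boundary and all faces. With $n^\pm$ the outward unit normals of $E^\pm$ put, on interior faces, $[\![w]\!]=w^+n^++w^-n^-$ and $\{\tau\}=\tfrac12(\tau^++\tau^-)$, and on boundary faces $[\![w]\!]=wn$ and $\{\tau\}=\tau$. Let $\mathsf a$ be a field of symmetric $d\times d$ matrices with bounded, piecewise continuous entries (Borel measurable, with one-sided limits from inside $E$ at almost every point of $\partial E$, for every $E$), $\zeta^{\top}\mathsf a\zeta\ge0$ for all $\zeta\in\mathbb R^d$ a.e. in $\Omega$; let $b:\bar\Omega\to\mathbb R^d$ be Lipschitz, $c\in L^\infty(\Omega)$,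 $f\in L^2(\Omega)$, with $c-\tfrac12\nabla\cdot b\ge0$ a.e. in $\Omega$ and $c_0:=(c-\tfrac12\nabla\cdot b)^{1/2}$. Let $\theta\in\{-1,0,1\}$, $r\in\mathbb N_0$, $C_p\ge0$, $C_{ar},C_d\in\mathbb R$. Put $\bar{\mathsf a}|_E=\|\,|\sqrt{\mathsf a}|_2\|_{L^\infty(E)}$, $m=C_p\{\bar{\mathsf a}r^2\}/h_e$ and $M=C_{ar}+C_d\{\bar{\mathsf a}r^2\}/h_e$. Let $\mathcal T_C\subset\mathcal T_h$ (the continuous region) and let $\mathcal E_h^C$ consist of the interior faces between two elements of $\mathcal T_C$ and the boundary faces of elements of $\mathcal T_C$. Let $V_{dG}=\{v\in L^2(\Omega): v|_E\in\mathbb P^r\ \forall E\in\mathcal T_h\}$, and let $V_{cdG}$ be the subspace of those $v\in V_{dG}$ that are continuous on the closure of $\bigcup\mathcal T_C$ and vanish on the boundary faces of elements of $\mathcal T_C$. For $w,\hat w\in V_{dG}$ let $B=B_d+B_{ar}$, $$\begin{aligned}B_d(w,\hat w)&=\sum_{E}\int_E\mathsf a\nabla w\cdot\nabla\hat w\,dx+\sum_{e\in\mathcal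 E_h}\int_e m[\![w]\!]\cdot[\![\hat w]\!]\,ds-\sum_{e\in\mathcal E_h}\int_e\big(\{\mathsf a\nabla w\}\cdot[\![\hat w]\!]-\theta\{\mathsf a\nabla\hat w\}\cdot[\![w]\!]\big)ds,\\ B_{ar}(w,\hat w)&=\sum_E\int_E\big((b\cdot\nabla w)\hat w+cw\hat w\big)dx-\sum_{e\in\mathcal E_h^o}\int_e b\cdot[\![w]\!]\,\hat w^{\rm out}ds-\int_{\{x\in\Gamma:\,b\cdot n\le0\}}(b\cdot n)w\hat w\,ds,\end{aligned}$$ where $\hat w^{\rm out}$ is the trace from the downstream element (the one into which $b$ points), and let $S(w,\hat w)=\sum_{e\in\mathcal E_h^C}\int_eM[\![w]\!]\cdot[\![\hat w]\!]ds$, $B_\sigma=B+\sigma S$, $\ell(w)=\int_\Omega fw\,dx$ and $$\|w\|_{dG}^2=\sum_E\|\sqrt{\mathsf a}\nabla w\|_{L^2(E)}^2+\|c_0w\|_{L^2(\Omega)}^2+\sum_{e\in\mathcal E_h}\tfrac12\big\||b\cdot n|^{1/2}[\![w]\!]\big\|_{L^2(e)}^2+\sum_{e\in\mathcal E_h}\|\sqrt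 m\,[\![w]\!]\|_{L^2(e)}^2 .$$ Assume that $\|\cdot\|_{dG}$ is a norm on $V_{dG}$ (it is nonzero for $w\neq 0$); that $M>0$ on all faces in $\mathcal E_h^C$; and that either $\mathcal T_C=\mathcal T_h$ or $\mathcal T_C$ is locally connected through faces: whenever the closures of $E,E'\in\mathcal T_C$ meet in a point $x$, then $E$ and $E'$ are joined by a chain of elements of $\mathcal T_C$ whose closures contain $x$ and in which consecutive elements share an interior face, or each of $E,E'$ is joined by such a chain to an element of $\mathcal T_C$ with a boundary face containing $x$. **Theorem.** There is $C_0\ge0$, depending only on $\mathcal T_h$, $r$, $\mathsf a$ and $\theta$, with $C_0=0$ if $\theta=1$, such that for every $C_p\ge C_0$ the following holds. For every $\sigma\ge0$ there is exactly one $w_\sigma\in V_{dG}$ with $B_\sigma(w_\sigma,w)=\ell(w)$ for all $w\in V_{dG}$, and there is exactly one $v_h\in V_{cdG}$ with $B_\sigma(v_h,v)=\ell(v)$ for all $v\in V_{cdG}$, which does not depend on $\sigma$. Moreover $$\lim_{\sigma\to\infty}(w_\sigma-v_h)=0$$ in $\|\cdot\|_{dG}$ and in every (semi-)norm on the finite-dimensional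 space $V_{dG}$. In particular, for $\mathcal T_C=\mathcal T_h$ the dG solutions converge to the standard continuous Galerkin solution. -/

import Mathlib

open MeasureTheory Filter Topology
open scoped ENNReal RealInnerProductSpace

noncomputable section

namespace CdG

/-- Points of `ℝ^d` with the Euclidean norm. -/
abbrev Pt (d : ℕ) := EuclideanSpace ℝ (Fin d)

/-- The `(d-1)`-dimensional surface measure (counting measure if `d = 1`). -/
def surf (d : ℕ) : Measure (Pt d) := Measure.euclideanHausdorffMeasure (d - 1)

/-- A bounded open polygonal set `Ω` with a subdivision into finitely many non-overlapping open
`d`-simplices. The mesh need not be conforming (hanging nodes are allowed). -/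
structure Mesh (d N : ℕ) where
  /-- the set `Ω` -/
  domain : Set (Pt d)
  /-- the (closed) simplices -/
  simplex : Fin N → Affine.Simplex ℝ (Pt d) d
  isOpen_domain : IsOpen domain
  closure_domain :
    closure domain = ⋃ i, convexHull ℝ (Set.range (simplex i).points)
  interior_subset :
    ∀ i, interior (convexHull ℝ (Set.range (simplex i).points)) ⊆ domain
  disjoint_interior : Pairwise fun i j =>
    Disjoint (interior (convexHull ℝ (Set.range (simplex i).points)))
      (interior (convexHull ℝ (Set.range (simplex j).points)))

/-- The broken polynomial space `V_dG`: one polynomial of total degree at most `r` for each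
element. Since the elements are open, nonempty and cover `Ω` up to a null set, this is the space
of all `v ∈ L²(Ω)` whose restriction to each element is a polynomial of degree at most `r`. -/
abbrev DGSpace (d N r : ℕ) := Fin N → MvPolynomial.restrictTotalDegree (Fin d) ℝ r

/-- The value at `x` of the polynomial on element `i`; for `x` on the boundary of the element this
is the interior trace. -/
def val {d N r : ℕ} (w : DGSpace d N r) (i : Fin N) (x : Pt d) : ℝ :=
  MvPolynomial.eval (fun k => x k) (w i : MvPolynomial (Fin d) ℝ)

/-- The value at `x` of the gradient of the polynomial on element `i`. -/
def grad {d N r : ℕ} (w : DGSpace d N r) (i : Fin N) (x : Pt d) : Pt d :=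
  WithLp.toLp 2 fun k =>
    MvPolynomial.eval (fun l => x l) (MvPolynomial.pderiv k (w i : MvPolynomial (Fin d) ℝ))

/-- A square matrix as an operator on Euclidean space; its norm is the matrix 2-norm. -/
def op {d : ℕ} (A : Matrix (Fin d) (Fin d) ℝ) : Pt d →L[ℝ] Pt d :=
  Matrix.toEuclideanCLM (n := Fin d) (𝕜 := ℝ) A

/-- The square root of a symmetric positive semidefinite matrix. -/
def matSqrt {d : ℕ} (A : Matrix (Fin d) (Fin d) ℝ) : Matrix (Fin d) (Fin d) ℝ :=
  cfc Real.sqrt A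

/-- The divergence of a vector field. -/
def divergence {d : ℕ} (b : Pt d → Pt d) (x : Pt d) : ℝ :=
  ∑ k : Fin d, (fderiv ℝ b x (EuclideanSpace.single k 1)) k

/-- The unit outward normal of a convex set `K` at a boundary point `x`. For a simplex it is
uniquely determined at every point outside the faces of dimension at most `d - 2`. -/
def outerNormal {d : ℕ} (K : Set (Pt d)) (x : Pt d) : Pt d :=
  Classical.epsilon fun n : Pt d => ‖n‖ = 1 ∧ ∀ y ∈ K, ⟪n, y - x⟫ ≤ 0

namespace Mesh

variable {d N r : ℕ} (T : Mesh d N)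

/-- The closed element `Ē_i`. -/
def closedElem (i : Fin N) : Set (Pt d) := convexHull ℝ (Set.range (T.simplex i).points)

/-- The open element `E_i`. -/
def elem (i : Fin N) : Set (Pt d) := interior (T.closedElem i)

/-- The interior face between the elements `i ≠ j`. (If this set has surface measure zero it is
not a face, and then all face integrals over it vanish.) -/
def face (i j : Fin N) : Set (Pt d) := T.closedElem i ∩ T.closedElem j ∩ T.domain

/-- The part of the boundary of element `i` lying in `∂Ω`, up to a set of surface measure zero
the union of its boundary faces. -/
def bdryFace (i : Fin N) : Set (Pt d) := T.closedElem i ∩ frontier T.domain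

/-- The unit outward normal of element `i`. -/
def normal (i : Fin N) (x : Pt d) : Pt d := outerNormal (T.closedElem i) x

/-- The diameter `h_E` of element `i`. -/
def diam (i : Fin N) : ℝ := Metric.diam (T.closedElem i)

/-- The sum over all interior faces of the integrals of `F i j`, where `i` and `j` are the two
adjacent elements, `i` playing the role of `E⁺` and `j` of `E⁻`. -/
def sumInterior (F : Fin N → Fin N → Pt d → ℝ) : ℝ :=
  ∑ i, ∑ j, if i < j then ∫ x in T.face i j, F i j x ∂(surf d) else 0

/-- The sum over all boundary faces of the integrals of `F i`, with `i` the adjacent element. -/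
def sumBoundary (F : Fin N → Pt d → ℝ) : ℝ :=
  ∑ i, ∫ x in T.bdryFace i, F i x ∂(surf d)

/-- The sum over all elements of the integrals of `F i`. -/
def sumElem (F : Fin N → Pt d → ℝ) : ℝ :=
  ∑ i, ∫ x in T.elem i, F i x

/-! ### Jumps, averages and traces -/

/-- The jump `w⁺ n⁺ + w⁻ n⁻` on the face between `i` and `j`. -/
def jump (w : DGSpace d N r) (i j : Fin N) (x : Pt d) : Pt d :=
  val w i x • T.normal i x + val w j x • T.normal j x

/-- The jump `w n` on a boundary face of element `i`. -/
def jumpB (w : DGSpace d N r) (i : Fin N) (x : Pt d) : Pt d :=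
  val w i x • T.normal i x

/-- The trace at `x` of a matrix field from inside element `i`. -/
def matTrace (a : Pt d → Matrix (Fin d) (Fin d) ℝ) (i : Fin N) (x : Pt d) :
    Matrix (Fin d) (Fin d) ℝ :=
  limUnder (𝓝[T.elem i] x) a

/-- The trace at `x` of `a ∇ w` from inside element `i`. -/
def flux (a : Pt d → Matrix (Fin d) (Fin d) ℝ) (w : DGSpace d N r) (i : Fin N) (x : Pt d) :
    Pt d :=
  op (T.matTrace a i x) (grad w i x)

/-- The average of `a ∇ w` on the face between `i` and `j`. -/
def avgFlux (a : Pt d → Matrix (Fin d) (Fin d) ℝ) (w : DGSpace d N r) (i j : Fin N)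
    (x : Pt d) : Pt d :=
  (1 / 2 : ℝ) • (T.flux a w i x + T.flux a w j x)

/-- The trace `w^out` on the face between `i` and `j` from the downstream side, i.e. from the
element into which `b` points. -/
def downstream (b : Pt d → Pt d) (w : DGSpace d N r) (i j : Fin N) (x : Pt d) : ℝ :=
  if 0 < ⟪b x, T.normal i x⟫ then val w j x else val w i x

/-! ### Coefficients -/

/-- The diffusion coefficient: a bounded, piecewise continuous field of symmetric matrices which is
positive semidefinite almost everywhere in `Ω`. Piecewise continuity enters only through
measurability and the existence, at almost every point of the boundary of each element, of the
one-sided limit from inside that element, and is recorded in this form. -/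
structure IsDiffusion (a : Pt d → Matrix (Fin d) (Fin d) ℝ) : Prop where
  symm : ∀ x ∈ T.domain, (a x).IsSymm
  bounded : ∃ C : ℝ, ∀ x ∈ T.domain, ∀ k l, |a x k l| ≤ C
  measurable : ∀ k l, Measurable fun x => a x k l
  trace : ∀ i, ∀ᵐ x ∂(surf d).restrict (frontier (T.elem i)),
    ∃ A : Matrix (Fin d) (Fin d) ℝ, Tendsto a (𝓝[T.elem i] x) (𝓝 A)
  nonneg : ∀ᵐ x ∂volume.restrict T.domain, ∀ ζ : Pt d, 0 ≤ ⟪ζ, op (a x) ζ⟫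

/-- The `L^∞(E_i)` norm of the matrix 2-norm of `√a`. -/
def abar (a : Pt d → Matrix (Fin d) (Fin d) ℝ) (i : Fin N) : ℝ :=
  (eLpNorm (fun x => ‖op (matSqrt (a x))‖) ∞ (volume.restrict (T.elem i))).toReal

/-- `{ā r²} / h_e` on the face between `i` and `j`. -/
def scale (r : ℕ) (a : Pt d → Matrix (Fin d) (Fin d) ℝ) (i j : Fin N) : ℝ :=
  (1 / 2 * (T.abar a i * (r : ℝ) ^ 2 + T.abar a j * (r : ℝ) ^ 2)) / min (T.diam i) (T.diam j)

/-- `{ā r²} / h_e` on a boundary face of element `i`. -/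
def scaleB (r : ℕ) (a : Pt d → Matrix (Fin d) (Fin d) ℝ) (i : Fin N) : ℝ :=
  T.abar a i * (r : ℝ) ^ 2 / T.diam i

/-! ### The bilinear forms -/

/-- The diffusion part `B_d` of the interior penalty form. -/
def formD (a : Pt d → Matrix (Fin d) (Fin d) ℝ) (θ Cp : ℝ) (w v : DGSpace d N r) : ℝ :=
  T.sumElem (fun i x => ⟪op (a x) (grad w i x), grad v i x⟫)
  + (T.sumInterior (fun i j x => Cp * T.scale r a i j * ⟪T.jump w i j x, T.jump v i j x⟫)
    + T.sumBoundary (fun i x => Cp * T.scaleB r a i * ⟪T.jumpB w i x, T.jumpB v i x⟫))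
  - (T.sumInterior (fun i j x => ⟪T.avgFlux a w i j x, T.jump v i j x⟫
        - θ * ⟪T.avgFlux a v i j x, T.jump w i j x⟫)
    + T.sumBoundary (fun i x => ⟪T.flux a w i x, T.jumpB v i x⟫
        - θ * ⟪T.flux a v i x, T.jumpB w i x⟫))

/-- The advection-reaction part `B_ar`. The last sum is over the inflow boundary `b · n ≤ 0`. -/
def formAR (b : Pt d → Pt d) (c : Pt d → ℝ) (w v : DGSpace d N r) : ℝ :=
  T.sumElem (fun i x => ⟪b x, grad w i x⟫ * val v i x + c x * val w i x * val v i x)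
  - T.sumInterior (fun i j x => ⟪b x, T.jump w i j x⟫ * T.downstream b v i j x)
  - T.sumBoundary (fun i x =>
      if ⟪b x, T.normal i x⟫ ≤ 0 then ⟪b x, T.normal i x⟫ * val w i x * val v i x else 0)

/-- The interior penalty form `B = B_d + B_ar`. -/
def formB (a : Pt d → Matrix (Fin d) (Fin d) ℝ) (b : Pt d → Pt d) (c : Pt d → ℝ) (θ Cp : ℝ)
    (w v : DGSpace d N r) : ℝ :=
  T.formD a θ Cp w v + T.formAR b c w v

/-- The penalty weight `M` on the face between `i` and `j`. -/
def penM (r : ℕ) (a : Pt d → Matrix (Fin d) (Fin d) ℝ) (Car Cd : ℝ) (i j : Fin N) : ℝ :=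
  Car + Cd * T.scale r a i j

/-- The penalty weight `M` on a boundary face of element `i`. -/
def penMB (r : ℕ) (a : Pt d → Matrix (Fin d) (Fin d) ℝ) (Car Cd : ℝ) (i : Fin N) : ℝ :=
  Car + Cd * T.scaleB r a i

/-- The super-penalty form `S`. `TC` is the set of elements of the continuous region; the faces
which lie in the boundary of no element outside `TC` are the interior faces between two
elements of `TC` and the boundary faces of elements of `TC`. -/
def formS (TC : Finset (Fin N)) (a : Pt d → Matrix (Fin d) (Fin d) ℝ) (Car Cd : ℝ)
    (w v : DGSpace d N r) : ℝ :=
  T.sumInterior (fun i j x => if i ∈ TC ∧ j ∈ TC then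
      T.penM r a Car Cd i j * ⟪T.jump w i j x, T.jump v i j x⟫ else 0)
  + T.sumBoundary (fun i x => if i ∈ TC then
      T.penMB r a Car Cd i * ⟪T.jumpB w i x, T.jumpB v i x⟫ else 0)

/-- The super-penalised form `B_σ = B + σ S`. -/
def formBσ (TC : Finset (Fin N)) (a : Pt d → Matrix (Fin d) (Fin d) ℝ) (b : Pt d → Pt d)
    (c : Pt d → ℝ) (θ Cp Car Cd σ : ℝ) (w v : DGSpace d N r) : ℝ :=
  T.formB a b c θ Cp w v + σ * T.formS TC a Car Cd w v

/-- The linear form `ℓ`. -/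
def formL (f : Pt d → ℝ) (w : DGSpace d N r) : ℝ :=
  T.sumElem (fun i x => f x * val w i x)

/-- The norm `‖·‖_dG`. -/
def dGNorm (a : Pt d → Matrix (Fin d) (Fin d) ℝ) (b : Pt d → Pt d) (c : Pt d → ℝ) (Cp : ℝ)
    (w : DGSpace d N r) : ℝ :=
  Real.sqrt
    (T.sumElem (fun i x => ‖op (matSqrt (a x)) (grad w i x)‖ ^ 2)
    + T.sumElem (fun i x => (Real.sqrt (c x - 1 / 2 * divergence b x) * val w i x) ^ 2)
    + (T.sumInterior (fun i j x => 1 / 2 * (|⟪b x, T.normal i x⟫| * ‖T.jump w i j x‖ ^ 2))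
      + T.sumBoundary (fun i x => 1 / 2 * (|⟪b x, T.normal i x⟫| * ‖T.jumpB w i x‖ ^ 2)))
    + (T.sumInterior (fun i j x => Cp * T.scale r a i j * ‖T.jump w i j x‖ ^ 2)
      + T.sumBoundary (fun i x => Cp * T.scaleB r a i * ‖T.jumpB w i x‖ ^ 2)))

/-! ### The continuous region -/

/-- The closure of the continuous region. -/
def closedRegion (TC : Finset (Fin N)) : Set (Pt d) := ⋃ i ∈ TC, T.closedElem i

/-- The space `V_cdG`: broken polynomials which are continuous on the closure of the continuous
region and vanish on the boundary faces of the continuous region. -/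
def cdGSpace (r : ℕ) (TC : Finset (Fin N)) : Submodule ℝ (DGSpace d N r) where
  carrier := {v |
    (∃ g : Pt d → ℝ, ContinuousOn g (T.closedRegion TC) ∧
      ∀ i ∈ TC, ∀ x ∈ T.elem i, g x = val v i x) ∧
    ∀ i ∈ TC, ∀ᵐ x ∂(surf d).restrict (T.bdryFace i), val v i x = 0}
  add_mem' := by
    rintro v w ⟨⟨g, hg, hgv⟩, hv⟩ ⟨⟨k, hk, hkw⟩, hw⟩
    refine ⟨⟨fun x => g x + k x, hg.add hk, fun i hi x hx => ?_⟩, fun i hi => ?_⟩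
    · simp [hgv i hi x hx, hkw i hi x hx, val]
    · filter_upwards [hv i hi, hw i hi] with x h1 h2
      simp only [val] at h1 h2
      simp [val, h1, h2]
  zero_mem' := by
    refine ⟨⟨fun _ => 0, continuousOn_const, fun i _ x _ => ?_⟩, fun i _ => ?_⟩
    · simp [val]
    · exact Filter.Eventually.of_forall fun x => by simp [val]
  smul_mem' := by
    rintro t v ⟨⟨g, hg, hgv⟩, hv⟩
    refine ⟨⟨fun x => t * g x, continuousOn_const.mul hg, fun i hi x hx => ?_⟩, fun i hi => ?_⟩
    · simp [hgv i hi x hx, val, MvPolynomial.smul_eval]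
    · filter_upwards [hv i hi] with x h1
      simp only [val] at h1
      simp [val, MvPolynomial.smul_eval, h1]

/-- Element `k` can be reached from element `i` through elements of the continuous region that
contain `x` in their closure, consecutive ones sharing an interior face. -/
def Linked (TC : Finset (Fin N)) (x : Pt d) : Fin N → Fin N → Prop :=
  Relation.ReflTransGen fun i j =>
    i ∈ TC ∧ j ∈ TC ∧ x ∈ T.closedElem i ∧ x ∈ T.closedElem j ∧ 0 < surf d (T.face i j)

/-- Element `i` is linked at `x` to an element of the continuous region that has a boundary face
containing `x`. -/
def BoundaryLinked (TC : Finset (Fin N)) (x : Pt d) (i : Fin N) : Prop :=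
  ∃ k ∈ TC, T.Linked TC x i k ∧ ∀ ε > 0, 0 < surf d (T.bdryFace k ∩ Metric.ball x ε)

/-- The continuous region is locally connected through faces: any two of its elements that meet in
a point `x` are linked at `x` through faces, or both are linked at `x` to a boundary face
containing `x`. This excludes parts of the continuous region that touch only in a vertex (or in
another set of dimension at most `d - 2`). -/
def FaceConnected (TC : Finset (Fin N)) : Prop :=
  ∀ i ∈ TC, ∀ j ∈ TC, ∀ x ∈ T.closedElem i ∩ T.closedElem j,
    T.Linked TC x i j ∨ (T.BoundaryLinked TC x i ∧ T.BoundaryLinked TC x j)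

/-- The penalty weight `M` is positive on all faces of the continuous region. -/
def PenaltyPos (r : ℕ) (TC : Finset (Fin N)) (a : Pt d → Matrix (Fin d) (Fin d) ℝ)
    (Car Cd : ℝ) : Prop :=
  (∀ i ∈ TC, ∀ j ∈ TC, i ≠ j → 0 < surf d (T.face i j) → 0 < T.penM r a Car Cd i j) ∧
  ∀ i ∈ TC, 0 < surf d (T.bdryFace i) → 0 < T.penMB r a Car Cd i

/-! ### The discrete problems -/

/-- `w` is a dG approximation with super-penalty parameter `σ`. -/
def IsDGSolution (TC : Finset (Fin N)) (a : Pt d → Matrix (Fin d) (Fin d) ℝ) (b : Pt d → Pt d)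
    (c f : Pt d → ℝ) (θ Cp Car Cd σ : ℝ) (w : DGSpace d N r) : Prop :=
  ∀ u : DGSpace d N r, T.formBσ TC a b c θ Cp Car Cd σ w u = T.formL f u

/-- `v` is a cdG approximation. -/
def IsCdGSolution (TC : Finset (Fin N)) (a : Pt d → Matrix (Fin d) (Fin d) ℝ) (b : Pt d → Pt d)
    (c f : Pt d → ℝ) (θ Cp Car Cd σ : ℝ) (v : DGSpace d N r) : Prop :=
  v ∈ T.cdGSpace r TC ∧
    ∀ u ∈ T.cdGSpace r TC, T.formBσ TC a b c θ Cp Car Cd σ v u = T.formL f u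

end Mesh

end CdG

end

noncomputable section

/-! ### Positive semidefinite bilinear forms in finite dimension -/

section BilinearForms

variable {V : Type*} [AddCommGroup V] [Module ℝ V]

/-! The form $B$ is coercive in the dG norm, $S$ is symmetric and positive semidefinite, and the
kernel of $S$ is exactly $V_{cdG}$. The theorem is then the finite-dimensional statement
`exists_penalty_limit`. On the kernel $S$ disappears, so $v_h$ cannot depend on $\sigma$. The error
$e=w_\sigma-v_h$ satisfies $B(e,e)+\sigma S(e,e)=\ell(e)-B(v_h,e)$. The residual on the right
vanishes on the kernel of $S$, so its square is at most $C\,S(e,e)$, and this forces $B(e,e)\le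
C/\sigma$. In finite dimension a positive definite form dominates every seminorm.

Coercivity has two halves. For diffusion (`IsDiffusion.exists_coercive`) the coupling of fluxes and
jumps vanishes as soon as the first argument has no diffusion energy or the second has no penalty
energy. The algebraic lemma `exists_sq_le_mul_of_psd` turns this into $F(w,u)^2\le
C\,D(w,w)\,P(u,u)$. This replaces the usual trace and inverse inequalities, tolerates degenerate
$\mathsf a$, and gives a $C$ that depends only on the mesh, $r$ and $\mathsf a$. For advection and
reaction (`formAR_self`) the diagonal is computed exactly by elementwise integration by parts. This
rests on a divergence theorem for Lipschitz functions on polytopes (`integral_lineDeriv_polytope`),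
obtained from ramp cutoffs whose boundary layers shrink, and on the decomposition of element
boundaries into faces (`integral_frontier_elem`).

For the kernel (`PenaltyPos.mem_cdGSpace_iff`), $S(v,v)=0$ says that the jumps vanish almost
everywhere on the faces. Since the traces are polynomials, agreement on a piece of a hyperplane
spreads over that hyperplane, hence to the whole intersection of two elements that share a face.
Elements that touch only in a smaller set are compared through chains of faces. For the full mesh no
such chain is assumed: a short segment that avoids all intersections of two facet hyperplanes of an
element does the same work (`val_eq_of_forall_face`). -/

theorem sq_apply_le_of_psd (S : V →ₗ[ℝ] V →ₗ[ℝ] ℝ) (hsymm : ∀ x y, S x y = S y x)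
    (hpos : ∀ x, 0 ≤ S x x) (x y : V) : S x y ^ 2 ≤ S x x * S y y :=
  LinearMap.BilinForm.apply_sq_le_of_symm S hpos ⟨fun x y => by simp [hsymm x y]⟩ x y

variable [FiniteDimensional ℝ V]

/-- A Riesz representation for a degenerate form. The hypothesis puts `g` in the annihilator of `ker
S`, which is the range of the dual map of `S`; reflexivity in finite dimension replaces the bidual
preimage by a vector. -/
theorem exists_repr_of_psd (S : V →ₗ[ℝ] V →ₗ[ℝ] ℝ) (hsymm : ∀ x y, S x y = S y x)
    (g : V →ₗ[ℝ] ℝ) (hg : ∀ w, S w w = 0 → g w = 0) : ∃ z, ∀ w, g w = S z w := by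
  have hmem : g ∈ (LinearMap.ker S).dualAnnihilator := by
    rw [Submodule.mem_dualAnnihilator]
    intro w hw
    apply hg
    rw [LinearMap.mem_ker] at hw
    simp [hw]
  rw [← LinearMap.range_dualMap_eq_dualAnnihilator_ker] at hmem
  obtain ⟨Φ, rfl⟩ := hmem
  refine ⟨(Module.evalEquiv ℝ V).symm Φ, fun w => ?_⟩
  rw [hsymm]
  have := Module.apply_evalEquiv_symm_apply (R := ℝ) (M := V) (S w) Φ
  rw [this]
  rfl

/-- Cauchy–Schwarz against the representing vector `z`, so that the constant is `S z z`. -/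
theorem exists_sq_le_of_psd (S : V →ₗ[ℝ] V →ₗ[ℝ] ℝ) (hsymm : ∀ x y, S x y = S y x)
    (hpos : ∀ x, 0 ≤ S x x) (g : V →ₗ[ℝ] ℝ) (hg : ∀ w, S w w = 0 → g w = 0) :
    ∃ C, 0 ≤ C ∧ ∀ w, g w ^ 2 ≤ C * S w w := by
  obtain ⟨z, hz⟩ := exists_repr_of_psd S hsymm g hg
  exact ⟨S z z, hpos z, fun w => by rw [hz]; exact sq_apply_le_of_psd S hsymm hpos z w⟩

/-- A bilinear form that vanishes on the kernels of two positive semidefinite forms is bounded by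
the product of the corresponding seminorms. -/
theorem exists_sq_le_mul_of_psd (P J F : V →ₗ[ℝ] V →ₗ[ℝ] ℝ) (hP : ∀ x y, P x y = P y x)
    (hP0 : ∀ x, 0 ≤ P x x) (hJ : ∀ x y, J x y = J y x) (hJ0 : ∀ x, 0 ≤ J x x)
    (hPF : ∀ w u, P w w = 0 → F w u = 0) (hJF : ∀ w u, J u u = 0 → F w u = 0) :
    ∃ C, 0 ≤ C ∧ ∀ w u, F w u ^ 2 ≤ C * (P w w * J u u) := by
  -- In a `P`-orthogonal basis the coordinates of `w` are controlled by `P w w`, except along the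
  -- null vectors of `P`, where `F` vanishes anyway.
  obtain ⟨e, he⟩ := LinearMap.BilinForm.exists_orthogonal_basis (B := P)
    ⟨fun x y => by simp [hP x y]⟩
  choose C hC0 hC using fun j =>
    exists_sq_le_of_psd J hJ hJ0 (F (e j)) (fun u hu => hJF (e j) u hu)
  -- Division by zero gives `0`, so null basis vectors do not contribute to the constant; the factor
  -- `finrank` comes from squaring a sum.
  refine ⟨Module.finrank ℝ V * ∑ j, C j / P (e j) (e j),
    mul_nonneg (Nat.cast_nonneg _) (Finset.sum_nonneg fun j _ => div_nonneg (hC0 j) (hP0 _)),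
    fun w u => ?_⟩
  have hcoord : ∀ j, P (e j) w = e.repr w j * P (e j) (e j) := by
    intro j
    conv_lhs => rw [← e.sum_repr w]
    rw [map_sum, Finset.sum_eq_single j]
    · simp
    · intro k _ hk
      have : P (e j) (e k) = 0 := he (Ne.symm hk)
      simp [this]
    · simp
  have hF : F w u = ∑ j, e.repr w j * F (e j) u := by
    conv_lhs => rw [← e.sum_repr w]
    simp only [map_sum, map_smul, LinearMap.sum_apply, LinearMap.smul_apply, smul_eq_mul]
  have hterm : ∀ j, (e.repr w j * F (e j) u) ^ 2 ≤ C j / P (e j) (e j) * (P w w * J u u) := by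
    intro j
    rcases (hP0 (e j)).eq_or_lt with h0 | hpos
    · rw [hPF _ _ h0.symm, ← h0]; simp
    · have h1 := sq_apply_le_of_psd P hP hP0 (e j) w
      rw [hcoord j] at h1
      have h2 : (e.repr w j) ^ 2 ≤ P w w / P (e j) (e j) := by
        rw [le_div_iff₀ hpos]
        nlinarith
      calc (e.repr w j * F (e j) u) ^ 2 = (e.repr w j) ^ 2 * (F (e j) u) ^ 2 := by ring
        _ ≤ (P w w / P (e j) (e j)) * (C j * J u u) := by
          gcongr
          · exact div_nonneg (hP0 _) hpos.le
          · exact hC j u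
        _ = _ := by ring
  calc F w u ^ 2 = (∑ j, e.repr w j * F (e j) u) ^ 2 := by rw [hF]
    _ ≤ (Finset.univ : Finset (Fin (Module.finrank ℝ V))).card *
        ∑ j, (e.repr w j * F (e j) u) ^ 2 := sq_sum_le_card_mul_sum_sq
    _ ≤ Module.finrank ℝ V * ∑ j, C j / P (e j) (e j) * (P w w * J u u) := by
      rw [Finset.card_univ, Fintype.card_fin]
      gcongr with j
      exact hterm j
    _ = _ := by rw [← Finset.sum_mul, mul_assoc]

/-- Lax–Milgram in finite dimension. -/
theorem existsUnique_of_pos (B : V →ₗ[ℝ] V →ₗ[ℝ] ℝ) (hB : ∀ w, w ≠ 0 → 0 < B w w)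
    (g : V →ₗ[ℝ] ℝ) : ∃ v, ∀ u, B u = g ↔ u = v := by
  have hinj : Function.Injective B := by
    rw [injective_iff_map_eq_zero]
    intro w hw
    by_contra hne
    have := hB w hne
    simp [hw] at this
  have hsurj : Function.Surjective B :=
    (LinearMap.injective_iff_surjective_of_finrank_eq_finrank
      (Subspace.dual_finrank_eq (K := ℝ) (V := V)).symm).1 hinj
  obtain ⟨v, hv⟩ := hsurj g
  refine ⟨v, fun u => ⟨fun h => hinj (h.trans hv.symm), fun h => h ▸ hv⟩⟩

/-- Since `B` need not be symmetric, it is replaced by its symmetric part, which has the same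
diagonal. Definiteness makes the kernel condition of `exists_sq_le_of_psd` automatic for every
coordinate functional, and a seminorm is bounded by the coordinates. -/
theorem seminorm_le_of_posDef (B : V →ₗ[ℝ] V →ₗ[ℝ] ℝ) (hB : ∀ w, w ≠ 0 → 0 < B w w)
    (p : Seminorm ℝ V) : ∃ C, 0 ≤ C ∧ ∀ w, p w ≤ C * √(B w w) := by
  let S : V →ₗ[ℝ] V →ₗ[ℝ] ℝ := (1 / 2 : ℝ) • (B + B.flip)
  have hS : ∀ w, S w w = B w w := fun w => by simp [S]; ring
  have hB0 : ∀ w, 0 ≤ B w w := fun w => by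
    rcases eq_or_ne w 0 with rfl | h
    · simp
    · exact (hB w h).le
  let e := Module.finBasis ℝ V
  choose C hC0 hC using fun j => exists_sq_le_of_psd S (fun x y => by simp [S]; ring)
    (fun x => by rw [hS]; exact hB0 x) (e.coord j) (fun w hw => by
      rw [hS] at hw
      by_contra h
      have : w ≠ 0 := fun h0 => h (by simp [h0])
      exact (hB w this).ne' hw)
  refine ⟨∑ j, √(C j) * p (e j), Finset.sum_nonneg fun j _ =>
    mul_nonneg (Real.sqrt_nonneg _) (apply_nonneg p _), fun w => ?_⟩
  conv_lhs => rw [← e.sum_repr w]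
  refine (Finset.le_sum_of_subadditive p (map_zero p).le (map_add_le_add p) _ _).trans ?_
  rw [Finset.sum_mul]
  refine Finset.sum_le_sum fun j _ => ?_
  rw [map_smul_eq_mul, Real.norm_eq_abs]
  have h1 : |e.repr w j| ≤ √(C j) * √(B w w) := by
    rw [← Real.sqrt_mul (hC0 j)]
    apply Real.le_sqrt_of_sq_le
    rw [sq_abs, ← hS]
    exact hC j w
  calc _ ≤ √(C j) * √(B w w) * p (e j) := by gcongr
    _ = _ := by ring

/-- Penalisation limit: as `σ → ∞` the solutions of the problems with form `B + σ S` converge to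
the solution of the problem restricted to the kernel of `S`. -/
theorem exists_penalty_limit (B S : V →ₗ[ℝ] V →ₗ[ℝ] ℝ) (hB : ∀ w, w ≠ 0 → 0 < B w w)
    (hS : ∀ x y, S x y = S y x) (hS0 : ∀ x, 0 ≤ S x x) (W : Submodule ℝ V)
    (hW : ∀ w, w ∈ W ↔ S w w = 0) (g : V →ₗ[ℝ] ℝ) :
    ∃ (v : V) (w : ℝ → V),
      (∀ σ ≥ 0, ∀ u, (u ∈ W ∧ ∀ z ∈ W, B u z + σ * S u z = g z) ↔ u = v) ∧
      (∀ σ ≥ 0, ∀ u, (∀ z, B u z + σ * S u z = g z) ↔ u = w σ) ∧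
      Tendsto (fun σ => B (w σ - v) (w σ - v)) atTop (𝓝 0) ∧
      ∀ p : Seminorm ℝ V, Tendsto (fun σ => p (w σ - v)) atTop (𝓝 0) := by
  -- By Cauchy–Schwarz a null vector of `S` is orthogonal to everything. This removes `σ` from the
  -- problem on `W`.
  have hSW : ∀ w ∈ W, ∀ z, S w z = 0 := by
    intro w hw z
    have := sq_apply_le_of_psd S hS hS0 w z
    rw [(hW w).1 hw, zero_mul] at this
    exact pow_eq_zero_iff (two_ne_zero) |>.1 (le_antisymm this (sq_nonneg _))
  obtain ⟨v, hv⟩ := existsUnique_of_pos (V := W) (B.compl₁₂ W.subtype W.subtype)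
    (fun w hw => hB w (by simpa using hw)) (g.comp W.subtype)
  have hvW : ∀ z ∈ W, B v z = g z := fun z hz => by
    have := LinearMap.congr_fun ((hv v).2 rfl) ⟨z, hz⟩
    simpa using this
  choose w hw using fun σ : Set.Ici (0 : ℝ) => existsUnique_of_pos (B + (σ : ℝ) • S)
    (fun w hw => by
      have := hB w hw
      have h2 := mul_nonneg σ.2 (hS0 w)
      simp only [LinearMap.add_apply, LinearMap.smul_apply, smul_eq_mul]
      linarith) g
  -- The solution map is extended by `0` to negative `σ`, where nothing is claimed.
  have hw' : ∀ σ ≥ 0, ∀ u, (∀ z, B u z + σ * S u z = g z) ↔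
      u = (fun σ => if h : 0 ≤ σ then w ⟨σ, h⟩ else 0) σ := by
    intro σ hσ u
    have hσ' : 0 ≤ σ := hσ
    simp only [hσ', dif_pos]
    rw [← hw ⟨σ, hσ⟩ u, LinearMap.ext_iff]
    simp
  generalize (fun σ => if h : 0 ≤ σ then w ⟨σ, h⟩ else 0) = ω at hw'
  have hlim : Tendsto (fun σ => B (ω σ - v) (ω σ - v)) atTop (𝓝 0) := by
    -- The residual of `v` vanishes on `W`, the set of null vectors of `S`, hence is bounded by the
    -- seminorm of `S`.
    obtain ⟨C, hC0, hC⟩ := exists_sq_le_of_psd S hS hS0 (g - B v) (fun z hz => by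
      simp [hvW z ((hW z).2 hz)])
    have hB0 : ∀ w, 0 ≤ B w w := fun w => by
      rcases eq_or_ne w 0 with rfl | h
      · simp
      · exact (hB w h).le
    have hbound : ∀ᶠ σ : ℝ in atTop, B (ω σ - v) (ω σ - v) ≤ C * σ⁻¹ := by
      filter_upwards [eventually_gt_atTop 0] with σ hσ
      set e := ω σ - v with he
      have h1 : B e e + σ * S e e = (g - B v) e := by
        have h2 := (hw' σ hσ.le (ω σ)).2 rfl e
        have hsplit : ω σ = e + v := by rw [he, sub_add_cancel]
        rw [hsplit] at h2
        simp only [map_add, LinearMap.add_apply, hSW v v.2, add_zero] at h2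
        rw [LinearMap.sub_apply, ← h2]
        ring
      have h4 := hC e
      have h5 := hB0 e
      rw [← h1] at h4
      have h6 := hS0 e
      rw [← div_eq_mul_inv, le_div_iff₀ hσ]
      -- With $x=B(e,e)$ and $y=\sigma S(e,e)$ the estimate reads $(x+y)^2\sigma\le Cy$. If
      -- $x\sigma>C$, then $x>0$ and $(x+y)^2\sigma\ge x\cdot x\sigma+x\sigma\cdot y>Cy$, a
      -- contradiction.
      by_contra hcon
      push Not at hcon
      have h7 : 0 ≤ σ * S e e := by positivity
      have h9 : (B e e + σ * S e e) ^ 2 * σ ≤ C * S e e * σ :=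
        mul_le_mul_of_nonneg_right h4 hσ.le
      have h10 : (B e e + σ * S e e) ^ 2 * σ ≥ (B e e) * (B e e * σ) + (B e e * σ) * (σ * S e e) := by
        nlinarith [mul_nonneg (mul_nonneg h5 h7) hσ.le, mul_nonneg (sq_nonneg (σ * S e e)) hσ.le]
      have h11 : 0 < B e e := by
        by_contra h
        have : B e e = 0 := le_antisymm (not_lt.1 h) h5
        rw [this] at hcon
        linarith
      nlinarith [mul_pos h11 (mul_pos h11 hσ), mul_le_mul_of_nonneg_right hcon.le h7]
    refine tendsto_of_tendsto_of_tendsto_of_le_of_le' tendsto_const_nhds ?_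
      (Eventually.of_forall fun σ => hB0 _) hbound
    simpa using tendsto_inv_atTop_zero.const_mul C
  refine ⟨v, ω, fun σ _ u => ⟨?_, ?_⟩, hw', hlim, fun p => ?_⟩
  · rintro ⟨huW, hu⟩
    have : (⟨u, huW⟩ : W) = v := (hv _).1 (by
      ext z
      have := hu z z.2
      rw [hSW u huW] at this
      simpa using this)
    rw [← this]
  · rintro rfl
    refine ⟨v.2, fun z hz => ?_⟩
    rw [hSW v v.2, hvW z hz]
    simp
  · obtain ⟨C, hC0, hC⟩ := seminorm_le_of_posDef B hB p
    refine squeeze_zero (fun σ => apply_nonneg p _) (fun σ => hC _) ?_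
    have := (Real.continuous_sqrt.tendsto 0).comp hlim
    simpa using this.const_mul C

end BilinearForms

/-! ### Hyperplanes and their surface measure -/

namespace CdG

/-- Appending a zero first coordinate. -/
def consZero (n : ℕ) : Pt n →ₗᵢ[ℝ] Pt (n + 1) where
  toFun z := WithLp.toLp 2 (Fin.cons 0 fun k => z k)
  map_add' x y := by
    ext k
    refine Fin.cases ?_ (fun k => ?_) k <;> simp
  map_smul' t x := by
    ext k
    refine Fin.cases ?_ (fun k => ?_) k <;> simp
  norm_map' x := by
    simp [EuclideanSpace.norm_eq, Fin.sum_univ_succ]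

theorem exists_orthonormalBasis_zero_eq {n : ℕ} (ν : Pt (n + 1)) (hν : ‖ν‖ = 1) :
    ∃ e : OrthonormalBasis (Fin (n + 1)) ℝ (Pt (n + 1)), e 0 = ν := by
  have hv : Orthonormal ℝ (Set.domRestrict ({0} : Set (Fin (n + 1))) (fun _ => ν)) := by
    refine ⟨fun i => hν, fun i j hij => ?_⟩
    exact absurd (Subsingleton.elim i j) hij
  obtain ⟨b, hb⟩ := Orthonormal.exists_orthonormalBasis_extension_of_card_eq (𝕜 := ℝ)
    (E := Pt (n + 1)) (ι := Fin (n + 1)) (by simp) hv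
  exact ⟨b, hb 0 rfl⟩

/-- An affine isometric parametrisation of a hyperplane, which together with the normal direction
gives a measure preserving parametrisation of the whole space. -/
theorem exists_hyperplane_param {n : ℕ} (ν : Pt (n + 1)) (hν : ‖ν‖ = 1) (c : ℝ) :
    ∃ ι : Pt n →ᵃ[ℝ] Pt (n + 1), Isometry ι ∧ Set.range ι = {x | ⟪ν, x⟫ = c} ∧
      MeasurePreserving (fun p : Pt n × ℝ => ι p.1 + p.2 • ν) (volume.prod volume) volume := by
  obtain ⟨e, he⟩ := exists_orthonormalBasis_zero_eq ν hν
  let A : Pt n →ₗᵢ[ℝ] Pt (n + 1) := e.repr.symm.toLinearIsometry.comp (consZero n)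
  let ι : Pt n →ᵃ[ℝ] Pt (n + 1) := A.toLinearMap.toAffineMap + AffineMap.const ℝ _ (c • ν)
  have hι : ∀ z, ι z = A z + c • ν := fun z => rfl
  have hsplit : ∀ (z : Pt n) (s : ℝ),
      A z + s • ν = e.repr.symm (WithLp.toLp 2 (Fin.cons s fun k => z k)) := by
    intro z s
    have : s • ν = e.repr.symm (s • EuclideanSpace.single 0 1) := by
      rw [map_smul, e.repr_symm_single, he]
    rw [this]
    change e.repr.symm _ + _ = _
    rw [← map_add]
    congr 1
    ext k
    refine Fin.cases ?_ (fun k => ?_) k <;> simp [consZero]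
  refine ⟨ι, ?_, ?_, ?_⟩
  · refine Isometry.of_dist_eq fun x y => ?_
    rw [hι, hι, dist_add_right, A.dist_map]
  · ext x
    simp only [Set.mem_range, Set.mem_ofPred_eq, hι, hsplit]
    constructor
    · rintro ⟨z, rfl⟩
      rw [← he, ← e.repr_apply_apply]
      simp
    · intro hx
      refine ⟨WithLp.toLp 2 fun k => e.repr x k.succ, ?_⟩
      rw [LinearIsometryEquiv.symm_apply_eq]
      ext k
      refine Fin.cases ?_ (fun k => ?_) k
      · simp [e.repr_apply_apply, he, hx]
      · simp
  -- The parametrisation is a composition of a swap, the insertion of a coordinate, a rotation and a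
  -- translation, each of which preserves volume.
  · have h1 : MeasurePreserving (fun p : Pt n × ℝ => (p.2, WithLp.ofLp p.1))
        (volume.prod volume) (volume.prod volume) :=
      ((MeasurePreserving.id (volume : Measure ℝ)).prod
        (PiLp.volume_preserving_ofLp (Fin n))).comp Measure.measurePreserving_swap
    have h2 := (volume_preserving_piFinSuccAbove (fun _ : Fin (n + 1) => ℝ) 0).symm
    have h3 := PiLp.volume_preserving_toLp (Fin (n + 1))
    have h4 := e.measurePreserving_repr_symm
    have h5 := measurePreserving_add_right (volume : Measure (Pt (n + 1))) (c • ν)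
    have := h5.comp (h4.comp (h3.comp (h2.comp h1)))
    convert this using 1
    ext1 p
    change A p.1 + c • ν + p.2 • ν = e.repr.symm (WithLp.toLp 2 (Fin.insertNth 0 p.2 p.1)) + c • ν
    rw [add_right_comm, hsplit, Fin.insertNth_zero]
    rfl

/-- Normalised Hausdorff measure is transported by isometries and equals Lebesgue measure on `Pt n`;
surface integrals over a hyperplane thus become ordinary integrals. -/
theorem surf_restrict_hyperplane {n : ℕ} {ν : Pt (n + 1)} {c : ℝ} {ι : Pt n →ᵃ[ℝ] Pt (n + 1)}
    (hι : Isometry ι) (hr : Set.range ι = {x | ⟪ν, x⟫ = c}) :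
    (surf (n + 1)).restrict {x | ⟪ν, x⟫ = c} = volume.map ι := by
  have := hι.map_euclideanHausdorffMeasure (d := n)
  rw [hr, EuclideanSpace.euclideanHausdorffMeasure_eq_volume] at this
  rw [this]
  rfl

theorem surf_image {n : ℕ} {ι : Pt n →ᵃ[ℝ] Pt (n + 1)} (hι : Isometry ι) (s : Set (Pt n)) :
    surf (n + 1) (ι '' s) = volume s := by
  have := hι.euclideanHausdorffMeasure_image (d := n) s
  rw [EuclideanSpace.euclideanHausdorffMeasure_eq_volume] at this
  exact this

/-- A nonzero affine function vanishes only on a null set. -/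
theorem volume_affine_zero {n : ℕ} (f : Pt n →ᵃ[ℝ] ℝ) (hf : ∃ x, f x ≠ 0) :
    volume {x | f x = 0} = 0 := by
  let s : AffineSubspace ℝ (Pt n) := (AffineSubspace.mk' (0 : ℝ) ⊥).comap f
  have hs : (s : Set (Pt n)) = {x | f x = 0} := by
    ext x; simp [s]
  rw [← hs]
  apply Measure.addHaar_affineSubspace
  rintro h
  obtain ⟨x, hx⟩ := hf
  have : x ∈ (s : Set (Pt n)) := by rw [h]; trivial
  rw [hs] at this
  exact hx this

/-- An affine function that is not identically zero on a hyperplane vanishes there only on a null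
set. -/
theorem surf_hyperplane_inter_affine_zero {n : ℕ} {ν : Pt (n + 1)} (hν : ‖ν‖ = 1) {c : ℝ}
    (f : Pt (n + 1) →ᵃ[ℝ] ℝ) (hf : ∃ x, ⟪ν, x⟫ = c ∧ f x ≠ 0) :
    surf (n + 1) {x | ⟪ν, x⟫ = c ∧ f x = 0} = 0 := by
  obtain ⟨ι, hι, hr, -⟩ := exists_hyperplane_param ν hν c
  have : {x | ⟪ν, x⟫ = c ∧ f x = 0} = ι '' {z | f (ι z) = 0} := by
    ext x
    simp only [Set.mem_ofPred_eq, Set.mem_image]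
    constructor
    · rintro ⟨h1, h2⟩
      obtain ⟨z, rfl⟩ : x ∈ Set.range ι := by rw [hr]; exact h1
      exact ⟨z, h2, rfl⟩
    · rintro ⟨z, hz, rfl⟩
      have : ι z ∈ Set.range ι := ⟨z, rfl⟩
      rw [hr] at this
      exact ⟨this, hz⟩
  rw [this, surf_image hι]
  refine volume_affine_zero (f.comp ι) ?_
  obtain ⟨x, hx, hfx⟩ := hf
  obtain ⟨z, rfl⟩ : x ∈ Set.range ι := by rw [hr]; exact hx
  exact ⟨z, hfx⟩

/-- Bounded pieces of a hyperplane have finite surface measure. -/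
theorem surf_hyperplane_inter_lt_top {n : ℕ} {ν : Pt (n + 1)} (hν : ‖ν‖ = 1) {c : ℝ}
    {s : Set (Pt (n + 1))} (hs : Bornology.IsBounded s) :
    surf (n + 1) (s ∩ {x | ⟪ν, x⟫ = c}) < ∞ := by
  obtain ⟨ι, hι, hr, -⟩ := exists_hyperplane_param ν hν c
  rw [← hr, ← Set.image_preimage_eq_inter_range, surf_image hι]
  exact (hι.antilipschitz.isBounded_preimage hs).measure_lt_top

/-- Relatively open nonempty pieces of a hyperplane have positive surface measure. -/
theorem surf_hyperplane_inter_open_pos {n : ℕ} {ν : Pt (n + 1)} (hν : ‖ν‖ = 1) {c : ℝ}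
    {s : Set (Pt (n + 1))} (hs : IsOpen s) (hne : (s ∩ {x | ⟪ν, x⟫ = c}).Nonempty) :
    0 < surf (n + 1) (s ∩ {x | ⟪ν, x⟫ = c}) := by
  obtain ⟨ι, hι, hr, -⟩ := exists_hyperplane_param ν hν c
  rw [← hr] at hne ⊢
  rw [← Set.image_preimage_eq_inter_range, surf_image hι]
  obtain ⟨_, hx, z, rfl⟩ := hne
  exact (hs.preimage hι.continuous).measure_pos _ ⟨z, hx⟩

end CdG

/-! ### The divergence theorem on polytopes -/

namespace CdG

/-- The piecewise linear ramp from `0` at `0` to `1` at `ε`. -/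
def ramp (ε t : ℝ) : ℝ := max 0 (min 1 (t / ε))

theorem ramp_nonneg (ε t : ℝ) : 0 ≤ ramp ε t := le_max_left _ _

theorem ramp_le_one (ε t : ℝ) : ramp ε t ≤ 1 := max_le zero_le_one (min_le_left _ _)

theorem ramp_of_nonpos {ε t : ℝ} (hε : 0 < ε) (ht : t ≤ 0) : ramp ε t = 0 := by
  have : t / ε ≤ 0 := div_nonpos_of_nonpos_of_nonneg ht hε.le
  simp [ramp, this]

theorem ramp_of_ge {ε t : ℝ} (hε : 0 < ε) (ht : ε ≤ t) : ramp ε t = 1 := by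
  have : 1 ≤ t / ε := (one_le_div hε).2 ht
  simp [ramp, this]

theorem continuous_ramp (ε : ℝ) : Continuous (ramp ε) := by
  unfold ramp; fun_prop

theorem ramp_lipschitz (ε : ℝ) : LipschitzWith ‖ε⁻¹‖₊ (ramp ε) := by
  have h : LipschitzWith ‖ε⁻¹‖₊ fun t : ℝ => t / ε := by
    refine LipschitzWith.of_dist_le_mul fun x y => ?_
    rw [Real.dist_eq, Real.dist_eq, ← sub_div, abs_div, div_eq_mul_inv, mul_comm]
    simp
  exact (h.const_min 1).const_max 0

theorem hasDerivAt_ramp {ε t : ℝ} (hε : 0 < ε) (h0 : t ≠ 0) (h1 : t ≠ ε) :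
    HasDerivAt (ramp ε) (if 0 < t ∧ t < ε then ε⁻¹ else 0) t := by
  rcases lt_or_gt_of_ne h0 with h | h
  · rw [if_neg (fun h' => absurd h'.1 h.not_gt)]
    refine (hasDerivAt_const t (0 : ℝ)).congr_of_eventuallyEq ?_
    filter_upwards [Iio_mem_nhds h] with s hs
    exact ramp_of_nonpos hε (le_of_lt hs)
  · rcases lt_or_gt_of_ne h1 with h' | h'
    · rw [if_pos ⟨h, h'⟩]
      have : HasDerivAt (fun s : ℝ => s / ε) (ε⁻¹) t := by
        simpa [div_eq_mul_inv] using (hasDerivAt_id t).mul_const ε⁻¹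
      refine this.congr_of_eventuallyEq ?_
      filter_upwards [Ioo_mem_nhds h h'] with s hs
      have h2 : 0 ≤ s / ε := div_nonneg hs.1.le hε.le
      have h3 : s / ε ≤ 1 := (div_le_one hε).2 hs.2.le
      simp [ramp, h2, h3]
    · rw [if_neg (fun h'' => absurd h''.2 h'.not_gt)]
      refine (hasDerivAt_const t (1 : ℝ)).congr_of_eventuallyEq ?_
      filter_upwards [Ioi_mem_nhds h'] with s hs
      exact ramp_of_ge hε (le_of_lt hs)

/-- The argument may move with `ε` because the ramps are evaluated at points that approach a facet.
As `f ε` stays away from `0` while `ε` shrinks, the value is eventually constant. -/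
theorem tendsto_ramp {f : ℝ → ℝ} {t : ℝ} (hf : Tendsto f (𝓝[>] 0) (𝓝 t)) (ht : t ≠ 0) :
    Tendsto (fun ε => ramp ε (f ε)) (𝓝[>] 0) (𝓝 (if 0 < t then 1 else 0)) := by
  have hpos : ∀ᶠ ε : ℝ in 𝓝[>] 0, 0 < ε := self_mem_nhdsWithin
  rcases lt_or_gt_of_ne ht with h | h
  · rw [if_neg h.not_gt]
    refine tendsto_const_nhds.congr' ?_
    filter_upwards [hf.eventually (Iio_mem_nhds h), hpos] with ε h1 h2
    exact (ramp_of_nonpos h2 (le_of_lt h1)).symm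
  · rw [if_pos h]
    refine tendsto_const_nhds.congr' ?_
    have h2 : ∀ᶠ ε : ℝ in 𝓝[>] 0, ε < t / 2 :=
      nhdsWithin_le_nhds (Iio_mem_nhds (half_pos h))
    filter_upwards [hf.eventually (Ioi_mem_nhds (half_lt_self h)), hpos, h2] with ε h1 h2 h3
    exact (ramp_of_ge h2 (h3.trans h1).le).symm

theorem exists_lipschitz_prod {α κ : Type*} [PseudoMetricSpace α] (s : Finset κ) (f : κ → α → ℝ)
    (hf : ∀ k, ∃ C, LipschitzWith C (f k)) (h0 : ∀ k x, 0 ≤ f k x) (h1 : ∀ k x, f k x ≤ 1) :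
    ∃ C, LipschitzWith C fun x => ∏ k ∈ s, f k x := by
  classical
  induction s using Finset.induction_on with
  | empty => exact ⟨0, by simp⟩
  | insert a s ha ih =>
    obtain ⟨C, hC⟩ := ih
    obtain ⟨D, hD⟩ := hf a
    refine ⟨D + C, LipschitzWith.of_dist_le_mul fun x y => ?_⟩
    simp only [Finset.prod_insert ha, Real.dist_eq]
    have hC' := hC.dist_le_mul x y
    have hD' := hD.dist_le_mul x y
    rw [Real.dist_eq] at hC' hD'
    have hp0 : 0 ≤ ∏ k ∈ s, f k x := Finset.prod_nonneg fun k _ => h0 k x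
    have hp1 : ∏ k ∈ s, f k x ≤ 1 := Finset.prod_le_one (fun k _ => h0 k x) fun k _ => h1 k x
    calc |f a x * ∏ k ∈ s, f k x - f a y * ∏ k ∈ s, f k y|
        = |(f a x - f a y) * ∏ k ∈ s, f k x + f a y * (∏ k ∈ s, f k x - ∏ k ∈ s, f k y)| := by
          congr 1; ring
      _ ≤ |f a x - f a y| * ∏ k ∈ s, f k x + f a y * |∏ k ∈ s, f k x - ∏ k ∈ s, f k y| := by
          refine (abs_add_le _ _).trans ?_
          rw [abs_mul, abs_mul, abs_of_nonneg hp0, abs_of_nonneg (h0 a y)]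
      _ ≤ |f a x - f a y| * 1 + 1 * |∏ k ∈ s, f k x - ∏ k ∈ s, f k y| := by
          gcongr
          exact h1 a y
      _ ≤ D * dist x y + C * dist x y := by rw [mul_one, one_mul]; gcongr
      _ = _ := by push_cast; ring

/-- This stretches a layer of width `ε` to width `1`; the factor `ε` cancels the slope `ε⁻¹` of the
ramp. -/
theorem integral_prod_mul_snd {X : Type*} [MeasurableSpace X] (μ : Measure X) [SFinite μ]
    (g : X × ℝ → ℝ) {ε : ℝ} (hε : 0 < ε) :
    ∫ p, g p ∂(μ.prod volume) = ∫ p, ε * g (p.1, ε * p.2) ∂(μ.prod volume) := by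
  let e : X × ℝ ≃ᵐ X × ℝ :=
    (MeasurableEquiv.refl X).prodCongr (Homeomorph.mulLeft₀ ε hε.ne').toMeasurableEquiv
  have hmap : (μ.prod volume).map e = ENNReal.ofReal ε⁻¹ • μ.prod volume := by
    have h := Measure.map_prod_map μ (volume : Measure ℝ) measurable_id
      (measurable_const_mul ε)
    have h' : (μ.prod volume).map e =
      Measure.map (Prod.map id (fun x => ε * x)) (μ.prod volume) := rfl
    rw [h', ← h, Measure.map_id, Real.map_volume_mul_left hε.ne', Measure.prod_smul_right,
      abs_of_pos (inv_pos.2 hε)]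
  have h2 := integral_map_equiv (μ := μ.prod volume) e g
  rw [hmap, integral_smul_measure, ENNReal.toReal_ofReal (inv_pos.2 hε).le, smul_eq_mul] at h2
  rw [integral_const_mul]
  have h3 : ∫ p, g (p.1, ε * p.2) ∂(μ.prod volume) = ∫ p, g (e p) ∂(μ.prod volume) := rfl
  rw [h3, ← h2]
  field_simp

section Polytope

variable {n : ℕ} {κ : Type*}

/-- The polytope cut out by the half spaces `c k ≤ ⟪ν k, x⟫`. -/
def polytope (ν : κ → Pt (n + 1)) (c : κ → ℝ) : Set (Pt (n + 1)) := {x | ∀ k, c k ≤ ⟪ν k, x⟫}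

theorem isClosed_polytope (ν : κ → Pt (n + 1)) (c : κ → ℝ) : IsClosed (polytope ν c) := by
  have : polytope ν c = ⋂ k, {x | c k ≤ ⟪ν k, x⟫} := by ext; simp [polytope]
  rw [this]
  exact isClosed_iInter fun k => isClosed_le continuous_const (by fun_prop)

variable [Fintype κ] [DecidableEq κ]

/-- One term of the derivative of the cutoff: slope `ε⁻¹` on the layer of width `ε` above the `i`-th
hyperplane, times the remaining ramps. In stretched coordinates the layer is a fixed product of the
hyperplane with `(0,1)`, and the remaining ramps tend to the indicator of the polytope off the
corners, which are null by `hnull`. Dominated convergence gives the facet integral. -/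
theorem tendsto_integral_layer {ν : κ → Pt (n + 1)} (hν : ∀ k, ‖ν k‖ = 1) {c : κ → ℝ}
    (hb : Bornology.IsBounded (polytope ν c))
    (hnull : ∀ i j, i ≠ j → surf (n + 1) {x | ⟪ν i, x⟫ = c i ∧ ⟪ν j, x⟫ = c j} = 0)
    {ψ : Pt (n + 1) → ℝ} (hψ : Continuous ψ) (i : κ) :
    Tendsto (fun ε => ∫ x, (∏ j ∈ Finset.univ.erase i, ramp ε (⟪ν j, x⟫ - c j)) *
        (if 0 < ⟪ν i, x⟫ - c i ∧ ⟪ν i, x⟫ - c i < ε then ε⁻¹ else 0) * ψ x) (𝓝[>] 0)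
      (𝓝 (∫ x in polytope ν c ∩ {x | ⟪ν i, x⟫ = c i}, ψ x ∂(surf (n + 1)))) := by
  obtain ⟨ι, hι, hr, hmp⟩ := exists_hyperplane_param (ν i) (hν i) (c i)
  have hιH : ∀ z, ⟪ν i, ι z⟫ = c i := fun z => by
    have : ι z ∈ Set.range ι := ⟨z, rfl⟩
    rwa [hr] at this
  have hνν : ⟪ν i, ν i⟫ = (1 : ℝ) := by rw [real_inner_self_eq_norm_sq, hν]; norm_num
  have hpos : ∀ᶠ ε : ℝ in 𝓝[>] 0, 0 < ε := self_mem_nhdsWithin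
  have hlt1 : ∀ᶠ ε : ℝ in 𝓝[>] 0, ε < 1 := nhdsWithin_le_nhds (Iio_mem_nhds one_pos)
  have hιc := hι.continuous
  -- the integrand in the coordinates of the layer
  let G : ℝ → Pt n × ℝ → ℝ := fun ε p =>
    (∏ j ∈ Finset.univ.erase i, ramp ε (⟪ν j, ι p.1 + (ε * p.2) • ν i⟫ - c j)) *
      (if 0 < p.2 ∧ p.2 < 1 then 1 else 0) * ψ (ι p.1 + (ε * p.2) • ν i)
  have hmeas : ∀ ε, Measurable fun x => (∏ j ∈ Finset.univ.erase i, ramp ε (⟪ν j, x⟫ - c j)) *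
        (if 0 < ⟪ν i, x⟫ - c i ∧ ⟪ν i, x⟫ - c i < ε then ε⁻¹ else 0) * ψ x := by
    intro ε
    refine Measurable.mul (Measurable.mul ?_ ?_) hψ.measurable
    · exact (continuous_finsetProd _ fun j _ => (continuous_ramp ε).comp (by fun_prop)).measurable
    · refine Measurable.ite ?_ measurable_const measurable_const
      exact (by fun_prop : Measurable fun x : Pt (n + 1) => ⟪ν i, x⟫ - c i) measurableSet_Ioo
  have hGmeas : ∀ ε, Measurable (G ε) := by
    intro ε
    refine Measurable.mul (Measurable.mul ?_ ?_) (by fun_prop)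
    · exact (continuous_finsetProd _ fun j _ => (continuous_ramp ε).comp
        (by fun_prop)).measurable
    · refine Measurable.ite ?_ measurable_const measurable_const
      exact measurable_snd measurableSet_Ioo
  have hcov : ∀ᶠ ε : ℝ in 𝓝[>] 0, ∫ p, G ε p ∂(volume.prod volume) =
      ∫ x, (∏ j ∈ Finset.univ.erase i, ramp ε (⟪ν j, x⟫ - c j)) *
        (if 0 < ⟪ν i, x⟫ - c i ∧ ⟪ν i, x⟫ - c i < ε then ε⁻¹ else 0) * ψ x := by
    filter_upwards [hpos] with ε hε
    conv_rhs => rw [← hmp.map_eq, integral_map hmp.measurable.aemeasurable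
      (hmeas ε).aestronglyMeasurable, integral_prod_mul_snd _ _ hε]
    refine integral_congr_ae (Eventually.of_forall fun p => ?_)
    have h1 : ⟪ν i, ι p.1 + (ε * p.2) • ν i⟫ - c i = ε * p.2 := by
      rw [inner_add_right, inner_smul_right, hιH, hνν]; ring
    have h2 : (0 < ε * p.2 ∧ ε * p.2 < ε) ↔ (0 < p.2 ∧ p.2 < 1) := by
      rw [mul_pos_iff_of_pos_left hε, mul_lt_iff_lt_one_right hε]
    simp only [G, h1, h2]
    split_ifs
    · field_simp
    · ring
  let g : Pt n → ℝ := fun z =>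
    (∏ j ∈ Finset.univ.erase i, if 0 < ⟪ν j, ι z⟫ - c j then (1 : ℝ) else 0) * ψ (ι z)
  have hae : ∀ᵐ z : Pt n, ∀ j, j ≠ i → ⟪ν j, ι z⟫ - c j ≠ 0 := by
    rw [ae_all_iff]
    intro j
    by_cases hj : j = i
    · exact Eventually.of_forall fun z h => absurd hj h
    · have h1 := hnull i j (Ne.symm hj)
      have h2 : {x | ⟪ν i, x⟫ = c i ∧ ⟪ν j, x⟫ = c j} = ι '' {z | ⟪ν j, ι z⟫ - c j = 0} := by
        ext x
        simp only [Set.mem_ofPred_eq, Set.mem_image, sub_eq_zero]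
        constructor
        · rintro ⟨h1, h2⟩
          obtain ⟨z, rfl⟩ : x ∈ Set.range ι := by rw [hr]; exact h1
          exact ⟨z, h2, rfl⟩
        · rintro ⟨z, hz, rfl⟩
          exact ⟨hιH z, hz⟩
      rw [h2, surf_image hι] at h1
      have h3 : ∀ᵐ z : Pt n, ¬ (⟪ν j, ι z⟫ - c j = 0) := by
        rw [ae_iff]; simpa using h1
      filter_upwards [h3] with z hz _ using hz
  have hlim : Tendsto (fun ε => ∫ p, G ε p ∂(volume.prod volume)) (𝓝[>] 0)
      (𝓝 (∫ p : Pt n × ℝ, g p.1 * (if 0 < p.2 ∧ p.2 < 1 then 1 else 0)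
        ∂(volume.prod volume))) := by
    obtain ⟨R, hR⟩ := hb.subset_closedBall 0
    obtain ⟨M, hM⟩ := (isCompact_closedBall (0 : Pt (n + 1)) R).exists_bound_of_continuousOn
      hψ.continuousOn
    -- The foot of a point of the layer is at distance less than `1` from it, since `ε < 1`; hence
    -- the radius `R + 1`.
    let D : Set (Pt n × ℝ) := (ι ⁻¹' Metric.closedBall 0 (R + 1)) ×ˢ Set.Ioo 0 1
    refine tendsto_integral_filter_of_dominated_convergence (D.indicator fun _ => |M|)
      (Eventually.of_forall fun ε => (hGmeas ε).aestronglyMeasurable) ?_ ?_ ?_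
    · filter_upwards [hpos, hlt1] with ε hε hε1
      refine Eventually.of_forall fun p => ?_
      by_cases h0 : G ε p = 0
      · rw [h0, norm_zero]
        exact Set.indicator_nonneg (fun _ _ => abs_nonneg M) _
      · have hp : 0 < p.2 ∧ p.2 < 1 := by
          by_contra h
          exact h0 (by simp [G, h])
        -- Every other ramp vanishes outside its half space, so the integrand is supported in the
        -- bounded polytope.
        have hK : ι p.1 + (ε * p.2) • ν i ∈ polytope ν c := by
          intro j
          by_cases hj : j = i
          · subst hj
            rw [inner_add_right, inner_smul_right, hιH, hνν]
            have := mul_pos hε hp.1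
            linarith
          · by_contra h
            push Not at h
            apply h0
            have : (∏ j ∈ Finset.univ.erase i,
                ramp ε (⟪ν j, ι p.1 + (ε * p.2) • ν i⟫ - c j)) = 0 :=
              Finset.prod_eq_zero (Finset.mem_erase.2 ⟨hj, Finset.mem_univ j⟩)
                (ramp_of_nonpos hε (by linarith))
            simp [G, this]
        have hx := hR hK
        have hpD : p ∈ D := by
          refine ⟨?_, hp⟩
          rw [Set.mem_preimage, mem_closedBall_zero_iff]
          rw [mem_closedBall_zero_iff] at hx
          calc ‖ι p.1‖ = ‖(ι p.1 + (ε * p.2) • ν i) - (ε * p.2) • ν i‖ := by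
                rw [add_sub_cancel_right]
            _ ≤ ‖ι p.1 + (ε * p.2) • ν i‖ + ‖(ε * p.2) • ν i‖ := norm_sub_le _ _
            _ ≤ R + 1 := by
              gcongr
              rw [norm_smul, hν, mul_one, Real.norm_eq_abs, abs_of_pos (mul_pos hε hp.1)]
              nlinarith [hp.1, hp.2]
        rw [Set.indicator_of_mem hpD]
        simp only [G, if_pos hp, mul_one, norm_mul]
        have hprod : ‖∏ j ∈ Finset.univ.erase i,
            ramp ε (⟪ν j, ι p.1 + (ε * p.2) • ν i⟫ - c j)‖ ≤ 1 := by
          rw [Real.norm_of_nonneg (Finset.prod_nonneg fun _ _ => ramp_nonneg _ _)]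
          exact Finset.prod_le_one (fun _ _ => ramp_nonneg _ _) fun _ _ => ramp_le_one _ _
        calc _ ≤ 1 * ‖ψ (ι p.1 + (ε * p.2) • ν i)‖ := by gcongr
          _ ≤ |M| := by rw [one_mul]; exact (hM _ hx).trans (le_abs_self M)
    · have hbd : Bornology.IsBounded (ι ⁻¹' Metric.closedBall 0 (R + 1)) :=
        hι.antilipschitz.isBounded_preimage Metric.isBounded_closedBall
      have hDm : MeasurableSet D :=
        (hιc.measurable measurableSet_closedBall).prod measurableSet_Ioo
      rw [integrable_indicator_iff hDm]
      refine integrableOn_const (hs := ?_)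
      rw [Measure.prod_prod]
      exact ENNReal.mul_ne_top hbd.measure_lt_top.ne (by simp)
    · filter_upwards [Measure.quasiMeasurePreserving_fst.ae hae] with p hp
      have hx : Tendsto (fun ε : ℝ => ι p.1 + (ε * p.2) • ν i) (𝓝[>] 0) (𝓝 (ι p.1)) := by
        have : Continuous fun ε : ℝ => ι p.1 + (ε * p.2) • ν i := by fun_prop
        have := (this.tendsto 0).mono_left (nhdsWithin_le_nhds (s := Set.Ioi 0))
        simpa using this
      have h1 : Tendsto (fun ε => ∏ j ∈ Finset.univ.erase i,
          ramp ε (⟪ν j, ι p.1 + (ε * p.2) • ν i⟫ - c j)) (𝓝[>] 0)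
          (𝓝 (∏ j ∈ Finset.univ.erase i, if 0 < ⟪ν j, ι p.1⟫ - c j then (1 : ℝ) else 0)) := by
        refine tendsto_finsetProd _ fun j hj => ?_
        exact tendsto_ramp (((tendsto_const_nhds.inner hx)).sub_const _)
          (hp j (Finset.ne_of_mem_erase hj))
      have := (h1.mul_const (if 0 < p.2 ∧ p.2 < 1 then (1 : ℝ) else 0)).mul
        ((hψ.tendsto _).comp hx)
      refine Tendsto.congr' (Eventually.of_forall fun ε => rfl) (this.trans (le_of_eq ?_))
      congr 1
      simp only [g]
      ring
  have hval : ∫ p : Pt n × ℝ, g p.1 * (if 0 < p.2 ∧ p.2 < 1 then 1 else 0)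
        ∂(volume.prod volume) =
      ∫ x in polytope ν c ∩ {x | ⟪ν i, x⟫ = c i}, ψ x ∂(surf (n + 1)) := by
    rw [integral_prod_mul g fun t : ℝ => if 0 < t ∧ t < 1 then (1 : ℝ) else 0]
    have h1 : ∫ t : ℝ, (if 0 < t ∧ t < 1 then (1 : ℝ) else 0) = 1 := by
      have : (fun t : ℝ => if 0 < t ∧ t < 1 then (1 : ℝ) else 0) =
          (Set.Ioo 0 1).indicator 1 := by
        ext t; simp [Set.indicator_apply]
      rw [this, integral_indicator_one measurableSet_Ioo]
      simp
    rw [h1, mul_one, Set.inter_comm, ← setIntegral_indicator (isClosed_polytope ν c).measurableSet,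
      surf_restrict_hyperplane hι hr, integral_map hιc.aemeasurable
        (hψ.measurable.indicator (isClosed_polytope ν c).measurableSet).aestronglyMeasurable]
    refine integral_congr_ae ?_
    filter_upwards [hae] with z hz
    simp only [g]
    by_cases hK : ι z ∈ polytope ν c
    · rw [Set.indicator_of_mem hK, Finset.prod_eq_one, one_mul]
      intro j hj
      have h1 := hz j (Finset.ne_of_mem_erase hj)
      have h2 := hK j
      exact if_pos (lt_of_le_of_ne (sub_nonneg.2 h2) h1.symm)
    · rw [Set.indicator_of_notMem hK]
      have : ∃ j, ⟪ν j, ι z⟫ < c j := by simpa [polytope] using hK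
      obtain ⟨j, hj⟩ := this
      have hji : j ≠ i := by
        rintro rfl
        rw [hιH] at hj
        exact lt_irrefl _ hj
      rw [Finset.prod_eq_zero (Finset.mem_erase.2 ⟨hji, Finset.mem_univ j⟩), zero_mul]
      exact if_neg (by linarith)
  rw [← hval]
  exact hlim.congr' hcov

end Polytope

section Polytope

variable {n : ℕ} {κ : Type*}

theorem support_cutoff_subset {ν : κ → Pt (n + 1)} {c : κ → ℝ} {ε : ℝ} (hε : 0 < ε)
    {x : Pt (n + 1)} (hx : x ∉ polytope ν c) (s : Finset κ)
    (hs : ∀ k, ⟪ν k, x⟫ < c k → k ∈ s) :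
    ∏ k ∈ s, ramp ε (⟪ν k, x⟫ - c k) = 0 := by
  have : ∃ j, ⟪ν j, x⟫ < c j := by simpa [polytope] using hx
  obtain ⟨j, hj⟩ := this
  exact Finset.prod_eq_zero (hs j hj) (ramp_of_nonpos hε (by linarith))

variable [Fintype κ]

/-- A Lipschitz cutoff function of a polytope. -/
theorem exists_lipschitz_cutoff {ν : κ → Pt (n + 1)} (hν : ∀ k, ‖ν k‖ = 1) (c : κ → ℝ) (ε : ℝ) :
    ∃ C, LipschitzWith C fun x : Pt (n + 1) => ∏ k, ramp ε (⟪ν k, x⟫ - c k) := by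
  refine exists_lipschitz_prod Finset.univ (fun k x => ramp ε (⟪ν k, x⟫ - c k)) (fun k => ?_)
    (fun k x => ramp_nonneg _ _) (fun k x => ramp_le_one _ _)
  refine ⟨‖ε⁻¹‖₊ * 1, (ramp_lipschitz ε).comp (LipschitzWith.of_dist_le_mul fun x y => ?_)⟩
  rw [Real.dist_eq, dist_eq_norm, sub_sub_sub_cancel_right, ← inner_sub_right]
  refine (abs_real_inner_le_norm _ _).trans ?_
  rw [hν]
  simp

theorem volume_hyperplane {ν : Pt (n + 1)} (hν : ‖ν‖ = 1) (c : ℝ) :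
    volume {x | ⟪ν, x⟫ = c} = 0 := by
  let f : Pt (n + 1) →ᵃ[ℝ] ℝ :=
    (innerSL ℝ ν).toLinearMap.toAffineMap - AffineMap.const ℝ _ c
  have hf : ∀ x, f x = ⟪ν, x⟫ - c := fun x => rfl
  have : {x | ⟪ν, x⟫ = c} = {x | f x = 0} := by
    ext x; simp [hf, sub_eq_zero]
  rw [this]
  refine volume_affine_zero f ⟨(c + 1) • ν, ?_⟩
  rw [hf, inner_smul_right, real_inner_self_eq_norm_sq, hν]
  norm_num

variable [DecidableEq κ]

/-- The product rule applies off the hyperplanes at levels `c k` and `c k + ε`, where the ramps have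
their kinks; these are null sets. -/
theorem ae_lineDeriv_cutoff {ν : κ → Pt (n + 1)} (hν : ∀ k, ‖ν k‖ = 1) (c : κ → ℝ) {ε : ℝ}
    (hε : 0 < ε) (v : Pt (n + 1)) :
    ∀ᵐ x : Pt (n + 1), lineDeriv ℝ (fun x => ∏ k, ramp ε (⟪ν k, x⟫ - c k)) x v =
      ∑ i, (∏ j ∈ Finset.univ.erase i, ramp ε (⟪ν j, x⟫ - c j)) *
        ((if 0 < ⟪ν i, x⟫ - c i ∧ ⟪ν i, x⟫ - c i < ε then ε⁻¹ else 0) * ⟪ν i, v⟫) := by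
  have h : ∀ᵐ x : Pt (n + 1), ∀ k, ⟪ν k, x⟫ ≠ c k ∧ ⟪ν k, x⟫ ≠ c k + ε := by
    rw [ae_all_iff]
    intro k
    have h1 : ∀ᵐ x : Pt (n + 1), ⟪ν k, x⟫ ≠ c k := by
      rw [ae_iff]; simpa using volume_hyperplane (hν k) (c k)
    have h2 : ∀ᵐ x : Pt (n + 1), ⟪ν k, x⟫ ≠ c k + ε := by
      rw [ae_iff]; simpa using volume_hyperplane (hν k) (c k + ε)
    exact h1.and h2
  filter_upwards [h] with x hx
  refine HasDerivAt.deriv ?_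
  have hk : ∀ k ∈ Finset.univ, HasDerivAt (fun t : ℝ => ramp ε (⟪ν k, x + t • v⟫ - c k))
      ((if 0 < ⟪ν k, x⟫ - c k ∧ ⟪ν k, x⟫ - c k < ε then ε⁻¹ else 0) * ⟪ν k, v⟫) 0 := by
    intro k _
    have h1 : HasDerivAt (fun t : ℝ => ⟪ν k, x + t • v⟫ - c k) ⟪ν k, v⟫ 0 := by
      simp only [inner_add_right, inner_smul_right]
      simpa using (((hasDerivAt_id (0 : ℝ)).mul_const ⟪ν k, v⟫).const_add ⟪ν k, x⟫).sub_const (c k)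
    have h2 : HasDerivAt (ramp ε)
        (if 0 < ⟪ν k, x⟫ - c k ∧ ⟪ν k, x⟫ - c k < ε then ε⁻¹ else 0)
        (⟪ν k, x + (0 : ℝ) • v⟫ - c k) := by
      rw [zero_smul, add_zero]
      refine hasDerivAt_ramp hε (sub_ne_zero.2 (hx k).1) fun h => (hx k).2 ?_
      linarith
    exact HasDerivAt.comp (h₂ := ramp ε) (h := fun t : ℝ => ⟪ν k, x + t • v⟫ - c k) 0 h2 h1
  simpa using HasDerivAt.fun_finsetProd hk

/-- **Divergence theorem** for a Lipschitz function on a bounded polytope. -/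
theorem integral_lineDeriv_polytope {ν : κ → Pt (n + 1)} (hν : ∀ k, ‖ν k‖ = 1) {c : κ → ℝ}
    (hb : Bornology.IsBounded (polytope ν c))
    (hnull : ∀ i j, i ≠ j → surf (n + 1) {x | ⟪ν i, x⟫ = c i ∧ ⟪ν j, x⟫ = c j} = 0)
    {ψ : Pt (n + 1) → ℝ} {C : NNReal} (hψ : LipschitzWith C ψ) (v : Pt (n + 1)) :
    ∫ x in polytope ν c, lineDeriv ℝ ψ x v =
      -∑ k, ⟪ν k, v⟫ * ∫ x in polytope ν c ∩ {x | ⟪ν k, x⟫ = c k}, ψ x ∂(surf (n + 1)) := by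
  have hpos : ∀ᶠ ε : ℝ in 𝓝[>] 0, 0 < ε := self_mem_nhdsWithin
  have hKc : IsCompact (polytope ν c) :=
    Metric.isCompact_of_isClosed_isBounded (isClosed_polytope ν c) hb
  have hKm := hKc.measurableSet
  -- Integration by parts against a compactly supported Lipschitz cutoff produces no boundary term;
  -- the derivative of the cutoff lives in the boundary layers, one for each half space.
  have hparts : ∀ᶠ ε : ℝ in 𝓝[>] 0,
      ∫ x, lineDeriv ℝ ψ x v * ∏ k, ramp ε (⟪ν k, x⟫ - c k) =
      -∑ i, ⟪ν i, v⟫ * ∫ x, (∏ j ∈ Finset.univ.erase i, ramp ε (⟪ν j, x⟫ - c j)) *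
        (if 0 < ⟪ν i, x⟫ - c i ∧ ⟪ν i, x⟫ - c i < ε then ε⁻¹ else 0) * ψ x := by
    filter_upwards [hpos] with ε hε
    obtain ⟨D, hD⟩ := exists_lipschitz_cutoff hν c ε
    have hsupp : HasCompactSupport fun x : Pt (n + 1) => ∏ k, ramp ε (⟪ν k, x⟫ - c k) :=
      HasCompactSupport.intro hKc fun x hx =>
        support_cutoff_subset hε hx _ fun k _ => Finset.mem_univ k
    rw [hψ.integral_lineDeriv_mul_eq hD hsupp v]
    have hint : ∀ i, Integrable fun x : Pt (n + 1) =>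
        (∏ j ∈ Finset.univ.erase i, ramp ε (⟪ν j, x⟫ - c j)) *
        (if 0 < ⟪ν i, x⟫ - c i ∧ ⟪ν i, x⟫ - c i < ε then ε⁻¹ else 0) * ψ x := by
      intro i
      obtain ⟨M, hM⟩ := hKc.exists_bound_of_continuousOn hψ.continuous.continuousOn
      have hmeas : Measurable fun x : Pt (n + 1) =>
          (∏ j ∈ Finset.univ.erase i, ramp ε (⟪ν j, x⟫ - c j)) *
          (if 0 < ⟪ν i, x⟫ - c i ∧ ⟪ν i, x⟫ - c i < ε then ε⁻¹ else 0) * ψ x := by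
        refine Measurable.mul (Measurable.mul ?_ ?_) hψ.continuous.measurable
        · exact (continuous_finsetProd _ fun j _ =>
            (continuous_ramp ε).comp (by fun_prop)).measurable
        · refine Measurable.ite ?_ measurable_const measurable_const
          exact (by fun_prop : Measurable fun x : Pt (n + 1) => ⟪ν i, x⟫ - c i) measurableSet_Ioo
      have hbd : Integrable ((polytope ν c).indicator fun _ => ε⁻¹ * |M|) := by
        rw [integrable_indicator_iff hKm]
        exact integrableOn_const (hs := hKc.measure_lt_top.ne)
      refine hbd.mono' hmeas.aestronglyMeasurable (Eventually.of_forall fun x => ?_)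
      by_cases hx : x ∈ polytope ν c
      · rw [Set.indicator_of_mem hx, norm_mul, norm_mul]
        have h1 : ‖∏ j ∈ Finset.univ.erase i, ramp ε (⟪ν j, x⟫ - c j)‖ ≤ 1 := by
          rw [Real.norm_of_nonneg (Finset.prod_nonneg fun _ _ => ramp_nonneg _ _)]
          exact Finset.prod_le_one (fun _ _ => ramp_nonneg _ _) fun _ _ => ramp_le_one _ _
        have h2 : ‖(if 0 < ⟪ν i, x⟫ - c i ∧ ⟪ν i, x⟫ - c i < ε then ε⁻¹ else 0)‖ ≤ ε⁻¹ := by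
          split_ifs
          · rw [Real.norm_of_nonneg (inv_pos.2 hε).le]
          · simpa using hε.le
        calc _ ≤ 1 * ε⁻¹ * ‖ψ x‖ := by gcongr
          _ ≤ _ := by
            rw [one_mul]
            gcongr
            exact (hM x hx).trans (le_abs_self M)
      · rw [Set.indicator_of_notMem hx]
        -- Outside the polytope either the `i`-th inequality fails and the slope factor is zero, or
        -- another one fails and its ramp is among the remaining factors.
        by_cases hi : ⟪ν i, x⟫ < c i
        · rw [if_neg (fun h => by linarith [h.1])]
          simp
        · rw [support_cutoff_subset hε hx]
          · simp
          · intro k hk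
            refine Finset.mem_erase.2 ⟨?_, Finset.mem_univ k⟩
            rintro rfl
            exact hi hk
    rw [← Finset.sum_neg_distrib]
    simp_rw [← integral_const_mul, ← integral_neg]
    rw [← integral_finsetSum _ fun i _ => Integrable.fun_neg ((hint i).const_mul _)]
    refine integral_congr_ae ?_
    filter_upwards [ae_lineDeriv_cutoff hν c hε (-v)] with x hx
    rw [hx, Finset.sum_mul]
    refine Finset.sum_congr rfl fun i _ => ?_
    rw [inner_neg_right]
    ring
  have hR : Tendsto (fun ε => -∑ i, ⟪ν i, v⟫ * ∫ x,
      (∏ j ∈ Finset.univ.erase i, ramp ε (⟪ν j, x⟫ - c j)) *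
        (if 0 < ⟪ν i, x⟫ - c i ∧ ⟪ν i, x⟫ - c i < ε then ε⁻¹ else 0) * ψ x) (𝓝[>] 0)
      (𝓝 (-∑ k, ⟪ν k, v⟫ *
        ∫ x in polytope ν c ∩ {x | ⟪ν k, x⟫ = c k}, ψ x ∂(surf (n + 1)))) :=
    (tendsto_finsetSum _ fun i _ =>
      (tendsto_integral_layer hν hb hnull hψ.continuous i).const_mul _).neg
  have hL : Tendsto (fun ε => ∫ x, lineDeriv ℝ ψ x v * ∏ k, ramp ε (⟪ν k, x⟫ - c k)) (𝓝[>] 0)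
      (𝓝 (∫ x in polytope ν c, lineDeriv ℝ ψ x v)) := by
    rw [← integral_indicator hKm]
    refine tendsto_integral_filter_of_dominated_convergence
      ((polytope ν c).indicator fun _ => C * ‖v‖) ?_ ?_ ?_ ?_
    · refine Eventually.of_forall fun ε => ?_
      refine (aestronglyMeasurable_lineDeriv hψ.continuous _).mul ?_
      exact (continuous_finsetProd _ fun j _ =>
        (continuous_ramp ε).comp (by fun_prop)).aestronglyMeasurable
    · filter_upwards [hpos] with ε hε
      refine Eventually.of_forall fun x => ?_
      by_cases hx : x ∈ polytope ν c
      · rw [Set.indicator_of_mem hx, norm_mul]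
        have h1 : ‖∏ j, ramp ε (⟪ν j, x⟫ - c j)‖ ≤ 1 := by
          rw [Real.norm_of_nonneg (Finset.prod_nonneg fun _ _ => ramp_nonneg _ _)]
          exact Finset.prod_le_one (fun _ _ => ramp_nonneg _ _) fun _ _ => ramp_le_one _ _
        calc _ ≤ C * ‖v‖ * 1 := by
              gcongr
              exact norm_lineDeriv_le_of_lipschitz ℝ hψ
          _ = _ := mul_one _
      · rw [Set.indicator_of_notMem hx, support_cutoff_subset hε hx _ fun k _ => Finset.mem_univ k]
        simp
    · rw [integrable_indicator_iff hKm]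
      exact integrableOn_const (hs := hKc.measure_lt_top.ne)
    · have h : ∀ᵐ x : Pt (n + 1), ∀ k, ⟪ν k, x⟫ ≠ c k := by
        rw [ae_all_iff]
        intro k
        rw [ae_iff]; simpa using volume_hyperplane (hν k) (c k)
      filter_upwards [h] with x hx
      have h1 : Tendsto (fun ε => ∏ k, ramp ε (⟪ν k, x⟫ - c k)) (𝓝[>] 0)
          (𝓝 (∏ k, if 0 < ⟪ν k, x⟫ - c k then 1 else 0)) :=
        tendsto_finsetProd _ fun k _ => tendsto_ramp tendsto_const_nhds (sub_ne_zero.2 (hx k))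
      refine (h1.const_mul _).trans (le_of_eq ?_)
      congr 1
      by_cases hK : x ∈ polytope ν c
      · rw [Set.indicator_of_mem hK, Finset.prod_eq_one, mul_one]
        intro k _
        exact if_pos (sub_pos.2 (lt_of_le_of_ne (hK k) (hx k).symm))
      · rw [Set.indicator_of_notMem hK]
        have : ∃ j, ⟪ν j, x⟫ < c j := by simpa [polytope] using hK
        obtain ⟨j, hj⟩ := this
        rw [Finset.prod_eq_zero (Finset.mem_univ j) (if_neg (by linarith)), mul_zero]
  exact tendsto_nhds_unique (hL.congr' hparts) hR

end Polytope

/-! ### Simplices as polytopes -/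

theorem affineMap_eq_inner {d : ℕ} (f : Pt d →ᵃ[ℝ] ℝ) :
    ∃ w : Pt d, ∀ x, f x = ⟪w, x⟫ + f 0 := by
  refine ⟨(InnerProductSpace.toDual ℝ (Pt d)).symm (LinearMap.toContinuousLinearMap f.linear),
    fun x => ?_⟩
  rw [InnerProductSpace.toDual_symm_apply]
  have := f.map_vadd 0 x
  simpa using this

/-- The half spaces are the nonnegativity sets of the barycentric coordinates, normalised by the
lengths of their gradients. In the last clause the witness is the vertex `l`, where the `k`-th
coordinate is `0` and the `l`-th is `1`; it makes the intersections of facet hyperplanes null. -/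
theorem exists_simplex_halfspaces {n : ℕ} (s : Affine.Simplex ℝ (Pt (n + 1)) (n + 1)) :
    ∃ (ν : Fin (n + 2) → Pt (n + 1)) (c : Fin (n + 2) → ℝ), (∀ k, ‖ν k‖ = 1) ∧
      convexHull ℝ (Set.range s.points) = polytope ν c ∧
      interior (convexHull ℝ (Set.range s.points)) = {x | ∀ k, c k < ⟪ν k, x⟫} ∧
      ∀ k l, k ≠ l → ∃ x, ⟪ν k, x⟫ = c k ∧ ⟪ν l, x⟫ ≠ c l := by
  have htop : affineSpan ℝ (Set.range s.points) = ⊤ :=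
    s.independent.affineSpan_eq_top_iff_card_eq_finrank_add_one.2 (by simp)
  let b : AffineBasis (Fin (n + 2)) ℝ (Pt (n + 1)) := ⟨s.points, s.independent, htop⟩
  have hb : Set.range s.points = Set.range b := rfl
  choose w hw using fun k => affineMap_eq_inner (b.coord k)
  have hw0 : ∀ k, w k ≠ 0 := by
    intro k h0
    obtain ⟨l, hl⟩ : ∃ l : Fin (n + 2), l ≠ k := exists_ne k
    have h1 : b.coord k (b k) = 1 := b.coord_apply_eq k
    have h2 : b.coord k (b l) = 0 := b.coord_apply_ne hl.symm
    rw [hw, h0, inner_zero_left] at h1 h2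
    linarith
  have hpos : ∀ k, 0 < ‖w k‖ := fun k => norm_pos_iff.2 (hw0 k)
  have key : ∀ k x, ⟪‖w k‖⁻¹ • w k, x⟫ - -(‖w k‖⁻¹ * b.coord k 0) = ‖w k‖⁻¹ * b.coord k x := by
    intro k x
    rw [hw k x, real_inner_smul_left]
    ring
  refine ⟨fun k => ‖w k‖⁻¹ • w k, fun k => -(‖w k‖⁻¹ * b.coord k 0), fun k => ?_, ?_, ?_, ?_⟩
  · rw [norm_smul, norm_inv, norm_norm, inv_mul_cancel₀ (hpos k).ne']
  · rw [hb, b.convexHull_eq_nonneg_coord]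
    ext x
    simp only [polytope, Set.mem_ofPred_eq]
    refine forall_congr' fun k => ?_
    rw [← sub_nonneg (b := -_), key, mul_nonneg_iff_of_pos_left (inv_pos.2 (hpos k))]
  · rw [hb, b.interior_convexHull]
    ext x
    simp only [Set.mem_ofPred_eq]
    refine forall_congr' fun k => ?_
    rw [← sub_pos (b := -_), key, mul_pos_iff_of_pos_left (inv_pos.2 (hpos k))]
  · intro k l hkl
    refine ⟨b l, ?_, ?_⟩
    · rw [← sub_eq_zero, key, b.coord_apply_ne hkl, mul_zero]
    · rw [← sub_ne_zero, key, b.coord_apply_eq, mul_one]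
      exact (inv_pos.2 (hpos l)).ne'

namespace Mesh

variable {n N : ℕ} (T : Mesh (n + 1) N)

/-- The inward unit normal of the `k`-th facet of element `i`. -/
def facetNormal (i : Fin N) : Fin (n + 2) → Pt (n + 1) :=
  (exists_simplex_halfspaces (T.simplex i)).choose

/-- The offset of the hyperplane containing the `k`-th facet of element `i`. -/
def facetOffset (i : Fin N) : Fin (n + 2) → ℝ :=
  (exists_simplex_halfspaces (T.simplex i)).choose_spec.choose

/-- The signed distance to the hyperplane containing the `k`-th facet of element `i`, positive
inside the element. -/
def level (i : Fin N) (k : Fin (n + 2)) : Pt (n + 1) →ᵃ[ℝ] ℝ :=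
  (innerSL ℝ (T.facetNormal i k)).toLinearMap.toAffineMap -
    AffineMap.const ℝ _ (T.facetOffset i k)

theorem level_apply (i : Fin N) (k : Fin (n + 2)) (x : Pt (n + 1)) :
    T.level i k x = ⟪T.facetNormal i k, x⟫ - T.facetOffset i k := rfl

theorem level_add (i : Fin N) (k : Fin (n + 2)) (x w : Pt (n + 1)) :
    T.level i k (x + w) = T.level i k x + ⟪T.facetNormal i k, w⟫ := by
  rw [level_apply, level_apply, inner_add_right]; ring

theorem continuous_level (i : Fin N) (k : Fin (n + 2)) : Continuous (T.level i k) := by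
  have : (T.level i k : Pt (n + 1) → ℝ) =
      fun x => ⟪T.facetNormal i k, x⟫ - T.facetOffset i k := rfl
  rw [this]; fun_prop

theorem norm_facetNormal (i : Fin N) (k : Fin (n + 2)) : ‖T.facetNormal i k‖ = 1 :=
  (exists_simplex_halfspaces (T.simplex i)).choose_spec.choose_spec.1 k

theorem inner_facetNormal_self (i : Fin N) (k : Fin (n + 2)) :
    ⟪T.facetNormal i k, T.facetNormal i k⟫ = (1 : ℝ) := by
  rw [real_inner_self_eq_norm_sq, T.norm_facetNormal]; norm_num

theorem closedElem_eq_polytope (i : Fin N) :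
    T.closedElem i = polytope (T.facetNormal i) (T.facetOffset i) :=
  (exists_simplex_halfspaces (T.simplex i)).choose_spec.choose_spec.2.1

theorem mem_closedElem {i : Fin N} {x : Pt (n + 1)} :
    x ∈ T.closedElem i ↔ ∀ k, 0 ≤ T.level i k x := by
  rw [T.closedElem_eq_polytope]
  exact forall_congr' fun k => sub_nonneg.symm

theorem mem_elem {i : Fin N} {x : Pt (n + 1)} : x ∈ T.elem i ↔ ∀ k, 0 < T.level i k x := by
  have := (exists_simplex_halfspaces (T.simplex i)).choose_spec.choose_spec.2.2.1
  have h : T.elem i = {x | ∀ k, T.facetOffset i k < ⟪T.facetNormal i k, x⟫} := this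
  rw [h]
  exact forall_congr' fun k => sub_pos.symm

theorem exists_level_ne_zero {i : Fin N} {k l : Fin (n + 2)} (hkl : k ≠ l) :
    ∃ x, T.level i k x = 0 ∧ T.level i l x ≠ 0 := by
  obtain ⟨x, h1, h2⟩ :=
    (exists_simplex_halfspaces (T.simplex i)).choose_spec.choose_spec.2.2.2 k l hkl
  exact ⟨x, sub_eq_zero.2 h1, sub_ne_zero.2 h2⟩

theorem isClosed_closedElem (i : Fin N) : IsClosed (T.closedElem i) := by
  rw [T.closedElem_eq_polytope]; exact isClosed_polytope _ _

theorem isBounded_closedElem (i : Fin N) : Bornology.IsBounded (T.closedElem i) :=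
  (isBounded_convexHull (s := Set.range (T.simplex i).points)).2
    (Set.finite_range _).isBounded

theorem isCompact_closedElem (i : Fin N) : IsCompact (T.closedElem i) :=
  Metric.isCompact_of_isClosed_isBounded (T.isClosed_closedElem i) (T.isBounded_closedElem i)

theorem convex_closedElem (i : Fin N) : Convex ℝ (T.closedElem i) := convex_convexHull _ _

theorem isOpen_elem (i : Fin N) : IsOpen (T.elem i) := isOpen_interior

theorem elem_subset_closedElem (i : Fin N) : T.elem i ⊆ T.closedElem i := _root_.interior_subset

theorem elem_subset_domain (i : Fin N) : T.elem i ⊆ T.domain := T.interior_subset i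

theorem elem_nonempty (i : Fin N) : (T.elem i).Nonempty := by
  refine interior_convexHull_nonempty_iff_affineSpan_eq_top.2 ?_
  exact (T.simplex i).independent.affineSpan_eq_top_iff_card_eq_finrank_add_one.2 (by simp)

theorem closure_elem (i : Fin N) : closure (T.elem i) = T.closedElem i := by
  rw [elem, (T.convex_closedElem i).closure_interior_eq_closure_of_nonempty_interior
    (T.elem_nonempty i), (T.isClosed_closedElem i).closure_eq]

theorem mem_frontier_elem {i : Fin N} {x : Pt (n + 1)} :
    x ∈ frontier (T.elem i) ↔ x ∈ T.closedElem i ∧ x ∉ T.elem i := by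
  rw [frontier, T.closure_elem, (T.isOpen_elem i).interior_eq]; rfl

theorem closure_domain_eq : closure T.domain = ⋃ i, T.closedElem i := T.closure_domain

theorem closedElem_subset_closure (i : Fin N) : T.closedElem i ⊆ closure T.domain := by
  rw [T.closure_domain_eq]; exact Set.subset_iUnion _ i

theorem notMem_elem_of_mem_closedElem {i j : Fin N} (hij : i ≠ j) {x : Pt (n + 1)}
    (hx : x ∈ T.closedElem i) : x ∉ T.elem j := by
  intro hxj
  rw [← T.closure_elem] at hx
  obtain ⟨y, hyj, hyi⟩ := mem_closure_iff.1 hx _ (T.isOpen_elem j) hxj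
  exact Set.disjoint_left.1 (T.disjoint_interior hij) hyi hyj

/-! ### The skeleton and regular boundary points -/

/-- The set of points that lie on two facet hyperplanes of the same element. -/
def skeleton : Set (Pt (n + 1)) :=
  ⋃ i, ⋃ k, ⋃ l, ⋃ _ : k ≠ l, {x | T.level i k x = 0 ∧ T.level i l x = 0}

theorem mem_skeleton {x : Pt (n + 1)} :
    x ∈ T.skeleton ↔ ∃ i k l, k ≠ l ∧ T.level i k x = 0 ∧ T.level i l x = 0 := by
  simp only [skeleton, Set.mem_iUnion, Set.mem_ofPred_eq, exists_prop]

theorem hyperplane_eq (i : Fin N) (k : Fin (n + 2)) :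
    {x | ⟪T.facetNormal i k, x⟫ = T.facetOffset i k} = {x | T.level i k x = 0} := by
  ext x; exact sub_eq_zero.symm

theorem surf_level_inter (i : Fin N) {k l : Fin (n + 2)} (hkl : k ≠ l) :
    surf (n + 1) {x | T.level i k x = 0 ∧ T.level i l x = 0} = 0 := by
  have := surf_hyperplane_inter_affine_zero (T.norm_facetNormal i k) (c := T.facetOffset i k)
    (T.level i l) ?_
  · convert this using 5 with x
    exact sub_eq_zero
  · obtain ⟨x, h1, h2⟩ := T.exists_level_ne_zero (i := i) hkl
    exact ⟨x, sub_eq_zero.1 h1, h2⟩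

theorem surf_skeleton : surf (n + 1) T.skeleton = 0 := by
  simp only [skeleton, measure_iUnion_null_iff]
  exact fun i k l hkl => T.surf_level_inter i hkl

theorem ae_notMem_skeleton (s : Set (Pt (n + 1))) :
    ∀ᵐ x ∂(surf (n + 1)).restrict s, x ∉ T.skeleton :=
  ae_restrict_of_ae (measure_eq_zero_iff_ae_notMem.1 T.surf_skeleton)

/-- `x` lies in the relative interior of the `k`-th facet of element `i`. -/
def IsRegular (i : Fin N) (k : Fin (n + 2)) (x : Pt (n + 1)) : Prop :=
  T.level i k x = 0 ∧ ∀ l, l ≠ k → 0 < T.level i l x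

theorem exists_isRegular {i : Fin N} {x : Pt (n + 1)} (hx : x ∈ frontier (T.elem i))
    (hs : x ∉ T.skeleton) : ∃ k, T.IsRegular i k x := by
  rw [mem_frontier_elem, mem_elem, mem_closedElem] at hx
  obtain ⟨h1, h2⟩ := hx
  push Not at h2
  obtain ⟨k, hk⟩ := h2
  have hk0 := le_antisymm hk (h1 k)
  refine ⟨k, hk0, fun l hl => lt_of_le_of_ne (h1 l) fun h => hs ?_⟩
  exact T.mem_skeleton.2 ⟨i, k, l, hl.symm, hk0, h.symm⟩

theorem exists_isRegular_of_mem {i j : Fin N} (hij : i ≠ j) {x : Pt (n + 1)}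
    (hi : x ∈ T.closedElem i) (hj : x ∈ T.closedElem j) (hs : x ∉ T.skeleton) :
    ∃ k, T.IsRegular i k x :=
  T.exists_isRegular (T.mem_frontier_elem.2 ⟨hi, T.notMem_elem_of_mem_closedElem hij.symm hj⟩) hs

variable {T}

theorem IsRegular.mem_closedElem {i : Fin N} {k : Fin (n + 2)} {x : Pt (n + 1)}
    (h : T.IsRegular i k x) : x ∈ T.closedElem i := by
  rw [T.mem_closedElem]
  intro l
  by_cases hl : l = k
  · rw [hl, h.1]
  · exact (h.2 l hl).le

/-- Near a regular boundary point an element is a half space. -/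
theorem IsRegular.eventually {i : Fin N} {k : Fin (n + 2)} {x : Pt (n + 1)}
    (h : T.IsRegular i k x) :
    ∀ᶠ y in 𝓝 x, (y ∈ T.closedElem i ↔ 0 ≤ T.level i k y) ∧
      (y ∈ T.elem i ↔ 0 < T.level i k y) := by
  have h1 : ∀ᶠ y in 𝓝 x, ∀ l, l ≠ k → 0 < T.level i l y := by
    rw [eventually_all]
    intro l
    by_cases hl : l = k
    · exact Eventually.of_forall fun y h => absurd hl h
    · filter_upwards [(T.continuous_level i l).continuousAt.eventually
        (Ioi_mem_nhds (h.2 l hl))] with y hy _ using hy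
  filter_upwards [h1] with y hy
  rw [T.mem_closedElem, T.mem_elem]
  refine ⟨⟨fun h => h k, fun h l => ?_⟩, ⟨fun h => h k, fun h l => ?_⟩⟩
  · by_cases hl : l = k
    · rwa [hl]
    · exact (hy l hl).le
  · by_cases hl : l = k
    · rwa [hl]
    · exact hy l hl

theorem eventually_add_smul {p : Pt (n + 1) → Prop} {x : Pt (n + 1)} (h : ∀ᶠ y in 𝓝 x, p y)
    (w : Pt (n + 1)) : ∃ t : ℝ, 0 < t ∧ p (x + t • w) := by
  have h1 : Tendsto (fun t : ℝ => x + t • w) (𝓝[>] 0) (𝓝 x) := by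
    have : Continuous fun t : ℝ => x + t • w := by fun_prop
    have := (this.tendsto 0).mono_left (nhdsWithin_le_nhds (s := Set.Ioi 0))
    simpa using this
  exact ((eventually_mem_nhdsWithin (a := (0 : ℝ)) (s := Set.Ioi 0)).and
    (h1.eventually h)).exists

/-- Here the choice made by `outerNormal` is forced. Locally the element is the half space with
inward normal $\nu$, so an admissible $m$ has $\langle m,w\rangle\le0$ whenever
$\langle\nu,w\rangle\ge0$. Taking $w=m-\langle m,\nu\rangle\nu$ and $w=\nu$ gives $1\le\langle
m,\nu\rangle^2$ and $\langle m,\nu\rangle\le0$, hence $m=-\nu$. -/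
theorem IsRegular.normal_eq {i : Fin N} {k : Fin (n + 2)} {x : Pt (n + 1)}
    (h : T.IsRegular i k x) : T.normal i x = -T.facetNormal i k := by
  have hex : ∃ m : Pt (n + 1), ‖m‖ = 1 ∧ ∀ y ∈ T.closedElem i, ⟪m, y - x⟫ ≤ 0 := by
    refine ⟨-T.facetNormal i k, by rw [norm_neg, T.norm_facetNormal], fun y hy => ?_⟩
    have h1 := T.mem_closedElem.1 hy k
    have h2 := T.level_add i k x (y - x)
    rw [add_sub_cancel, h.1, zero_add] at h2
    rw [inner_neg_left, ← h2]
    linarith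
  obtain ⟨h1, h2⟩ := Classical.epsilon_spec hex
  change ‖T.normal i x‖ = 1 at h1
  change ∀ y ∈ T.closedElem i, ⟪T.normal i x, y - x⟫ ≤ 0 at h2
  have hν := T.inner_facetNormal_self i k
  generalize T.normal i x = m at h1 h2
  have key : ∀ w, 0 ≤ ⟪T.facetNormal i k, w⟫ → ⟪m, w⟫ ≤ 0 := by
    intro w hw
    obtain ⟨t, ht, hy⟩ := eventually_add_smul h.eventually w
    have h3 := h2 (x + t • w) (hy.1.2 (by
      rw [T.level_add, h.1, zero_add, inner_smul_right]; positivity))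
    rw [add_sub_cancel_left, inner_smul_right] at h3
    exact nonpos_of_mul_nonpos_right h3 ht
  have h4 := key (m - ⟪m, T.facetNormal i k⟫ • T.facetNormal i k) (by
    rw [inner_sub_right, inner_smul_right, hν, real_inner_comm]; simp)
  have h5 := key (T.facetNormal i k) (by rw [hν]; norm_num)
  rw [inner_sub_right, inner_smul_right, real_inner_self_eq_norm_sq, h1] at h4
  have h6 : ⟪m, T.facetNormal i k⟫ ≤ -1 := by nlinarith
  have h7 : ‖m + T.facetNormal i k‖ ^ 2 ≤ 0 := by
    rw [norm_add_sq_real, h1, T.norm_facetNormal]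
    linarith
  have h8 : m + T.facetNormal i k = 0 := by
    rw [← norm_eq_zero]
    exact pow_eq_zero_iff two_ne_zero |>.1 (le_antisymm h7 (sq_nonneg _))
  exact eq_neg_of_add_eq_zero_left h8

/-- Two elements meeting in a regular boundary point lie on opposite sides of a hyperplane. -/
theorem IsRegular.facetNormal_eq_neg {i j : Fin N} {k l : Fin (n + 2)} {x : Pt (n + 1)}
    (hij : i ≠ j) (hi : T.IsRegular i k x) (hj : T.IsRegular j l x) :
    T.facetNormal j l = -T.facetNormal i k := by
  by_contra hne
  have hsum : T.facetNormal i k + T.facetNormal j l ≠ 0 := fun h =>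
    hne (eq_neg_of_add_eq_zero_right h)
  have hpos : 0 < ‖T.facetNormal i k + T.facetNormal j l‖ ^ 2 := by positivity
  rw [norm_add_sq_real, T.norm_facetNormal, T.norm_facetNormal] at hpos
  -- If the normals are not opposite, their sum points strictly into both half spaces, and a short
  -- step along it reaches both open elements, which are disjoint.
  obtain ⟨t, ht, h1, h2⟩ := eventually_add_smul (hi.eventually.and hj.eventually)
    (T.facetNormal i k + T.facetNormal j l)
  have h3 := h1.2.2 (by
    rw [T.level_add, hi.1, inner_smul_right, inner_add_right, T.inner_facetNormal_self]
    have : 0 < 1 + ⟪T.facetNormal i k, T.facetNormal j l⟫ := by linarith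
    positivity)
  have h4 := h2.2.2 (by
    rw [T.level_add, hj.1, inner_smul_right, inner_add_right, T.inner_facetNormal_self,
      real_inner_comm]
    have : 0 < ⟪T.facetNormal i k, T.facetNormal j l⟫ + 1 := by linarith
    positivity)
  exact Set.disjoint_left.1 (T.disjoint_interior hij) h3 h4

theorem IsRegular.level_eq_neg {i j : Fin N} {k l : Fin (n + 2)} {x : Pt (n + 1)}
    (hij : i ≠ j) (hi : T.IsRegular i k x) (hj : T.IsRegular j l x) (y : Pt (n + 1)) :
    T.level j l y = -T.level i k y := by
  have h1 := T.level_add i k x (y - x)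
  have h2 := T.level_add j l x (y - x)
  rw [hi.facetNormal_eq_neg hij hj] at h2
  rw [add_sub_cancel, hi.1] at h1
  rw [add_sub_cancel, hj.1, inner_neg_left] at h2
  linarith

theorem IsRegular.normal_eq_neg {i j : Fin N} {k l : Fin (n + 2)} {x : Pt (n + 1)}
    (hij : i ≠ j) (hi : T.IsRegular i k x) (hj : T.IsRegular j l x) :
    T.normal j x = -T.normal i x := by
  rw [hi.normal_eq, hj.normal_eq, hi.facetNormal_eq_neg hij hj]

/-- Three unit vectors cannot be pairwise opposite. Hence off the skeleton at most two elements
meet. -/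
theorem IsRegular.false_of_three {i j m : Fin N} {k l p : Fin (n + 2)} {x : Pt (n + 1)}
    (hij : i ≠ j) (him : i ≠ m) (hjm : j ≠ m) (hi : T.IsRegular i k x) (hj : T.IsRegular j l x)
    (hm : T.IsRegular m p x) : False := by
  have h1 := hi.facetNormal_eq_neg hij hj
  have h2 := hi.facetNormal_eq_neg him hm
  have h3 := hj.facetNormal_eq_neg hjm hm
  have h4 := T.inner_facetNormal_self m p
  have h5 : ⟪T.facetNormal m p, T.facetNormal m p⟫ = (-1 : ℝ) := by
    nth_rewrite 2 [h3]
    rw [h1, ← h2, inner_neg_right, T.inner_facetNormal_self]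
  linarith

/-- If a regular boundary point of an element is interior to the closure of the domain, then some
other element contains it. -/
theorem IsRegular.exists_other {i : Fin N} {k : Fin (n + 2)} {x : Pt (n + 1)}
    (h : T.IsRegular i k x) (hx : ∀ᶠ y in 𝓝 x, y ∈ closure T.domain) :
    ∃ j, j ≠ i ∧ x ∈ T.closedElem j := by
  by_contra hcon
  push Not at hcon
  have h1 : ∀ᶠ y in 𝓝 x, ∀ j, j ≠ i → y ∉ T.closedElem j := by
    rw [eventually_all]
    intro j
    by_cases hj : j = i
    · exact Eventually.of_forall fun y h => absurd hj h
    · filter_upwards [(T.isClosed_closedElem j).isOpen_compl.mem_nhds (hcon j hj)] with y hy _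
        using hy
  obtain ⟨t, ht, ⟨h2, h3⟩, h4⟩ := eventually_add_smul ((h1.and hx).and h.eventually)
    (-T.facetNormal i k)
  rw [T.closure_domain_eq, Set.mem_iUnion] at h3
  obtain ⟨j, hj⟩ := h3
  by_cases hji : j = i
  · subst hji
    have := h4.1.1 hj
    rw [T.level_add, h.1, inner_smul_right, inner_neg_right, T.inner_facetNormal_self] at this
    linarith
  · exact h2 j hji hj

variable (T)

/-! ### Decomposition of element boundaries into faces -/

theorem measurableSet_face (i j : Fin N) : MeasurableSet (T.face i j) :=
  ((T.isClosed_closedElem i).measurableSet.inter (T.isClosed_closedElem j).measurableSet).inter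
    T.isOpen_domain.measurableSet

theorem measurableSet_bdryFace (i : Fin N) : MeasurableSet (T.bdryFace i) :=
  (T.isClosed_closedElem i).measurableSet.inter isClosed_frontier.measurableSet

theorem face_comm (i j : Fin N) : T.face i j = T.face j i := by
  rw [face, face, Set.inter_comm (T.closedElem i)]

theorem face_subset_frontier {i j : Fin N} (hij : i ≠ j) : T.face i j ⊆ frontier (T.elem i) :=
  fun _ hx => T.mem_frontier_elem.2
    ⟨hx.1.1, T.notMem_elem_of_mem_closedElem hij.symm hx.1.2⟩

theorem bdryFace_subset_frontier (i : Fin N) : T.bdryFace i ⊆ frontier (T.elem i) := by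
  intro x hx
  refine T.mem_frontier_elem.2 ⟨hx.1, fun h => ?_⟩
  have h2 := hx.2
  rw [frontier, T.isOpen_domain.interior_eq] at h2
  exact h2.2 (T.elem_subset_domain i h)

theorem frontier_subset_iUnion (i : Fin N) :
    frontier (T.elem i) ⊆ ⋃ k, T.closedElem i ∩ {x | T.level i k x = 0} := by
  intro x hx
  obtain ⟨h1, h2⟩ := T.mem_frontier_elem.1 hx
  rw [mem_elem] at h2
  push Not at h2
  obtain ⟨k, hk⟩ := h2
  exact Set.mem_iUnion.2 ⟨k, h1, le_antisymm hk (T.mem_closedElem.1 h1 k)⟩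

theorem surf_frontier_lt_top (i : Fin N) : surf (n + 1) (frontier (T.elem i)) < ∞ := by
  refine (measure_mono (T.frontier_subset_iUnion i)).trans_lt ?_
  refine (measure_iUnion_le _).trans_lt ?_
  rw [tsum_fintype]
  refine ENNReal.sum_lt_top.2 fun k _ => ?_
  rw [← T.hyperplane_eq]
  exact surf_hyperplane_inter_lt_top (T.norm_facetNormal i k) (T.isBounded_closedElem i)

instance isFiniteMeasure_frontier (i : Fin N) :
    IsFiniteMeasure ((surf (n + 1)).restrict (frontier (T.elem i))) :=
  ⟨by rw [Measure.restrict_apply_univ]; exact T.surf_frontier_lt_top i⟩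

theorem measurableSet_frontier_elem (i : Fin N) : MeasurableSet (frontier (T.elem i)) :=
  isClosed_frontier.measurableSet

/-- The outward normal of element `i` agrees a.e. with a simple function. -/
theorem ae_normal_eq (i : Fin N) : ∀ᵐ x ∂(surf (n + 1)).restrict (frontier (T.elem i)),
    T.normal i x = ∑ k, if T.level i k x = 0 then -T.facetNormal i k else 0 := by
  filter_upwards [T.ae_notMem_skeleton _, ae_restrict_mem (T.measurableSet_frontier_elem i)]
    with x hs hx
  obtain ⟨k, hk⟩ := T.exists_isRegular hx hs
  rw [hk.normal_eq, Finset.sum_eq_single k, if_pos hk.1]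
  · intro l _ hl
    exact if_neg (hk.2 l hl).ne'
  · simp

theorem aestronglyMeasurable_normal (i : Fin N) :
    AEStronglyMeasurable (T.normal i) ((surf (n + 1)).restrict (frontier (T.elem i))) := by
  refine AEStronglyMeasurable.congr ?_ ((T.ae_normal_eq i).mono fun _ h => h.symm)
  refine Measurable.aestronglyMeasurable (Finset.measurable_fun_sum _ fun k _ => ?_)
  exact Measurable.ite (isClosed_eq (T.continuous_level i k) continuous_const).measurableSet
    measurable_const measurable_const

theorem ae_norm_normal (i : Fin N) : ∀ᵐ x ∂(surf (n + 1)).restrict (frontier (T.elem i)),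
    ‖T.normal i x‖ = 1 := by
  filter_upwards [T.ae_notMem_skeleton _, ae_restrict_mem (T.measurableSet_frontier_elem i)]
    with x hs hx
  obtain ⟨k, hk⟩ := T.exists_isRegular hx hs
  rw [hk.normal_eq, norm_neg, T.norm_facetNormal]

theorem ae_normal_eq_neg {i j : Fin N} (hij : i ≠ j) :
    ∀ᵐ x ∂(surf (n + 1)).restrict (T.face i j), T.normal j x = -T.normal i x := by
  filter_upwards [T.ae_notMem_skeleton _, ae_restrict_mem (T.measurableSet_face i j)]
    with x hs hx
  obtain ⟨k, hk⟩ := T.exists_isRegular_of_mem hij hx.1.1 hx.1.2 hs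
  obtain ⟨l, hl⟩ := T.exists_isRegular_of_mem hij.symm hx.1.2 hx.1.1 hs
  exact hk.normal_eq_neg hij hl

/-- The boundary of an element is the almost disjoint union of its faces. -/
theorem integral_frontier_elem (i : Fin N) {g : Pt (n + 1) → ℝ}
    (hg : IntegrableOn g (frontier (T.elem i)) (surf (n + 1))) :
    ∫ x in frontier (T.elem i), g x ∂(surf (n + 1)) =
      ∑ j, (if j ≠ i then ∫ x in T.face i j, g x ∂(surf (n + 1)) else 0) +
        ∫ x in T.bdryFace i, g x ∂(surf (n + 1)) := by
  have h1 : ∀ j, (if j ≠ i then ∫ x in T.face i j, g x ∂(surf (n + 1)) else 0) =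
      ∫ x in frontier (T.elem i), (if j ≠ i then (T.face i j).indicator g x else 0)
        ∂(surf (n + 1)) := by
    intro j
    split_ifs with h
    · rw [setIntegral_indicator (T.measurableSet_face i j),
        Set.inter_eq_right.2 (T.face_subset_frontier h.symm)]
    · simp
  have h2 : ∫ x in T.bdryFace i, g x ∂(surf (n + 1)) =
      ∫ x in frontier (T.elem i), (T.bdryFace i).indicator g x ∂(surf (n + 1)) := by
    rw [setIntegral_indicator (T.measurableSet_bdryFace i),
      Set.inter_eq_right.2 (T.bdryFace_subset_frontier i)]
  have hint : ∀ j ∈ Finset.univ, Integrable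
      (fun x => if j ≠ i then (T.face i j).indicator g x else 0)
      ((surf (n + 1)).restrict (frontier (T.elem i))) := by
    intro j _
    split_ifs
    · exact hg.indicator (T.measurableSet_face i j)
    · exact integrable_zero _ _ _
  simp_rw [h1]
  rw [h2, ← integral_finsetSum _ hint, ← integral_add (integrable_finsetSum _ hint)
    (hg.indicator (T.measurableSet_bdryFace i))]
  refine integral_congr_ae ?_
  filter_upwards [T.ae_notMem_skeleton _, ae_restrict_mem (T.measurableSet_frontier_elem i)]
    with x hs hx
  obtain ⟨k, hk⟩ := T.exists_isRegular hx hs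
  -- Off the skeleton a boundary point of the element has exactly one neighbour if it lies in the
  -- domain, and otherwise belongs to the boundary face alone.
  by_cases hd : x ∈ T.domain
  · obtain ⟨j, hji, hj⟩ := hk.exists_other
      (mem_of_superset (T.isOpen_domain.mem_nhds hd) subset_closure)
    have hb : x ∉ T.bdryFace i := by
      intro h
      have h2 := h.2
      rw [frontier, T.isOpen_domain.interior_eq] at h2
      exact h2.2 hd
    rw [Set.indicator_of_notMem hb, add_zero, Finset.sum_eq_single j, if_pos hji,
      Set.indicator_of_mem]
    · exact ⟨⟨hk.mem_closedElem, hj⟩, hd⟩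
    · intro m _ hm
      split_ifs with h
      · refine Set.indicator_of_notMem (fun hx' => ?_) _
        obtain ⟨l, hl⟩ := T.exists_isRegular_of_mem hji hj hk.mem_closedElem hs
        obtain ⟨p, hp⟩ := T.exists_isRegular_of_mem h hx'.1.2 hk.mem_closedElem hs
        exact hk.false_of_three hji.symm h.symm hm.symm hl hp
      · rfl
    · simp
  · have hb : x ∈ T.bdryFace i := by
      refine ⟨hk.mem_closedElem, ?_⟩
      rw [frontier, T.isOpen_domain.interior_eq]
      exact ⟨T.closedElem_subset_closure i hk.mem_closedElem, hd⟩
    rw [Set.indicator_of_mem hb, Finset.sum_eq_zero, zero_add]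
    intro j _
    split_ifs
    · exact Set.indicator_of_notMem (fun h => hd h.2) _
    · rfl

/-- The divergence theorem on an element, in a single direction. -/
theorem integral_elem_lineDeriv (i : Fin N) {ψ : Pt (n + 1) → ℝ} {C : NNReal}
    (hψ : LipschitzWith C ψ) (v : Pt (n + 1)) :
    ∫ x in T.elem i, lineDeriv ℝ ψ x v =
      ∫ x in frontier (T.elem i), ⟪T.normal i x, v⟫ * ψ x ∂(surf (n + 1)) := by
  have hK := T.closedElem_eq_polytope i
  have hdiv := integral_lineDeriv_polytope (T.norm_facetNormal i) (c := T.facetOffset i)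
    (by rw [← hK]; exact T.isBounded_closedElem i) (fun k l hkl => by
      have := T.surf_level_inter i hkl
      convert this using 5 with x
      · exact sub_eq_zero.symm
      · exact sub_eq_zero.symm) hψ v
  rw [← hK] at hdiv
  have hvol : volume.restrict (T.elem i) = volume.restrict (T.closedElem i) := by
    refine Measure.restrict_congr_set ?_
    have h1 := (T.convex_closedElem i).addHaar_frontier volume
    have h2 := interior_ae_eq_of_null_frontier h1
    exact h2
  rw [hvol, hdiv]
  obtain ⟨M, hM⟩ := (T.isCompact_closedElem i).exists_bound_of_continuousOn
    hψ.continuous.continuousOn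
  have hψi : IntegrableOn ψ (frontier (T.elem i)) (surf (n + 1)) := by
    refine Integrable.of_bound hψ.continuous.measurable.aestronglyMeasurable M ?_
    filter_upwards [ae_restrict_mem (T.measurableSet_frontier_elem i)] with x hx
    exact hM x (T.mem_frontier_elem.1 hx).1
  have hterm : ∀ k, ∫ x in T.closedElem i ∩ {x | ⟪T.facetNormal i k, x⟫ = T.facetOffset i k},
      ψ x ∂(surf (n + 1)) =
      ∫ x in frontier (T.elem i), {x | T.level i k x = 0}.indicator ψ x ∂(surf (n + 1)) := by
    intro k
    rw [setIntegral_indicator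
      (isClosed_eq (T.continuous_level i k) continuous_const).measurableSet, T.hyperplane_eq]
    congr 2
    ext x
    simp only [Set.mem_inter_iff, Set.mem_ofPred_eq, T.mem_frontier_elem, T.mem_elem]
    constructor
    · rintro ⟨h1, h2⟩
      exact ⟨⟨h1, fun h => (h k).ne' h2⟩, h2⟩
    · rintro ⟨⟨h1, _⟩, h2⟩
      exact ⟨h1, h2⟩
  simp_rw [hterm, ← Finset.sum_neg_distrib, ← integral_const_mul, ← integral_neg]
  rw [← integral_finsetSum _ fun k _ => Integrable.fun_neg (Integrable.const_mul (hψi.indicator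
      (isClosed_eq (T.continuous_level i k) continuous_const).measurableSet) _)]
  refine integral_congr_ae ?_
  filter_upwards [T.ae_notMem_skeleton _, ae_restrict_mem (T.measurableSet_frontier_elem i)]
    with x hs hx
  obtain ⟨k, hk⟩ := T.exists_isRegular hx hs
  rw [hk.normal_eq, Finset.sum_eq_single k, Set.indicator_of_mem (s := {y | T.level i k y = 0}) hk.1,
    inner_neg_left, neg_mul]
  · intro l _ hl
    rw [Set.indicator_of_notMem (s := {y | T.level i l y = 0}) (hk.2 l hl).ne', mul_zero, neg_zero]
  · simp

end Mesh

/-! ### Bounded measurable functions -/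

section BddMeas

variable {X E : Type*} [MeasurableSpace X] [NormedAddCommGroup E] {μ ν : Measure X}

/-- Essentially bounded, a.e. strongly measurable functions. -/
structure BddMeas (f : X → E) (μ : Measure X) : Prop where
  aesm : AEStronglyMeasurable f μ
  bdd : ∃ C : ℝ, ∀ᵐ x ∂μ, ‖f x‖ ≤ C

namespace BddMeas

theorem integrable [IsFiniteMeasure μ] {f : X → E} (hf : BddMeas f μ) : Integrable f μ :=
  let ⟨C, hC⟩ := hf.bdd
  Integrable.of_bound hf.aesm C hC

theorem mul_integrable {f g : X → ℝ} (hf : BddMeas f μ) (hg : Integrable g μ) :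
    Integrable (fun x => f x * g x) μ :=
  let ⟨_, hC⟩ := hf.bdd
  hg.bdd_mul hf.aesm hC

theorem mono {f : X → E} (hf : BddMeas f μ) (h : ν ≤ μ) : BddMeas f ν :=
  ⟨hf.aesm.mono_measure h, hf.bdd.imp fun _ hC => ae_mono h hC⟩

theorem congr {f g : X → E} (hf : BddMeas f μ) (h : f =ᵐ[μ] g) : BddMeas g μ :=
  ⟨hf.aesm.congr h, hf.bdd.imp fun C hC => by
    filter_upwards [h, hC] with x h1 h2
    rwa [← h1]⟩

theorem const (c : E) : BddMeas (fun _ : X => c) μ :=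
  ⟨aestronglyMeasurable_const, ‖c‖, Eventually.of_forall fun _ => le_rfl⟩

theorem add {f g : X → E} (hf : BddMeas f μ) (hg : BddMeas g μ) :
    BddMeas (fun x => f x + g x) μ := by
  obtain ⟨C, hC⟩ := hf.bdd
  obtain ⟨D, hD⟩ := hg.bdd
  refine ⟨hf.aesm.add hg.aesm, C + D, ?_⟩
  filter_upwards [hC, hD] with x h1 h2
  exact (norm_add_le _ _).trans (add_le_add h1 h2)

theorem neg {f : X → E} (hf : BddMeas f μ) : BddMeas (fun x => -f x) μ :=
  ⟨hf.aesm.neg, hf.bdd.imp fun C hC => by simpa using hC⟩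

theorem sub {f g : X → E} (hf : BddMeas f μ) (hg : BddMeas g μ) :
    BddMeas (fun x => f x - g x) μ := by
  simpa only [sub_eq_add_neg] using hf.add hg.neg

theorem sum {ι : Type*} (s : Finset ι) {f : ι → X → E} (hf : ∀ i ∈ s, BddMeas (f i) μ) :
    BddMeas (fun x => ∑ i ∈ s, f i x) μ := by
  classical
  induction s using Finset.induction_on with
  | empty => simpa using const (0 : E)
  | insert a s ha ih =>
    simp only [Finset.sum_insert ha]
    exact (hf a (Finset.mem_insert_self a s)).add
      (ih fun i hi => hf i (Finset.mem_insert_of_mem hi))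

theorem smul [NormedSpace ℝ E] {f : X → ℝ} {g : X → E} (hf : BddMeas f μ) (hg : BddMeas g μ) :
    BddMeas (fun x => f x • g x) μ := by
  obtain ⟨C, hC⟩ := hf.bdd
  obtain ⟨D, hD⟩ := hg.bdd
  refine ⟨hf.aesm.smul hg.aesm, C * D, ?_⟩
  filter_upwards [hC, hD] with x h1 h2
  rw [norm_smul]
  exact mul_le_mul h1 h2 (norm_nonneg _) ((norm_nonneg _).trans h1)

theorem mul {f g : X → ℝ} (hf : BddMeas f μ) (hg : BddMeas g μ) :
    BddMeas (fun x => f x * g x) μ := hf.smul hg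

theorem inner [InnerProductSpace ℝ E] {f g : X → E} (hf : BddMeas f μ) (hg : BddMeas g μ) :
    BddMeas (fun x => ⟪f x, g x⟫) μ := by
  obtain ⟨C, hC⟩ := hf.bdd
  obtain ⟨D, hD⟩ := hg.bdd
  refine ⟨AEStronglyMeasurable.inner hf.aesm hg.aesm, C * D, ?_⟩
  filter_upwards [hC, hD] with x h1 h2
  exact (norm_inner_le_norm _ _).trans
    (mul_le_mul h1 h2 (norm_nonneg _) ((norm_nonneg _).trans h1))

theorem norm {f : X → E} (hf : BddMeas f μ) : BddMeas (fun x => ‖f x‖) μ :=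
  ⟨hf.aesm.norm, hf.bdd.imp fun C hC => by simpa using hC⟩

/-- Null measurability suffices and is what is available: the sets where `b · n` has a given sign
involve the normal, which is measurable only up to null sets. -/
theorem ite {p : X → Prop} [DecidablePred p] {f g : X → E} (hp : NullMeasurableSet {x | p x} μ)
    (hf : BddMeas f μ) (hg : BddMeas g μ) : BddMeas (fun x => if p x then f x else g x) μ := by
  have h : (fun x => if p x then f x else g x) =
      fun x => {x | p x}.indicator f x + {x | p x}ᶜ.indicator g x := by
    ext x
    by_cases h : p x <;> simp [h]
  rw [h]
  have hind : ∀ {s : Set X} {f : X → E}, NullMeasurableSet s μ → BddMeas f μ →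
      BddMeas (fun x => s.indicator f x) μ := by
    intro s f hs hf
    refine ⟨hf.aesm.indicator₀ hs, hf.bdd.imp fun C hC => ?_⟩
    filter_upwards [hC] with x hx
    exact (norm_indicator_le_norm_self f x).trans hx
  exact (hind hp hf).add (hind hp.compl hg)

theorem of_coord {d : ℕ} {f : X → Pt d} (hf : ∀ k, BddMeas (fun x => f x k) μ) : BddMeas f μ := by
  have h := BddMeas.sum Finset.univ fun k (_ : k ∈ Finset.univ) =>
    (hf k).smul (const (μ := μ) (EuclideanSpace.single k (1 : ℝ)))
  refine h.congr (Eventually.of_forall fun x => ?_)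
  ext l
  simp [Finset.sum_apply, Pi.single_apply]

theorem coord {d : ℕ} {f : X → Pt d} (hf : BddMeas f μ) (k : Fin d) :
    BddMeas (fun x => f x k) μ := by
  refine (hf.inner (const (EuclideanSpace.single k (1 : ℝ)))).congr
    (Eventually.of_forall fun x => ?_)
  simp [EuclideanSpace.inner_single_right]

theorem of_continuous_of_isCompact [TopologicalSpace X] [OpensMeasurableSpace X]
    [SecondCountableTopologyEither X E] {K s : Set X} (hK : IsCompact K) (hKm : MeasurableSet K)
    (hs : s ⊆ K) {f : X → E} (hf : ContinuousOn f K) : BddMeas f (μ.restrict s) := by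
  obtain ⟨C, hC⟩ := hK.exists_bound_of_continuousOn hf
  refine mono (μ := μ.restrict K) ⟨hf.aestronglyMeasurable hKm, C, ?_⟩
    (Measure.restrict_mono_set μ hs)
  filter_upwards [ae_restrict_mem hKm] with x hx using hC x hx

theorem of_memLp_top {f : X → E} (hf : MemLp f ∞ μ) : BddMeas f μ := by
  refine ⟨hf.1, (eLpNorm f ∞ μ).toReal, ?_⟩
  have h := ae_le_eLpNormEssSup (f := f) (μ := μ)
  have hfin := hf.2.ne
  rw [eLpNorm_exponent_top] at hfin ⊢
  filter_upwards [h] with x hx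
  rw [← toReal_enorm]
  exact ENNReal.toReal_mono hfin hx

theorem op_apply {d : ℕ} {A : X → Matrix (Fin d) (Fin d) ℝ} {v : X → Pt d}
    (hA : ∀ k l, BddMeas (fun x => A x k l) μ) (hv : BddMeas v μ) :
    BddMeas (fun x => op (A x) (v x)) μ := by
  refine of_coord fun k => ?_
  refine (BddMeas.sum Finset.univ fun l _ => (hA k l).mul (hv.coord l)).congr
    (Eventually.of_forall fun x => ?_)
  simp [op, Matrix.ofLp_toEuclideanCLM, Matrix.mulVec, dotProduct]

end BddMeas

end BddMeas

/-! ### Bilinear functions -/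

section IsBilin

variable {V : Type*} [AddCommGroup V] [Module ℝ V]

/-- Bilinearity of a real-valued function of two variables. -/
structure IsBilin (F : V → V → ℝ) : Prop where
  add_left : ∀ w w' v, F (w + w') v = F w v + F w' v
  smul_left : ∀ (t : ℝ) w v, F (t • w) v = t * F w v
  add_right : ∀ w v v', F w (v + v') = F w v + F w v'
  smul_right : ∀ (t : ℝ) w v, F w (t • v) = t * F w v

namespace IsBilin

/-- The bilinear map given by a bilinear function. -/
def toLin {F : V → V → ℝ} (h : IsBilin F) : V →ₗ[ℝ] V →ₗ[ℝ] ℝ :=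
  LinearMap.mk₂ ℝ F h.add_left h.smul_left h.add_right h.smul_right

theorem toLin_apply {F : V → V → ℝ} (h : IsBilin F) (w v : V) : h.toLin w v = F w v := rfl

theorem zero : IsBilin fun _ _ : V => (0 : ℝ) := by constructor <;> intros <;> simp

theorem add {F G : V → V → ℝ} (hF : IsBilin F) (hG : IsBilin G) :
    IsBilin fun w v => F w v + G w v := by
  constructor <;> intros <;> simp only [hF.add_left, hF.add_right, hF.smul_left, hF.smul_right,
    hG.add_left, hG.add_right, hG.smul_left, hG.smul_right] <;> ring

theorem const_mul {F : V → V → ℝ} (hF : IsBilin F) (t : ℝ) : IsBilin fun w v => t * F w v := by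
  constructor <;> intros <;>
    simp only [hF.add_left, hF.add_right, hF.smul_left, hF.smul_right] <;> ring

theorem sub {F G : V → V → ℝ} (hF : IsBilin F) (hG : IsBilin G) :
    IsBilin fun w v => F w v - G w v := by
  constructor <;> intros <;> simp only [hF.add_left, hF.add_right, hF.smul_left, hF.smul_right,
    hG.add_left, hG.add_right, hG.smul_left, hG.smul_right] <;> ring

theorem flip {F : V → V → ℝ} (hF : IsBilin F) : IsBilin fun w v => F v w :=
  ⟨fun w w' v => hF.add_right v w w', fun t w v => hF.smul_right t v w,
    fun w v v' => hF.add_left v v' w, fun t w v => hF.smul_left t v w⟩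

theorem sum {ι : Type*} (s : Finset ι) {F : ι → V → V → ℝ} (hF : ∀ i ∈ s, IsBilin (F i)) :
    IsBilin fun w v => ∑ i ∈ s, F i w v := by
  classical
  induction s using Finset.induction_on with
  | empty => simpa using zero
  | insert a s ha ih =>
    simp only [Finset.sum_insert ha]
    exact (hF a (Finset.mem_insert_self a s)).add
      (ih fun i hi => hF i (Finset.mem_insert_of_mem hi))

theorem integral {X : Type*} [MeasurableSpace X] {μ : Measure X} {F : V → V → X → ℝ}
    (hF : ∀ x, IsBilin fun w v => F w v x) (hint : ∀ w v, Integrable (F w v) μ) :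
    IsBilin fun w v => ∫ x, F w v x ∂μ where
  add_left w w' v := by
    simp_rw [(hF _).add_left]
    exact integral_add (hint w v) (hint w' v)
  smul_left t w v := by
    simp_rw [(hF _).smul_left]
    exact integral_const_mul t _
  add_right w v v' := by
    simp_rw [(hF _).add_right]
    exact integral_add (hint w v) (hint w v')
  smul_right t w v := by
    simp_rw [(hF _).smul_right]
    exact integral_const_mul t _

end IsBilin

end IsBilin

/-! ### Traces of broken polynomials -/

section Values

variable {d N r : ℕ}

theorem val_add (w v : DGSpace d N r) (i : Fin N) (x : Pt d) :
    val (w + v) i x = val w i x + val v i x := by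
  simp [val]

theorem val_smul (t : ℝ) (w : DGSpace d N r) (i : Fin N) (x : Pt d) :
    val (t • w) i x = t * val w i x := by
  simp [val, MvPolynomial.smul_eval]

theorem grad_add (w v : DGSpace d N r) (i : Fin N) (x : Pt d) :
    grad (w + v) i x = grad w i x + grad v i x := by
  ext k; simp [grad]

theorem grad_smul (t : ℝ) (w : DGSpace d N r) (i : Fin N) (x : Pt d) :
    grad (t • w) i x = t • grad w i x := by
  ext k; simp [grad, MvPolynomial.smul_eval]

theorem continuous_val (w : DGSpace d N r) (i : Fin N) : Continuous (val w i) :=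
  (MvPolynomial.continuous_eval _).comp (by fun_prop : Continuous fun x : Pt d => fun k => x k)

theorem continuous_grad (w : DGSpace d N r) (i : Fin N) : Continuous (grad w i) := by
  refine (PiLp.continuous_toLp 2 _).comp (continuous_pi fun k => ?_)
  exact (MvPolynomial.continuous_eval _).comp
    (by fun_prop : Continuous fun x : Pt d => fun k => x k)

end Values

namespace Mesh

/-! ### Linearity of traces and calculus of the face and element sums -/

section Linearity

variable {d N r : ℕ} (T : Mesh d N)

theorem jump_add (w v : DGSpace d N r) (i j : Fin N) (x : Pt d) :
    T.jump (w + v) i j x = T.jump w i j x + T.jump v i j x := by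
  simp only [jump, val_add, add_smul]; abel

theorem jump_smul (t : ℝ) (w : DGSpace d N r) (i j : Fin N) (x : Pt d) :
    T.jump (t • w) i j x = t • T.jump w i j x := by
  simp only [jump, val_smul, mul_smul, smul_add]

theorem jumpB_add (w v : DGSpace d N r) (i : Fin N) (x : Pt d) :
    T.jumpB (w + v) i x = T.jumpB w i x + T.jumpB v i x := by
  simp only [jumpB, val_add, add_smul]

theorem jumpB_smul (t : ℝ) (w : DGSpace d N r) (i : Fin N) (x : Pt d) :
    T.jumpB (t • w) i x = t • T.jumpB w i x := by
  simp only [jumpB, val_smul, mul_smul]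

theorem flux_add (a : Pt d → Matrix (Fin d) (Fin d) ℝ) (w v : DGSpace d N r) (i : Fin N)
    (x : Pt d) : T.flux a (w + v) i x = T.flux a w i x + T.flux a v i x := by
  simp only [flux, grad_add, map_add]

theorem flux_smul (a : Pt d → Matrix (Fin d) (Fin d) ℝ) (t : ℝ) (w : DGSpace d N r) (i : Fin N)
    (x : Pt d) : T.flux a (t • w) i x = t • T.flux a w i x := by
  simp only [flux, grad_smul, map_smul]

theorem avgFlux_add (a : Pt d → Matrix (Fin d) (Fin d) ℝ) (w v : DGSpace d N r) (i j : Fin N)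
    (x : Pt d) : T.avgFlux a (w + v) i j x = T.avgFlux a w i j x + T.avgFlux a v i j x := by
  simp only [avgFlux, flux_add, smul_add]; abel

theorem avgFlux_smul (a : Pt d → Matrix (Fin d) (Fin d) ℝ) (t : ℝ) (w : DGSpace d N r)
    (i j : Fin N) (x : Pt d) : T.avgFlux a (t • w) i j x = t • T.avgFlux a w i j x := by
  simp only [avgFlux, flux_smul, smul_add, smul_comm t]

theorem downstream_add (b : Pt d → Pt d) (w v : DGSpace d N r) (i j : Fin N) (x : Pt d) :
    T.downstream b (w + v) i j x = T.downstream b w i j x + T.downstream b v i j x := by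
  simp only [downstream, val_add]; split_ifs <;> rfl

theorem downstream_smul (b : Pt d → Pt d) (t : ℝ) (w : DGSpace d N r) (i j : Fin N) (x : Pt d) :
    T.downstream b (t • w) i j x = t * T.downstream b w i j x := by
  simp only [downstream, val_smul]; split_ifs <;> rfl

theorem isBilin_sumInterior {F : DGSpace d N r → DGSpace d N r → Fin N → Fin N → Pt d → ℝ}
    (hF : ∀ i j x, IsBilin fun w v => F w v i j x)
    (hint : ∀ i j, i ≠ j → ∀ w v, IntegrableOn (F w v i j) (T.face i j) (surf d)) :
    IsBilin fun w v => T.sumInterior (F w v) := by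
  refine IsBilin.sum _ fun i _ => IsBilin.sum _ fun j _ => ?_
  by_cases h : i < j
  · simp only [if_pos h]
    exact IsBilin.integral (hF i j) (hint i j h.ne)
  · simp only [if_neg h]
    exact IsBilin.zero

theorem isBilin_sumBoundary {F : DGSpace d N r → DGSpace d N r → Fin N → Pt d → ℝ}
    (hF : ∀ i x, IsBilin fun w v => F w v i x)
    (hint : ∀ i w v, IntegrableOn (F w v i) (T.bdryFace i) (surf d)) :
    IsBilin fun w v => T.sumBoundary (F w v) :=
  IsBilin.sum _ fun i _ => IsBilin.integral (hF i) (hint i)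

theorem isBilin_sumElem {F : DGSpace d N r → DGSpace d N r → Fin N → Pt d → ℝ}
    (hF : ∀ i x, IsBilin fun w v => F w v i x)
    (hint : ∀ i w v, IntegrableOn (F w v i) (T.elem i) volume) :
    IsBilin fun w v => T.sumElem (F w v) :=
  IsBilin.sum _ fun i _ => IsBilin.integral (hF i) (hint i)

theorem sumInterior_const_mul (t : ℝ) (F : Fin N → Fin N → Pt d → ℝ) :
    T.sumInterior (fun i j x => t * F i j x) = t * T.sumInterior F := by
  simp only [sumInterior, Finset.mul_sum, integral_const_mul, mul_ite, mul_zero]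

theorem sumBoundary_const_mul (t : ℝ) (F : Fin N → Pt d → ℝ) :
    T.sumBoundary (fun i x => t * F i x) = t * T.sumBoundary F := by
  simp only [sumBoundary, Finset.mul_sum, integral_const_mul]

theorem sumElem_const_mul (t : ℝ) (F : Fin N → Pt d → ℝ) :
    T.sumElem (fun i x => t * F i x) = t * T.sumElem F := by
  simp only [sumElem, Finset.mul_sum, integral_const_mul]

theorem sumInterior_add {F G : Fin N → Fin N → Pt d → ℝ}
    (hF : ∀ i j, i ≠ j → IntegrableOn (F i j) (T.face i j) (surf d))
    (hG : ∀ i j, i ≠ j → IntegrableOn (G i j) (T.face i j) (surf d)) :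
    T.sumInterior (fun i j x => F i j x + G i j x) = T.sumInterior F + T.sumInterior G := by
  simp only [sumInterior, ← Finset.sum_add_distrib]
  refine Finset.sum_congr rfl fun i _ => Finset.sum_congr rfl fun j _ => ?_
  split_ifs with h
  · exact integral_add (hF i j h.ne) (hG i j h.ne)
  · rw [add_zero]

theorem sumBoundary_add {F G : Fin N → Pt d → ℝ}
    (hF : ∀ i, IntegrableOn (F i) (T.bdryFace i) (surf d))
    (hG : ∀ i, IntegrableOn (G i) (T.bdryFace i) (surf d)) :
    T.sumBoundary (fun i x => F i x + G i x) = T.sumBoundary F + T.sumBoundary G := by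
  simp only [sumBoundary, ← Finset.sum_add_distrib]
  exact Finset.sum_congr rfl fun i _ => integral_add (hF i) (hG i)

theorem sumElem_add {F G : Fin N → Pt d → ℝ}
    (hF : ∀ i, IntegrableOn (F i) (T.elem i) volume)
    (hG : ∀ i, IntegrableOn (G i) (T.elem i) volume) :
    T.sumElem (fun i x => F i x + G i x) = T.sumElem F + T.sumElem G := by
  simp only [sumElem, ← Finset.sum_add_distrib]
  exact Finset.sum_congr rfl fun i _ => integral_add (hF i) (hG i)

theorem sumInterior_congr {F G : Fin N → Fin N → Pt d → ℝ}
    (h : ∀ i j, i < j → ∀ᵐ x ∂(surf d).restrict (T.face i j), F i j x = G i j x) :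
    T.sumInterior F = T.sumInterior G := by
  refine Finset.sum_congr rfl fun i _ => Finset.sum_congr rfl fun j _ => ?_
  split_ifs with hij
  · exact integral_congr_ae (h i j hij)
  · rfl

theorem sumBoundary_congr {F G : Fin N → Pt d → ℝ}
    (h : ∀ i, ∀ᵐ x ∂(surf d).restrict (T.bdryFace i), F i x = G i x) :
    T.sumBoundary F = T.sumBoundary G :=
  Finset.sum_congr rfl fun i _ => integral_congr_ae (h i)

theorem sumElem_congr {F G : Fin N → Pt d → ℝ}
    (h : ∀ i, ∀ᵐ x ∂volume.restrict (T.elem i), F i x = G i x) :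
    T.sumElem F = T.sumElem G :=
  Finset.sum_congr rfl fun i _ => integral_congr_ae (h i)

theorem sumInterior_nonneg {F : Fin N → Fin N → Pt d → ℝ}
    (h : ∀ i j, i < j → 0 ≤ ∫ x in T.face i j, F i j x ∂(surf d)) : 0 ≤ T.sumInterior F := by
  refine Finset.sum_nonneg fun i _ => Finset.sum_nonneg fun j _ => ?_
  split_ifs with hij
  · exact h i j hij
  · exact le_rfl

theorem sumBoundary_nonneg {F : Fin N → Pt d → ℝ}
    (h : ∀ i, 0 ≤ ∫ x in T.bdryFace i, F i x ∂(surf d)) : 0 ≤ T.sumBoundary F :=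
  Finset.sum_nonneg fun i _ => h i

theorem sumInterior_eq_zero {F : Fin N → Fin N → Pt d → ℝ}
    (h : ∀ i j, i < j → ∀ᵐ x ∂(surf d).restrict (T.face i j), F i j x = 0) :
    T.sumInterior F = 0 := by
  rw [T.sumInterior_congr h]
  simp [sumInterior]

theorem sumBoundary_eq_zero {F : Fin N → Pt d → ℝ}
    (h : ∀ i, ∀ᵐ x ∂(surf d).restrict (T.bdryFace i), F i x = 0) :
    T.sumBoundary F = 0 := by
  rw [T.sumBoundary_congr h]
  simp [sumBoundary]

end Linearity

/-! ### Integrability of the integrands -/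

section Integrability

variable {n N r : ℕ} (T : Mesh (n + 1) N)

theorem frontier_subset_closedElem (i : Fin N) : frontier (T.elem i) ⊆ T.closedElem i :=
  fun _ hx => (T.mem_frontier_elem.1 hx).1

theorem bddMeas_face_left {E : Type*} [NormedAddCommGroup E] {f : Pt (n + 1) → E} {i j : Fin N}
    (hij : i ≠ j) (hf : BddMeas f ((surf (n + 1)).restrict (frontier (T.elem i)))) :
    BddMeas f ((surf (n + 1)).restrict (T.face i j)) :=
  hf.mono (Measure.restrict_mono_set _ (T.face_subset_frontier hij))

theorem bddMeas_face_right {E : Type*} [NormedAddCommGroup E] {f : Pt (n + 1) → E} {i j : Fin N}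
    (hij : i ≠ j) (hf : BddMeas f ((surf (n + 1)).restrict (frontier (T.elem j)))) :
    BddMeas f ((surf (n + 1)).restrict (T.face i j)) := by
  rw [T.face_comm]
  exact T.bddMeas_face_left hij.symm hf

theorem bddMeas_bdryFace {E : Type*} [NormedAddCommGroup E] {f : Pt (n + 1) → E} {i : Fin N}
    (hf : BddMeas f ((surf (n + 1)).restrict (frontier (T.elem i)))) :
    BddMeas f ((surf (n + 1)).restrict (T.bdryFace i)) :=
  hf.mono (Measure.restrict_mono_set _ (T.bdryFace_subset_frontier i))

theorem isFiniteMeasure_face {i j : Fin N} (hij : i ≠ j) :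
    IsFiniteMeasure ((surf (n + 1)).restrict (T.face i j)) :=
  ⟨by
    rw [Measure.restrict_apply_univ]
    exact (measure_mono (T.face_subset_frontier hij)).trans_lt (T.surf_frontier_lt_top i)⟩

instance isFiniteMeasure_bdryFace (i : Fin N) :
    IsFiniteMeasure ((surf (n + 1)).restrict (T.bdryFace i)) :=
  ⟨by
    rw [Measure.restrict_apply_univ]
    exact (measure_mono (T.bdryFace_subset_frontier i)).trans_lt (T.surf_frontier_lt_top i)⟩

instance isFiniteMeasure_elem (i : Fin N) : IsFiniteMeasure (volume.restrict (T.elem i)) :=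
  ⟨by
    rw [Measure.restrict_apply_univ]
    exact (measure_mono (T.elem_subset_closedElem i)).trans_lt
      (T.isCompact_closedElem i).measure_lt_top⟩

theorem integrableOn_face {f : Pt (n + 1) → ℝ} {i j : Fin N} (hij : i ≠ j)
    (hf : BddMeas f ((surf (n + 1)).restrict (T.face i j))) :
    IntegrableOn f (T.face i j) (surf (n + 1)) :=
  have := T.isFiniteMeasure_face hij
  hf.integrable

theorem bddMeas_of_continuousOn {E : Type*} [NormedAddCommGroup E] {f : Pt (n + 1) → E}
    {i : Fin N} (hf : ContinuousOn f (T.closedElem i)) :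
    BddMeas f ((surf (n + 1)).restrict (frontier (T.elem i))) :=
  BddMeas.of_continuous_of_isCompact (T.isCompact_closedElem i)
    (T.isClosed_closedElem i).measurableSet (T.frontier_subset_closedElem i) hf

theorem bddMeas_elem_of_continuousOn {E : Type*} [NormedAddCommGroup E] {f : Pt (n + 1) → E}
    {i : Fin N} (hf : ContinuousOn f (T.closedElem i)) :
    BddMeas f (volume.restrict (T.elem i)) :=
  BddMeas.of_continuous_of_isCompact (T.isCompact_closedElem i)
    (T.isClosed_closedElem i).measurableSet (T.elem_subset_closedElem i) hf

theorem bddMeas_val (w : DGSpace (n + 1) N r) (i j : Fin N) :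
    BddMeas (val w j) ((surf (n + 1)).restrict (frontier (T.elem i))) :=
  T.bddMeas_of_continuousOn (continuous_val w j).continuousOn

theorem bddMeas_grad (w : DGSpace (n + 1) N r) (i j : Fin N) :
    BddMeas (grad w j) ((surf (n + 1)).restrict (frontier (T.elem i))) :=
  T.bddMeas_of_continuousOn (continuous_grad w j).continuousOn

theorem bddMeas_elem_val (w : DGSpace (n + 1) N r) (i j : Fin N) :
    BddMeas (val w j) (volume.restrict (T.elem i)) :=
  T.bddMeas_elem_of_continuousOn (continuous_val w j).continuousOn

theorem bddMeas_elem_grad (w : DGSpace (n + 1) N r) (i j : Fin N) :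
    BddMeas (grad w j) (volume.restrict (T.elem i)) :=
  T.bddMeas_elem_of_continuousOn (continuous_grad w j).continuousOn

theorem bddMeas_normal (i : Fin N) :
    BddMeas (T.normal i) ((surf (n + 1)).restrict (frontier (T.elem i))) :=
  ⟨T.aestronglyMeasurable_normal i, 1, (T.ae_norm_normal i).mono fun _ h => h.le⟩

theorem bddMeas_jump (w : DGSpace (n + 1) N r) {i j : Fin N} (hij : i ≠ j) :
    BddMeas (T.jump w i j) ((surf (n + 1)).restrict (T.face i j)) :=
  (T.bddMeas_face_left hij ((T.bddMeas_val w i i).smul (T.bddMeas_normal i))).add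
    (T.bddMeas_face_right hij ((T.bddMeas_val w j j).smul (T.bddMeas_normal j)))

theorem bddMeas_jumpB (w : DGSpace (n + 1) N r) (i : Fin N) :
    BddMeas (T.jumpB w i) ((surf (n + 1)).restrict (T.bdryFace i)) :=
  T.bddMeas_bdryFace ((T.bddMeas_val w i i).smul (T.bddMeas_normal i))

variable {T} {a : Pt (n + 1) → Matrix (Fin (n + 1)) (Fin (n + 1)) ℝ}

theorem IsDiffusion.bddMeas_elem (ha : T.IsDiffusion a) (i : Fin N) (k l : Fin (n + 1)) :
    BddMeas (fun x => a x k l) (volume.restrict (T.elem i)) := by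
  obtain ⟨C, hC⟩ := ha.bounded
  refine ⟨(ha.measurable k l).aestronglyMeasurable, C, ?_⟩
  filter_upwards [ae_restrict_mem (T.isOpen_elem i).measurableSet] with x hx
  exact hC x (T.elem_subset_domain i hx) k l

theorem nhdsWithin_elem_neBot {i : Fin N} {x : Pt (n + 1)} (hx : x ∈ T.closedElem i) :
    (𝓝[T.elem i] x).NeBot := by
  rwa [← mem_closure_iff_nhdsWithin_neBot, T.closure_elem]

theorem matTrace_eq {i : Fin N} {x : Pt (n + 1)} (hx : x ∈ T.closedElem i)
    {A : Matrix (Fin (n + 1)) (Fin (n + 1)) ℝ} (hA : Tendsto a (𝓝[T.elem i] x) (𝓝 A)) :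
    T.matTrace a i x = A :=
  have := nhdsWithin_elem_neBot hx
  hA.limUnder_eq

theorem IsDiffusion.ae_tendsto (ha : T.IsDiffusion a) (i : Fin N) :
    ∀ᵐ x ∂(surf (n + 1)).restrict (frontier (T.elem i)),
      Tendsto a (𝓝[T.elem i] x) (𝓝 (T.matTrace a i x)) := by
  filter_upwards [ha.trace i, ae_restrict_mem (T.measurableSet_frontier_elem i)] with x h hx
  obtain ⟨A, hA⟩ := h
  rwa [matTrace_eq (T.frontier_subset_closedElem i hx) hA]

/-- The trace is a pointwise a.e. limit of measurable functions: the values of `a` along the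
segments from the boundary point to a fixed interior point `z`, which stay inside the element by
convexity. -/
theorem IsDiffusion.bddMeas_matTrace (ha : T.IsDiffusion a) (i : Fin N) (k l : Fin (n + 1)) :
    BddMeas (fun x => T.matTrace a i x k l)
      ((surf (n + 1)).restrict (frontier (T.elem i))) := by
  obtain ⟨C, hC⟩ := ha.bounded
  obtain ⟨z, hz⟩ := T.elem_nonempty i
  have hmem := ae_restrict_mem (μ := surf (n + 1)) (T.measurableSet_frontier_elem i)
  have hlim : ∀ᵐ x ∂(surf (n + 1)).restrict (frontier (T.elem i)),
      Tendsto (fun m : ℕ => a (x + (1 / ((m : ℝ) + 1)) • (z - x)) k l) atTop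
        (𝓝 (T.matTrace a i x k l)) := by
    filter_upwards [ha.ae_tendsto i, hmem] with x hx hxf
    have h1 : Tendsto (fun m : ℕ => x + (1 / ((m : ℝ) + 1)) • (z - x)) atTop
        (𝓝[T.elem i] x) := by
      refine tendsto_nhdsWithin_iff.2 ⟨?_, Eventually.of_forall fun m => ?_⟩
      · have := (tendsto_one_div_add_atTop_nhds_zero_nat (𝕜 := ℝ)).smul_const (z - x)
        simpa using this.const_add x
      · refine (T.convex_closedElem i).add_smul_sub_mem_interior
          (T.frontier_subset_closedElem i hxf) hz ⟨by positivity, ?_⟩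
        rw [div_le_one (by positivity)]
        have : (0 : ℝ) ≤ m := Nat.cast_nonneg m
        linarith
    have h2 := hx.comp h1
    exact ((continuous_apply l).comp (continuous_apply k)).continuousAt.tendsto.comp h2
  refine ⟨AEMeasurable.aestronglyMeasurable ?_, C, ?_⟩
  · refine aemeasurable_of_tendsto_metrizable_ae atTop (fun m => ?_) hlim
    exact ((ha.measurable k l).comp (by fun_prop)).aemeasurable
  · filter_upwards [ha.ae_tendsto i, hmem] with x hx hxf
    have := nhdsWithin_elem_neBot (T.frontier_subset_closedElem i hxf)
    have h2 : Tendsto (fun y => ‖a y k l‖) (𝓝[T.elem i] x) (𝓝 ‖T.matTrace a i x k l‖) :=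
      (((continuous_apply l).comp (continuous_apply k)).continuousAt.tendsto.comp hx).norm
    refine le_of_tendsto h2 ?_
    filter_upwards [self_mem_nhdsWithin] with y hy
    exact hC y (T.elem_subset_domain i hy) k l

theorem IsDiffusion.bddMeas_flux (ha : T.IsDiffusion a) (w : DGSpace (n + 1) N r) (i : Fin N) :
    BddMeas (T.flux a w i) ((surf (n + 1)).restrict (frontier (T.elem i))) :=
  BddMeas.op_apply (ha.bddMeas_matTrace i) (T.bddMeas_grad w i i)

theorem IsDiffusion.bddMeas_avgFlux (ha : T.IsDiffusion a) (w : DGSpace (n + 1) N r)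
    {i j : Fin N} (hij : i ≠ j) :
    BddMeas (T.avgFlux a w i j) ((surf (n + 1)).restrict (T.face i j)) :=
  (BddMeas.const (1 / 2 : ℝ)).smul ((T.bddMeas_face_left hij (ha.bddMeas_flux w i)).add
    (T.bddMeas_face_right hij (ha.bddMeas_flux w j)))

end Integrability

end Mesh

/-! ### Square roots of positive semidefinite matrices -/

section Matrix

variable {d : ℕ}

theorem continuous_op_apply :
    Continuous fun p : Matrix (Fin d) (Fin d) ℝ × Pt d => op p.1 p.2 := by
  have : (fun p : Matrix (Fin d) (Fin d) ℝ × Pt d => op p.1 p.2) =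
      fun p => WithLp.toLp 2 (p.1.mulVec (WithLp.ofLp p.2)) := by
    ext p : 1
    rw [op, ← Matrix.ofLp_toEuclideanCLM]
  rw [this]
  exact (PiLp.continuous_toLp 2 _).comp
    (continuous_fst.matrix_mulVec ((PiLp.continuous_ofLp 2 _).comp continuous_snd))

theorem exists_norm_op_le (C : ℝ) : ∃ K : ℝ, ∀ A : Matrix (Fin d) (Fin d) ℝ,
    (∀ k l, |A k l| ≤ C) → ‖op A‖ ≤ K := by
  refine ⟨∑ k : Fin d, ∑ l : Fin d, C * ‖op (Matrix.single k l (1 : ℝ))‖, fun A hA => ?_⟩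
  have h : op A = ∑ k, ∑ l, A k l • op (Matrix.single k l (1 : ℝ)) := by
    conv_lhs => rw [Matrix.matrix_eq_sum_single A]
    simp only [op, map_sum]
    refine Finset.sum_congr rfl fun k _ => Finset.sum_congr rfl fun l _ => ?_
    rw [← map_smul, Matrix.smul_single, smul_eq_mul, mul_one]
  rw [h]
  refine (norm_sum_le _ _).trans (Finset.sum_le_sum fun k _ => (norm_sum_le _ _).trans
    (Finset.sum_le_sum fun l _ => ?_))
  rw [norm_smul]
  exact mul_le_mul_of_nonneg_right (hA k l) (norm_nonneg _)

theorem inner_op_comm {A : Matrix (Fin d) (Fin d) ℝ} (hA : A.IsSymm) (u v : Pt d) :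
    ⟪op A u, v⟫ = ⟪u, op A v⟫ := by
  have h : star (op A) = op A := by
    rw [op, ← map_star, Matrix.star_eq_conjTranspose, Matrix.conjTranspose_eq_transpose_of_trivial,
      hA.eq]
  rw [← ContinuousLinearMap.adjoint_inner_right, ← ContinuousLinearMap.star_eq_adjoint, h]

theorem isSymm_matSqrt (A : Matrix (Fin d) (Fin d) ℝ) : (matSqrt A).IsSymm := by
  have h : IsSelfAdjoint (matSqrt A) := cfc_predicate Real.sqrt A
  rw [IsSelfAdjoint, Matrix.star_eq_conjTranspose,
    Matrix.conjTranspose_eq_transpose_of_trivial] at h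
  exact h

theorem matSqrt_mul_self {A : Matrix (Fin d) (Fin d) ℝ} (hA : A.IsSymm)
    (hpos : ∀ ζ : Pt d, 0 ≤ ⟪ζ, op A ζ⟫) : matSqrt A * matSqrt A = A := by
  have hsa : IsSelfAdjoint A := by
    rw [IsSelfAdjoint, Matrix.star_eq_conjTranspose,
      Matrix.conjTranspose_eq_transpose_of_trivial, hA.eq]
  have hherm : A.IsHermitian := hsa
  have hpsd : A.PosSemidef := by
    refine Matrix.PosSemidef.of_dotProduct_mulVec_nonneg hherm fun x => ?_
    have := hpos (WithLp.toLp 2 x)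
    rw [op, Matrix.toEuclideanCLM_toLp, EuclideanSpace.inner_toLp_toLp, dotProduct_comm] at this
    exact this
  have hspec : ∀ x ∈ spectrum ℝ A, 0 ≤ x := by
    intro x hx
    rw [hherm.spectrum_real_eq_range_eigenvalues] at hx
    obtain ⟨k, rfl⟩ := hx
    exact hpsd.eigenvalues_nonneg k
  rw [matSqrt, ← cfc_mul Real.sqrt Real.sqrt A]
  conv_rhs => rw [← cfc_id ℝ A hsa]
  exact cfc_congr fun x hx => Real.mul_self_sqrt (hspec x hx)

theorem op_eq_op_matSqrt {A : Matrix (Fin d) (Fin d) ℝ} (hA : A.IsSymm)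
    (hpos : ∀ ζ : Pt d, 0 ≤ ⟪ζ, op A ζ⟫) (ζ : Pt d) :
    op A ζ = op (matSqrt A) (op (matSqrt A) ζ) := by
  conv_lhs => rw [← matSqrt_mul_self hA hpos]
  rw [op, map_mul]
  rfl

theorem norm_op_matSqrt_sq {A : Matrix (Fin d) (Fin d) ℝ} (hA : A.IsSymm)
    (hpos : ∀ ζ : Pt d, 0 ≤ ⟪ζ, op A ζ⟫) (ζ : Pt d) :
    ‖op (matSqrt A) ζ‖ ^ 2 = ⟪op A ζ, ζ⟫ := by
  rw [op_eq_op_matSqrt hA hpos, inner_op_comm (isSymm_matSqrt A), real_inner_self_eq_norm_sq]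

/-- The quadratic form is $|\sqrt A\zeta|^2$, so its zeros are killed by $\sqrt A$ and hence by $A$.
Vanishing diffusion energy therefore makes the flux vanish, although the gradient need not. -/
theorem op_apply_eq_zero {A : Matrix (Fin d) (Fin d) ℝ} (hA : A.IsSymm)
    (hpos : ∀ ζ : Pt d, 0 ≤ ⟪ζ, op A ζ⟫) {ζ : Pt d} (h : ⟪op A ζ, ζ⟫ = 0) : op A ζ = 0 := by
  rw [← norm_op_matSqrt_sq hA hpos, pow_eq_zero_iff two_ne_zero, norm_eq_zero] at h
  rw [op_eq_op_matSqrt hA hpos, h, map_zero]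

theorem norm_op_matSqrt_le {A : Matrix (Fin d) (Fin d) ℝ} (hA : A.IsSymm)
    (hpos : ∀ ζ : Pt d, 0 ≤ ⟪ζ, op A ζ⟫) : ‖op (matSqrt A)‖ ≤ √‖op A‖ := by
  refine ContinuousLinearMap.opNorm_le_bound _ (Real.sqrt_nonneg _) fun ζ => ?_
  refine abs_le_of_sq_le_sq' ?_ (by positivity) |>.2
  rw [norm_op_matSqrt_sq hA hpos, mul_pow, Real.sq_sqrt (norm_nonneg _)]
  calc ⟪op A ζ, ζ⟫ ≤ ‖op A ζ‖ * ‖ζ‖ := real_inner_le_norm _ _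
    _ ≤ ‖op A‖ * ‖ζ‖ * ‖ζ‖ := by gcongr; exact (op A).le_opNorm ζ
    _ = _ := by ring

end Matrix

namespace Mesh

variable {n N r : ℕ} {T : Mesh (n + 1) N} {a : Pt (n + 1) → Matrix (Fin (n + 1)) (Fin (n + 1)) ℝ}

/-! ### The diffusion part -/

theorem IsDiffusion.ae_elem (ha : T.IsDiffusion a) (i : Fin N) :
    ∀ᵐ x ∂volume.restrict (T.elem i),
      (a x).IsSymm ∧ ∀ ζ : Pt (n + 1), 0 ≤ ⟪ζ, op (a x) ζ⟫ := by
  filter_upwards [ae_restrict_of_ae_restrict_of_subset (T.elem_subset_domain i) ha.nonneg,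
    ae_restrict_mem (T.isOpen_elem i).measurableSet] with x h hx
  exact ⟨ha.symm x (T.elem_subset_domain i hx), h⟩

/-- Every neighbourhood of `x` meets the open element in a nonempty open set, which has positive
volume. This lets almost-everywhere information inside reach the traces. -/
theorem frequently_nhdsWithin_elem {i : Fin N} {p : Pt (n + 1) → Prop}
    (h : ∀ᵐ y ∂volume.restrict (T.elem i), p y) {x : Pt (n + 1)} (hx : x ∈ T.closedElem i) :
    ∃ᶠ y in 𝓝[T.elem i] x, p y := by
  intro hcon
  rw [eventually_nhdsWithin_iff, eventually_nhds_iff] at hcon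
  obtain ⟨U, hU, hUo, hxU⟩ := hcon
  have hne : (U ∩ T.elem i).Nonempty := by
    rw [← T.closure_elem] at hx
    exact mem_closure_iff.1 hx U hUo hxU
  have hpos := (hUo.inter (T.isOpen_elem i)).measure_pos volume hne
  rw [ae_restrict_iff' (T.isOpen_elem i).measurableSet, ae_iff] at h
  refine hpos.ne' (measure_mono_null (fun y hy => ?_) h)
  exact fun h' => hU y hy.1 hy.2 (h' hy.2)

theorem op_apply_eq_zero_of_frequently {d : ℕ} {a : Pt d → Matrix (Fin d) (Fin d) ℝ}
    {A : Matrix (Fin d) (Fin d) ℝ} {g : Pt d → Pt d} {l : Filter (Pt d)} {ζ : Pt d}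
    (ha : Tendsto a l (𝓝 A)) (hg : Tendsto g l (𝓝 ζ)) (h : ∃ᶠ y in l, op (a y) (g y) = 0) :
    op A ζ = 0 := by
  have hlim := (continuous_op_apply.tendsto (A, ζ)).comp (ha.prodMk_nhds hg)
  have hmem : (fun p : Matrix (Fin d) (Fin d) ℝ × Pt d => op p.1 p.2) (A, ζ) ∈
      ({0} : Set (Pt d)) := isClosed_singleton.mem_of_frequently_of_tendsto h hlim
  exact hmem

/-- If `a ∇w` vanishes in an element then so does its trace. -/
theorem IsDiffusion.flux_eq_zero (ha : T.IsDiffusion a) {w : DGSpace (n + 1) N r} {i : Fin N}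
    (h : ∀ᵐ y ∂volume.restrict (T.elem i), op (a y) (grad w i y) = 0) :
    ∀ᵐ x ∂(surf (n + 1)).restrict (frontier (T.elem i)), T.flux a w i x = 0 := by
  filter_upwards [ha.ae_tendsto i, ae_restrict_mem (T.measurableSet_frontier_elem i)] with x hx hxf
  exact op_apply_eq_zero_of_frequently hx
    ((continuous_grad w i).continuousAt.tendsto.mono_left nhdsWithin_le_nhds)
    (frequently_nhdsWithin_elem h (T.frontier_subset_closedElem i hxf))

variable (T)

/-- The element part of the diffusion form. -/
def diffForm (a : Pt (n + 1) → Matrix (Fin (n + 1)) (Fin (n + 1)) ℝ)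
    (w v : DGSpace (n + 1) N r) : ℝ :=
  T.sumElem fun i x => ⟪op (a x) (grad w i x), grad v i x⟫

/-- The interior penalty form for `C_p = 1`. -/
def penaltyForm (a : Pt (n + 1) → Matrix (Fin (n + 1)) (Fin (n + 1)) ℝ)
    (w v : DGSpace (n + 1) N r) : ℝ :=
  T.sumInterior (fun i j x => T.scale r a i j * ⟪T.jump w i j x, T.jump v i j x⟫) +
    T.sumBoundary (fun i x => T.scaleB r a i * ⟪T.jumpB w i x, T.jumpB v i x⟫)

/-- The form coupling averages of fluxes with jumps. -/
def fluxForm (a : Pt (n + 1) → Matrix (Fin (n + 1)) (Fin (n + 1)) ℝ)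
    (w v : DGSpace (n + 1) N r) : ℝ :=
  T.sumInterior (fun i j x => ⟪T.avgFlux a w i j x, T.jump v i j x⟫) +
    T.sumBoundary (fun i x => ⟪T.flux a w i x, T.jumpB v i x⟫)

variable {T}

theorem IsDiffusion.integrable_flux (ha : T.IsDiffusion a) (w v : DGSpace (n + 1) N r)
    {i j : Fin N} (hij : i ≠ j) :
    IntegrableOn (fun x => ⟪T.avgFlux a w i j x, T.jump v i j x⟫) (T.face i j) (surf (n + 1)) :=
  T.integrableOn_face hij ((ha.bddMeas_avgFlux w hij).inner (T.bddMeas_jump v hij))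

theorem IsDiffusion.integrable_fluxB (ha : T.IsDiffusion a) (w v : DGSpace (n + 1) N r)
    (i : Fin N) :
    IntegrableOn (fun x => ⟪T.flux a w i x, T.jumpB v i x⟫) (T.bdryFace i) (surf (n + 1)) :=
  ((T.bddMeas_bdryFace (ha.bddMeas_flux w i)).inner (T.bddMeas_jumpB v i)).integrable

theorem integrable_jump (w v : DGSpace (n + 1) N r) {i j : Fin N} (hij : i ≠ j) :
    IntegrableOn (fun x => ⟪T.jump w i j x, T.jump v i j x⟫) (T.face i j) (surf (n + 1)) :=
  T.integrableOn_face hij ((T.bddMeas_jump w hij).inner (T.bddMeas_jump v hij))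

theorem integrable_jumpB (w v : DGSpace (n + 1) N r) (i : Fin N) :
    IntegrableOn (fun x => ⟪T.jumpB w i x, T.jumpB v i x⟫) (T.bdryFace i) (surf (n + 1)) :=
  ((T.bddMeas_jumpB w i).inner (T.bddMeas_jumpB v i)).integrable

theorem IsDiffusion.integrable_diff (ha : T.IsDiffusion a) (w v : DGSpace (n + 1) N r)
    (i : Fin N) :
    IntegrableOn (fun x => ⟪op (a x) (grad w i x), grad v i x⟫) (T.elem i) volume :=
  ((BddMeas.op_apply (ha.bddMeas_elem i) (T.bddMeas_elem_grad w i i)).inner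
    (T.bddMeas_elem_grad v i i)).integrable

theorem isBilin_inner_jump (i j : Fin N) (x : Pt (n + 1)) :
    IsBilin fun w v : DGSpace (n + 1) N r => ⟪T.jump w i j x, T.jump v i j x⟫ := by
  constructor <;> intros <;> simp only [jump_add, jump_smul, inner_add_left, inner_add_right,
    real_inner_smul_left, real_inner_smul_right]

theorem isBilin_inner_jumpB (i : Fin N) (x : Pt (n + 1)) :
    IsBilin fun w v : DGSpace (n + 1) N r => ⟪T.jumpB w i x, T.jumpB v i x⟫ := by
  constructor <;> intros <;> simp only [jumpB_add, jumpB_smul, inner_add_left, inner_add_right,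
    real_inner_smul_left, real_inner_smul_right]

theorem IsDiffusion.isBilin_diffForm (ha : T.IsDiffusion a) :
    IsBilin (T.diffForm (r := r) a) := by
  refine T.isBilin_sumElem (fun i x => ?_) fun i w v => ha.integrable_diff w v i
  constructor <;> intros <;> simp only [grad_add, grad_smul, map_add, map_smul, inner_add_left,
    inner_add_right, real_inner_smul_left, real_inner_smul_right]

theorem isBilin_penaltyForm (a : Pt (n + 1) → Matrix (Fin (n + 1)) (Fin (n + 1)) ℝ) :
    IsBilin (T.penaltyForm (r := r) a) := by
  unfold penaltyForm
  refine IsBilin.add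
    (T.isBilin_sumInterior
      (F := fun w v i j x => T.scale r a i j * ⟪T.jump w i j x, T.jump v i j x⟫) ?_ ?_)
    (T.isBilin_sumBoundary
      (F := fun w v i x => T.scaleB r a i * ⟪T.jumpB w i x, T.jumpB v i x⟫) ?_ ?_)
  · exact fun i j x => (isBilin_inner_jump i j x).const_mul _
  · exact fun _ _ hij w v => (integrable_jump w v hij).const_mul _
  · exact fun i x => (isBilin_inner_jumpB i x).const_mul _
  · exact fun i w v => (integrable_jumpB w v i).const_mul _

theorem IsDiffusion.isBilin_fluxForm (ha : T.IsDiffusion a) :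
    IsBilin (T.fluxForm (r := r) a) := by
  refine (T.isBilin_sumInterior (fun i j x => ?_)
    fun _ _ hij w v => ha.integrable_flux w v hij).add
    (T.isBilin_sumBoundary (fun i x => ?_) fun i w v => ha.integrable_fluxB w v i)
  · constructor <;> intros <;> simp only [avgFlux_add, avgFlux_smul, jump_add, jump_smul,
      inner_add_left, inner_add_right, real_inner_smul_left, real_inner_smul_right]
  · constructor <;> intros <;> simp only [flux_add, flux_smul, jumpB_add, jumpB_smul,
      inner_add_left, inner_add_right, real_inner_smul_left, real_inner_smul_right]

theorem IsDiffusion.formD_eq (ha : T.IsDiffusion a) (θ Cp : ℝ) (w v : DGSpace (n + 1) N r) :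
    T.formD a θ Cp w v = T.diffForm a w v + Cp * T.penaltyForm a w v -
      (T.fluxForm a w v - θ * T.fluxForm a v w) := by
  have h1 : T.sumInterior (fun i j x => ⟪T.avgFlux a w i j x, T.jump v i j x⟫
        - θ * ⟪T.avgFlux a v i j x, T.jump w i j x⟫) =
      T.sumInterior (fun i j x => ⟪T.avgFlux a w i j x, T.jump v i j x⟫) -
        θ * T.sumInterior (fun i j x => ⟪T.avgFlux a v i j x, T.jump w i j x⟫) := by
    simp only [sub_eq_add_neg, ← neg_mul]
    rw [T.sumInterior_add (fun i j hij => ha.integrable_flux w v hij)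
      (fun i j hij => (ha.integrable_flux v w hij).const_mul _), T.sumInterior_const_mul]
  have h2 : T.sumBoundary (fun i x => ⟪T.flux a w i x, T.jumpB v i x⟫
        - θ * ⟪T.flux a v i x, T.jumpB w i x⟫) =
      T.sumBoundary (fun i x => ⟪T.flux a w i x, T.jumpB v i x⟫) -
        θ * T.sumBoundary (fun i x => ⟪T.flux a v i x, T.jumpB w i x⟫) := by
    simp only [sub_eq_add_neg, ← neg_mul]
    rw [T.sumBoundary_add (fun i => ha.integrable_fluxB w v i)
      (fun i => (ha.integrable_fluxB v w i).const_mul _), T.sumBoundary_const_mul]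
  rw [formD, h1, h2, diffForm, penaltyForm, fluxForm, fluxForm]
  simp only [mul_assoc]
  rw [T.sumInterior_const_mul, T.sumBoundary_const_mul]
  ring

theorem IsDiffusion.isBilin_formD (ha : T.IsDiffusion a) (θ Cp : ℝ) :
    IsBilin (T.formD (r := r) a θ Cp) := by
  have : T.formD (r := r) a θ Cp = fun w v => T.diffForm a w v + Cp * T.penaltyForm a w v -
      (T.fluxForm a w v - θ * T.fluxForm a v w) := by
    ext w v; exact ha.formD_eq θ Cp w v
  rw [this]
  exact (ha.isBilin_diffForm.add ((isBilin_penaltyForm a).const_mul Cp)).sub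
    (ha.isBilin_fluxForm.sub (ha.isBilin_fluxForm.flip.const_mul θ))

theorem IsDiffusion.diffForm_comm (ha : T.IsDiffusion a) (w v : DGSpace (n + 1) N r) :
    T.diffForm a w v = T.diffForm a v w := by
  refine T.sumElem_congr fun i => ?_
  filter_upwards [ha.ae_elem i] with x hx
  rw [inner_op_comm hx.1, real_inner_comm]

theorem IsDiffusion.ae_diff_nonneg (ha : T.IsDiffusion a) (w : DGSpace (n + 1) N r) (i : Fin N) :
    ∀ᵐ x ∂volume.restrict (T.elem i), 0 ≤ ⟪op (a x) (grad w i x), grad w i x⟫ := by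
  filter_upwards [ha.ae_elem i] with x hx
  rw [real_inner_comm]
  exact hx.2 _

theorem IsDiffusion.diffForm_nonneg (ha : T.IsDiffusion a) (w : DGSpace (n + 1) N r) :
    0 ≤ T.diffForm a w w := by
  unfold diffForm sumElem
  exact Finset.sum_nonneg fun i _ => integral_nonneg_of_ae (ha.ae_diff_nonneg w i)

theorem IsDiffusion.ae_op_grad_eq_zero (ha : T.IsDiffusion a) {w : DGSpace (n + 1) N r}
    (h : T.diffForm a w w = 0) (i : Fin N) :
    ∀ᵐ x ∂volume.restrict (T.elem i), op (a x) (grad w i x) = 0 := by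
  unfold diffForm sumElem at h
  have h1 := (Finset.sum_eq_zero_iff_of_nonneg fun i _ =>
    integral_nonneg_of_ae (ha.ae_diff_nonneg w i)).1 h i (Finset.mem_univ i)
  rw [integral_eq_zero_iff_of_nonneg_ae (ha.ae_diff_nonneg w i) (ha.integrable_diff w w i)] at h1
  filter_upwards [h1, ha.ae_elem i] with x hx hx'
  exact op_apply_eq_zero hx'.1 hx'.2 hx

theorem fluxForm_eq_zero {w v : DGSpace (n + 1) N r}
    (h1 : ∀ i j, i < j → ∀ᵐ x ∂(surf (n + 1)).restrict (T.face i j),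
      T.avgFlux a w i j x = 0 ∨ T.jump v i j x = 0)
    (h2 : ∀ i, ∀ᵐ x ∂(surf (n + 1)).restrict (T.bdryFace i),
      T.flux a w i x = 0 ∨ T.jumpB v i x = 0) : T.fluxForm a w v = 0 := by
  rw [fluxForm, T.sumInterior_eq_zero, T.sumBoundary_eq_zero, add_zero]
  · intro i
    filter_upwards [h2 i] with x hx
    rcases hx with hx | hx <;> simp [hx]
  · intro i j hij
    filter_upwards [h1 i j hij] with x hx
    rcases hx with hx | hx <;> simp [hx]

theorem ae_avgFlux_eq_zero {w : DGSpace (n + 1) N r} {i j : Fin N} (hij : i ≠ j)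
    (hi : ∀ᵐ x ∂(surf (n + 1)).restrict (frontier (T.elem i)), T.flux a w i x = 0)
    (hj : ∀ᵐ x ∂(surf (n + 1)).restrict (frontier (T.elem j)), T.flux a w j x = 0) :
    ∀ᵐ x ∂(surf (n + 1)).restrict (T.face i j), T.avgFlux a w i j x = 0 := by
  have hj' := ae_restrict_of_ae_restrict_of_subset (T.face_subset_frontier hij.symm) hj
  rw [T.face_comm] at hj'
  filter_upwards [ae_restrict_of_ae_restrict_of_subset (T.face_subset_frontier hij) hi, hj']
    with x h1 h2
  rw [avgFlux, h1, h2, add_zero, smul_zero]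

/-- One of the two kernel conditions needed for the product bound on the flux form; the other is
`IsDiffusion.fluxForm_eq_zero_of_penaltyForm`. -/
theorem IsDiffusion.fluxForm_eq_zero_of_diffForm (ha : T.IsDiffusion a)
    {w : DGSpace (n + 1) N r} (h : T.diffForm a w w = 0) (v : DGSpace (n + 1) N r) :
    T.fluxForm a w v = 0 := by
  have hf := fun i => ha.flux_eq_zero (ha.ae_op_grad_eq_zero h i)
  refine fluxForm_eq_zero (fun i j hij => ?_) fun i => ?_
  · exact (ae_avgFlux_eq_zero hij.ne (hf i) (hf j)).mono fun x hx => Or.inl hx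
  · exact (ae_restrict_of_ae_restrict_of_subset (T.bdryFace_subset_frontier i) (hf i)).mono
      fun x hx => Or.inl hx

/-! ### Penalty weights, degenerate faces and diffusion coercivity -/

theorem diam_pos (i : Fin N) : 0 < T.diam i := by
  have hne : (T.simplex i).points 0 ≠ (T.simplex i).points 1 := fun h =>
    absurd ((T.simplex i).independent.injective h) (by simp)
  have hmem : ∀ k, (T.simplex i).points k ∈ T.closedElem i := fun k =>
    subset_convexHull ℝ _ ⟨k, rfl⟩
  exact (dist_pos.2 hne).trans_le
    (Metric.dist_le_diam_of_mem (T.isBounded_closedElem i) (hmem 0) (hmem 1))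

theorem abar_nonneg (i : Fin N) : 0 ≤ T.abar a i := ENNReal.toReal_nonneg

theorem scale_nonneg (r : ℕ) (i j : Fin N) : 0 ≤ T.scale r a i j :=
  div_nonneg (mul_nonneg (by norm_num) (add_nonneg
    (mul_nonneg (abar_nonneg i) (sq_nonneg _)) (mul_nonneg (abar_nonneg j) (sq_nonneg _))))
    (le_min (diam_pos i).le (diam_pos j).le)

theorem scaleB_nonneg (r : ℕ) (i : Fin N) : 0 ≤ T.scaleB r a i :=
  div_nonneg (mul_nonneg (abar_nonneg i) (sq_nonneg _)) (diam_pos i).le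

theorem IsDiffusion.ae_op_eq_zero_of_abar (ha : T.IsDiffusion a) {i : Fin N}
    (h : T.abar a i = 0) : ∀ᵐ x ∂volume.restrict (T.elem i), op (a x) = 0 := by
  obtain ⟨C, hC⟩ := ha.bounded
  obtain ⟨K, hK⟩ := exists_norm_op_le (d := n + 1) C
  -- Finiteness must be checked, because `toReal` also sends an infinite norm to `0`.
  have hfin : eLpNorm (fun x => ‖op (matSqrt (a x))‖) ∞ (volume.restrict (T.elem i)) ≠ ∞ := by
    rw [eLpNorm_exponent_top]
    refine (eLpNormEssSup_lt_top_of_ae_bound (C := √K) ?_).ne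
    filter_upwards [ha.ae_elem i, ae_restrict_mem (T.isOpen_elem i).measurableSet] with x hx hxi
    rw [norm_norm]
    exact (norm_op_matSqrt_le hx.1 hx.2).trans
      (Real.sqrt_le_sqrt (hK _ (hC x (T.elem_subset_domain i hxi))))
  have h0 := (ENNReal.toReal_eq_zero_iff _).1 h
  have h1 := h0.resolve_right hfin
  rw [eLpNorm_exponent_top, eLpNormEssSup_eq_zero_iff] at h1
  filter_upwards [h1, ha.ae_elem i] with x hx hx'
  have h2 : op (matSqrt (a x)) = 0 := norm_eq_zero.1 hx
  ext1 ζ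
  rw [op_eq_op_matSqrt hx'.1 hx'.2, h2]
  rfl

theorem grad_eq_zero_of_degree_zero (w : DGSpace (n + 1) N 0) (i : Fin N) (x : Pt (n + 1)) :
    grad w i x = 0 := by
  have h1 := (MvPolynomial.mem_restrictTotalDegree _ _ _).1 (w i).2
  have h2 := MvPolynomial.totalDegree_eq_zero_iff_eq_C.1 (Nat.le_zero.1 h1)
  ext k
  simp only [grad]
  rw [h2]
  simp

/-- The weight degenerates only if the diffusion vanishes on the element or if `r = 0` and gradients
are zero; the flux is zero in both cases. -/
theorem IsDiffusion.ae_flux_eq_zero_of_abar (ha : T.IsDiffusion a) {i : Fin N}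
    (h : T.abar a i * (r : ℝ) ^ 2 = 0) (w : DGSpace (n + 1) N r) :
    ∀ᵐ x ∂(surf (n + 1)).restrict (frontier (T.elem i)), T.flux a w i x = 0 := by
  refine ha.flux_eq_zero ?_
  rcases mul_eq_zero.1 h with h | h
  · filter_upwards [ha.ae_op_eq_zero_of_abar h] with x hx
    rw [hx]; rfl
  · have : r = 0 := by simpa using h
    subst this
    refine Eventually.of_forall fun x => ?_
    rw [grad_eq_zero_of_degree_zero, map_zero]

theorem sumInterior_add_sumBoundary_eq_zero {F : Fin N → Fin N → Pt (n + 1) → ℝ}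
    {G : Fin N → Pt (n + 1) → ℝ}
    (hF : ∀ i j, i < j → 0 ≤ ∫ x in T.face i j, F i j x ∂(surf (n + 1)))
    (hG : ∀ i, 0 ≤ ∫ x in T.bdryFace i, G i x ∂(surf (n + 1)))
    (h : T.sumInterior F + T.sumBoundary G = 0) :
    (∀ i j, i < j → ∫ x in T.face i j, F i j x ∂(surf (n + 1)) = 0) ∧
      ∀ i, ∫ x in T.bdryFace i, G i x ∂(surf (n + 1)) = 0 := by
  have h1 := T.sumInterior_nonneg hF
  have h2 := T.sumBoundary_nonneg hG
  have h3 : T.sumInterior F = 0 := by linarith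
  have h4 : T.sumBoundary G = 0 := by linarith
  have hF' : ∀ i j, 0 ≤ if i < j then ∫ x in T.face i j, F i j x ∂(surf (n + 1)) else 0 := by
    intro i j
    split_ifs with hij
    · exact hF i j hij
    · exact le_rfl
  refine ⟨fun i j hij => ?_, fun i =>
    (Finset.sum_eq_zero_iff_of_nonneg fun i _ => hG i).1 h4 i (Finset.mem_univ i)⟩
  have h5 := (Finset.sum_eq_zero_iff_of_nonneg fun i _ =>
    Finset.sum_nonneg fun j _ => hF' i j).1 h3 i (Finset.mem_univ i)
  have h6 := (Finset.sum_eq_zero_iff_of_nonneg fun j _ => hF' i j).1 h5 j (Finset.mem_univ j)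
  rwa [if_pos hij] at h6

theorem integral_mul_inner_self_nonneg {c : ℝ} {f : Pt (n + 1) → Pt (n + 1)}
    {μ : Measure (Pt (n + 1))} (hc : 0 ≤ c) : 0 ≤ ∫ x, c * ⟪f x, f x⟫ ∂μ :=
  integral_nonneg fun _ => mul_nonneg hc real_inner_self_nonneg

theorem ae_eq_zero_of_integral_mul_inner_self {c : ℝ} {f : Pt (n + 1) → Pt (n + 1)}
    {μ : Measure (Pt (n + 1))} (hc : c ≠ 0) (hf : Integrable (fun x => ⟪f x, f x⟫) μ)
    (h : ∫ x, c * ⟪f x, f x⟫ ∂μ = 0) : ∀ᵐ x ∂μ, f x = 0 := by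
  rw [integral_const_mul] at h
  have h1 := (mul_eq_zero.1 h).resolve_left hc
  rw [integral_eq_zero_iff_of_nonneg (fun x => real_inner_self_nonneg) hf] at h1
  filter_upwards [h1] with x hx using inner_self_eq_zero.1 hx

theorem penaltyForm_comm (w v : DGSpace (n + 1) N r) :
    T.penaltyForm a w v = T.penaltyForm a v w := by
  simp only [penaltyForm, real_inner_comm]

theorem penaltyForm_nonneg (w : DGSpace (n + 1) N r) : 0 ≤ T.penaltyForm a w w :=
  add_nonneg
    (T.sumInterior_nonneg fun i j _ => integral_mul_inner_self_nonneg (scale_nonneg r i j))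
    (T.sumBoundary_nonneg fun i => integral_mul_inner_self_nonneg (scaleB_nonneg r i))

/-- On a face with positive weight the jump of `v` vanishes. On a face with zero weight the jump is
uncontrolled, but the fluxes from all adjacent elements vanish, so nothing is lost. -/
theorem IsDiffusion.fluxForm_eq_zero_of_penaltyForm (ha : T.IsDiffusion a)
    (w : DGSpace (n + 1) N r) {v : DGSpace (n + 1) N r} (h : T.penaltyForm a v v = 0) :
    T.fluxForm a w v = 0 := by
  obtain ⟨h1, h2⟩ := sumInterior_add_sumBoundary_eq_zero
    (fun i j _ => integral_mul_inner_self_nonneg (scale_nonneg r i j))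
    (fun i => integral_mul_inner_self_nonneg (scaleB_nonneg r i)) h
  refine fluxForm_eq_zero (fun i j hij => ?_) fun i => ?_
  · by_cases hs : T.scale r a i j = 0
    · have h3 := (div_eq_zero_iff.1 hs).resolve_right (lt_min (diam_pos i) (diam_pos j)).ne'
      have hi := mul_nonneg (abar_nonneg (T := T) (a := a) i) (sq_nonneg (r : ℝ))
      have hj := mul_nonneg (abar_nonneg (T := T) (a := a) j) (sq_nonneg (r : ℝ))
      exact (ae_avgFlux_eq_zero hij.ne (ha.ae_flux_eq_zero_of_abar (by linarith) w)
        (ha.ae_flux_eq_zero_of_abar (by linarith) w)).mono fun x hx => Or.inl hx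
    · exact (ae_eq_zero_of_integral_mul_inner_self hs (integrable_jump v v hij.ne)
        (h1 i j hij)).mono fun x hx => Or.inr hx
  · by_cases hs : T.scaleB r a i = 0
    · have h3 := (div_eq_zero_iff.1 hs).resolve_right (diam_pos i).ne'
      exact (ae_restrict_of_ae_restrict_of_subset (T.bdryFace_subset_frontier i)
        (ha.ae_flux_eq_zero_of_abar h3 w)).mono fun x hx => Or.inl hx
    · exact (ae_eq_zero_of_integral_mul_inner_self hs (integrable_jumpB v v i)
        (h2 i)).mono fun x hx => Or.inr hx

instance finiteDimensional_restrictTotalDegree (d r : ℕ) :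
    FiniteDimensional ℝ (MvPolynomial.restrictTotalDegree (Fin d) ℝ r) := by
  infer_instance

/-- Coercivity of the diffusion part for a large penalty parameter. -/
theorem IsDiffusion.exists_coercive (ha : T.IsDiffusion a) (r : ℕ) {θ : ℝ}
    (hθ : θ = -1 ∨ θ = 0 ∨ θ = 1) :
    ∃ C₀ : ℝ, 0 ≤ C₀ ∧ (θ = 1 → C₀ = 0) ∧ ∀ Cp, C₀ ≤ Cp → ∀ w : DGSpace (n + 1) N r,
      T.diffForm a w w + Cp * T.penaltyForm a w w ≤ 2 * T.formD a θ Cp w w := by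
  by_cases h1 : θ = 1
  -- For `θ = 1` the two flux terms cancel on the diagonal, and no lower bound on the penalty is
  -- needed.
  · refine ⟨0, le_rfl, fun _ => rfl, fun Cp hCp w => ?_⟩
    rw [ha.formD_eq, h1]
    have := ha.diffForm_nonneg w
    have := mul_nonneg hCp (penaltyForm_nonneg (T := T) (a := a) w)
    linarith
  · obtain ⟨C, hC0, hC⟩ := exists_sq_le_mul_of_psd
      (ha.isBilin_diffForm (r := r)).toLin (isBilin_penaltyForm (T := T) (r := r) a).toLin
      (ha.isBilin_fluxForm (r := r)).toLin ha.diffForm_comm ha.diffForm_nonneg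
      penaltyForm_comm penaltyForm_nonneg
      (fun w u h => ha.fluxForm_eq_zero_of_diffForm h u)
      (fun w u h => ha.fluxForm_eq_zero_of_penaltyForm w h)
    -- With $C_p\ge4C$ one has $16F^2\le16C\,DP\le4C_p\,DP\le(D+C_pP)^2$. Hence $4|F|\le D+C_pP$,
    -- which absorbs the diagonal flux term $(1-\theta)F$, at most $2|F|$ in size.
    refine ⟨4 * C, by positivity, fun h => absurd h h1, fun Cp hCp w => ?_⟩
    have hD := ha.diffForm_nonneg w
    have hP := penaltyForm_nonneg (T := T) (a := a) w
    have hF : T.fluxForm a w w ^ 2 ≤ C * (T.diffForm a w w * T.penaltyForm a w w) := hC w w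
    rw [ha.formD_eq]
    generalize T.diffForm a w w = D at *
    generalize T.penaltyForm a w w = P at *
    generalize T.fluxForm a w w = F at *
    have hCp0 : 0 ≤ Cp := le_trans (by positivity) hCp
    have hsq : (4 * F) ^ 2 ≤ (D + Cp * P) ^ 2 := by
      nlinarith [sq_nonneg (D - Cp * P), mul_le_mul_of_nonneg_right hCp (mul_nonneg hD hP)]
    have habs := abs_le_of_sq_le_sq' hsq (by positivity)
    have h0 : 0 ≤ D + Cp * P := by positivity
    rcases hθ with h | h | h
    · rw [h]; linarith [habs.2]
    · rw [h]; linarith [habs.1, habs.2]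
    · exact absurd h h1

end Mesh

/-! ### Derivatives of polynomials and Lipschitz products -/

section Calculus

theorem hasFDerivAt_mvPolynomial_eval {d : ℕ} (p : MvPolynomial (Fin d) ℝ) (x : Pt d) :
    HasFDerivAt (fun y : Pt d => MvPolynomial.eval (fun l => y l) p)
      (innerSL ℝ (WithLp.toLp 2 fun k =>
        MvPolynomial.eval (fun l => x l) (MvPolynomial.pderiv k p) : Pt d)) x := by
  induction p using MvPolynomial.induction_on with
  | C c =>
    simp only [MvPolynomial.eval_C, MvPolynomial.pderiv_C, map_zero]
    refine (hasFDerivAt_const c x).congr_fderiv ?_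
    ext y
    simp [PiLp.inner_apply]
  | add p q hp hq =>
    simp only [map_add]
    refine (hp.add hq).congr_fderiv ?_
    ext y
    simp [PiLp.inner_apply, mul_add, Finset.sum_add_distrib]
  | mul_X p k hp =>
    simp only [map_mul, MvPolynomial.eval_X]
    have hk : HasFDerivAt (fun y : Pt d => y k) (EuclideanSpace.proj k : Pt d →L[ℝ] ℝ) x :=
      (EuclideanSpace.proj k : Pt d →L[ℝ] ℝ).hasFDerivAt
    refine (hp.mul hk).congr_fderiv ?_
    ext y
    simp only [PiLp.inner_apply, innerSL_apply_apply, Derivation.leibniz, MvPolynomial.pderiv_X,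
      smul_eq_mul, map_add, map_mul, MvPolynomial.eval_X, add_apply,
      smul_apply, PiLp.proj_apply, RCLike.inner_apply,
      conj_trivial, mul_add, Finset.sum_add_distrib]
    congr 1
    · rw [Finset.sum_eq_single k]
      · simp; ring
      · intro l _ hl
        simp [hl]
      · simp
    · rw [Finset.mul_sum]
      exact Finset.sum_congr rfl fun l _ => by ring

theorem hasFDerivAt_val {d N r : ℕ} (w : DGSpace d N r) (i : Fin N) (x : Pt d) :
    HasFDerivAt (val w i) (innerSL ℝ (grad w i x)) x :=
  hasFDerivAt_mvPolynomial_eval _ x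

theorem contDiff_val {d N r : ℕ} (w : DGSpace d N r) (i : Fin N) : ContDiff ℝ 1 (val w i) := by
  rw [contDiff_one_iff_hasFDerivAt]
  exact ⟨fun x => innerSL ℝ (grad w i x), (innerSL ℝ).continuous.comp (continuous_grad w i),
    hasFDerivAt_val w i⟩

theorem lipschitzOnWith_mul_of_bound {α : Type*} [PseudoMetricSpace α] {s : Set α} {f g : α → ℝ}
    {C D : NNReal} (hf : LipschitzOnWith C f s) (hg : LipschitzOnWith D g s) {A B : NNReal}
    (hA : ∀ x ∈ s, |f x| ≤ A) (hB : ∀ x ∈ s, |g x| ≤ B) :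
    LipschitzOnWith (C * B + A * D) (fun x => f x * g x) s := by
  refine LipschitzOnWith.of_dist_le_mul fun x hx y hy => ?_
  have h1 := hf.dist_le_mul x hx y hy
  have h2 := hg.dist_le_mul x hx y hy
  rw [Real.dist_eq] at h1 h2 ⊢
  calc |f x * g x - f y * g y| = |(f x - f y) * g x + f y * (g x - g y)| := by congr 1; ring
    _ ≤ |f x - f y| * |g x| + |f y| * |g x - g y| := by
      refine (abs_add_le _ _).trans ?_
      rw [abs_mul, abs_mul]
    _ ≤ (C * dist x y) * B + A * (D * dist x y) := by
      gcongr
      · exact hB x hx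
      · exact hA y hy
    _ = _ := by push_cast; ring

end Calculus

namespace Mesh

variable {n N r : ℕ} {T : Mesh (n + 1) N} {b : Pt (n + 1) → Pt (n + 1)} {c : Pt (n + 1) → ℝ}

/-! ### The advection-reaction part -/

theorem continuousOn_of_lipschitz (hb : ∃ K, LipschitzOnWith K b (closure T.domain)) (i : Fin N) :
    ContinuousOn b (T.closedElem i) :=
  let ⟨_, hK⟩ := hb
  hK.continuousOn.mono (T.closedElem_subset_closure i)

theorem bddMeas_divergence (hb : ∃ K, LipschitzOnWith K b (closure T.domain)) (i : Fin N) :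
    BddMeas (divergence b) (volume.restrict (T.elem i)) := by
  obtain ⟨K, hK⟩ := hb
  refine BddMeas.sum _ fun k _ => BddMeas.coord ?_ k
  refine ⟨(measurable_fderiv_apply_const ℝ b _).aestronglyMeasurable, K, ?_⟩
  filter_upwards [ae_restrict_mem (T.isOpen_elem i).measurableSet] with x hx
  have h1 : ‖fderiv ℝ b x‖ ≤ K := norm_fderiv_le_of_lipschitzOn ℝ
    (mem_of_superset ((T.isOpen_elem i).mem_nhds hx)
      ((T.elem_subset_domain i).trans subset_closure)) hK
  refine ((fderiv ℝ b x).le_opNorm _).trans ?_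
  simpa using h1

/-- Integration by parts for `b · ∇(w²)` on an element. -/
theorem integral_elem_advection (hb : ∃ K, LipschitzOnWith K b (closure T.domain))
    (w : DGSpace (n + 1) N r) (i : Fin N) :
    ∫ x in T.elem i, (divergence b x * val w i x ^ 2 + 2 * (⟪b x, grad w i x⟫ * val w i x)) =
      ∫ x in frontier (T.elem i), ⟪b x, T.normal i x⟫ * val w i x ^ 2 ∂(surf (n + 1)) := by
  obtain ⟨K, hK⟩ := hb
  have hKi := hK.mono (T.closedElem_subset_closure i)
  have hcomp := T.isCompact_closedElem i
  have hbc := hKi.continuousOn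
  -- Lipschitz extensions of the components of `w² b`
  have hext : ∀ k, ∃ ψ : Pt (n + 1) → ℝ, (∃ C, LipschitzWith C ψ) ∧
      Set.EqOn (fun x => b x k * val w i x ^ 2) ψ (T.closedElem i) := by
    intro k
    have h1 : LipschitzOnWith K (fun x => b x k) (T.closedElem i) := by
      refine LipschitzOnWith.of_dist_le_mul fun x hx y hy => ?_
      refine le_trans ?_ (hKi.dist_le_mul x hx y hy)
      rw [Real.dist_eq, dist_eq_norm]
      exact PiLp.norm_apply_le (b x - b y) k
    obtain ⟨D, hD⟩ := ((contDiff_val w i).pow 2).contDiffOn.exists_lipschitzOnWith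
      one_ne_zero (T.convex_closedElem i) hcomp
    obtain ⟨A, hA⟩ := hcomp.exists_bound_of_continuousOn h1.continuousOn
    obtain ⟨B, hB⟩ := hcomp.exists_bound_of_continuousOn hD.continuousOn
    have h3 := lipschitzOnWith_mul_of_bound h1 hD (A := ⟨|A|, abs_nonneg A⟩)
      (B := ⟨|B|, abs_nonneg B⟩) (fun x hx => (hA x hx).trans (le_abs_self A))
      fun x hx => (hB x hx).trans (le_abs_self B)
    obtain ⟨ψ, hψ, hE⟩ := h3.extend_real
    exact ⟨ψ, ⟨_, hψ⟩, hE⟩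
  choose ψ hψ hE using hext
  choose C hC using hψ
  have hL : ∀ k, Integrable (fun x => lineDeriv ℝ (ψ k) x (EuclideanSpace.single k 1))
      (volume.restrict (T.elem i)) := fun k =>
    (BddMeas.of_memLp_top ((hC k).memLp_lineDeriv _)).integrable
  have hval : ContinuousOn (fun x => val w i x ^ 2) (T.closedElem i) :=
    ((continuous_val w i).pow 2).continuousOn
  have hR : ∀ k, Integrable (fun x => ⟪T.normal i x, EuclideanSpace.single k 1⟫ * ψ k x)
      ((surf (n + 1)).restrict (frontier (T.elem i))) := fun k =>
    (((T.bddMeas_normal i).inner (BddMeas.const _)).mul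
      (T.bddMeas_of_continuousOn (hC k).continuous.continuousOn)).integrable
  -- Rademacher's theorem; it makes the product rule available almost everywhere.
  have hdiff : ∀ᵐ x ∂volume.restrict (T.elem i), DifferentiableAt ℝ b x := by
    filter_upwards [(hKi.mono (T.elem_subset_closedElem i)).ae_differentiableWithinAt
      (μ := volume) (T.isOpen_elem i).measurableSet,
      ae_restrict_mem (T.isOpen_elem i).measurableSet] with x hx hxi
    exact hx.differentiableAt ((T.isOpen_elem i).mem_nhds hxi)
  calc _ = ∫ x in T.elem i, ∑ k, lineDeriv ℝ (ψ k) x (EuclideanSpace.single k 1) := by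
        refine integral_congr_ae ?_
        filter_upwards [hdiff, ae_restrict_mem (T.isOpen_elem i).measurableSet] with x hx hxi
        have h1 : ∀ k, lineDeriv ℝ (ψ k) x (EuclideanSpace.single k 1) =
            (fderiv ℝ b x (EuclideanSpace.single k 1)) k * val w i x ^ 2 +
              2 * (b x k * grad w i x k * val w i x) := by
          intro k
          have h2 : ψ k =ᶠ[𝓝 x] fun y => b y k * val w i y ^ 2 := by
            filter_upwards [(T.isOpen_elem i).mem_nhds hxi] with y hy
            exact (hE k (T.elem_subset_closedElem i hy)).symm
          rw [h2.lineDeriv_eq]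
          have h3 : HasFDerivAt (fun y => b y k)
              ((EuclideanSpace.proj k : Pt (n + 1) →L[ℝ] ℝ).comp (fderiv ℝ b x)) x :=
            (EuclideanSpace.proj k : Pt (n + 1) →L[ℝ] ℝ).hasFDerivAt.comp x hx.hasFDerivAt
          have h4 := h3.mul ((hasFDerivAt_val w i x).pow 2)
          have h5 := (h4.hasLineDerivAt (EuclideanSpace.single k 1)).lineDeriv
          refine h5.trans ?_
          simp [EuclideanSpace.inner_single_right]
          ring
        rw [Finset.sum_congr rfl fun k _ => h1 k, Finset.sum_add_distrib, ← Finset.sum_mul,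
          ← Finset.mul_sum, ← Finset.sum_mul, divergence, PiLp.inner_apply]
        simp [mul_comm]
    _ = ∑ k, ∫ x in T.elem i, lineDeriv ℝ (ψ k) x (EuclideanSpace.single k 1) :=
        integral_finsetSum _ fun k _ => hL k
    _ = ∑ k, ∫ x in frontier (T.elem i), ⟪T.normal i x, EuclideanSpace.single k 1⟫ * ψ k x
          ∂(surf (n + 1)) :=
        Finset.sum_congr rfl fun k _ => T.integral_elem_lineDeriv i (hC k) _
    _ = ∫ x in frontier (T.elem i), ∑ k, ⟪T.normal i x, EuclideanSpace.single k 1⟫ * ψ k x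
          ∂(surf (n + 1)) := (integral_finsetSum _ fun k _ => hR k).symm
    _ = _ := by
        refine integral_congr_ae ?_
        filter_upwards [ae_restrict_mem (T.measurableSet_frontier_elem i)] with x hx
        have h1 : ∀ k, ψ k x = b x k * val w i x ^ 2 := fun k =>
          (hE k (T.frontier_subset_closedElem i hx)).symm
        simp only [h1, PiLp.inner_apply, Finset.sum_mul]
        refine Finset.sum_congr rfl fun k _ => ?_
        simp
        ring

variable (T) in
/-- Symmetrisation of a double sum over adjacent elements. -/
theorem sum_ne_eq_sum_lt {M : Type*} [AddCommMonoid M] (A : Fin N → Fin N → M) :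
    ∑ i, ∑ j, (if j ≠ i then A i j else 0) = ∑ i, ∑ j, if i < j then A i j + A j i else 0 := by
  have h : ∀ i j : Fin N, (if j ≠ i then A i j else 0) =
      (if i < j then A i j else 0) + if j < i then A i j else 0 := by
    intro i j
    rcases lt_trichotomy i j with h | h | h
    · simp [h, h.ne', h.not_gt]
    · simp [h]
    · simp [h, h.ne, h.not_gt]
  simp_rw [h, Finset.sum_add_distrib]
  rw [Finset.sum_comm (f := fun i j => if j < i then A i j else 0), ← Finset.sum_add_distrib]
  refine Finset.sum_congr rfl fun i _ => ?_
  rw [← Finset.sum_add_distrib]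
  refine Finset.sum_congr rfl fun j _ => ?_
  split_ifs <;> simp

theorem bddMeas_advection (hb : ∃ K, LipschitzOnWith K b (closure T.domain)) (i : Fin N) :
    BddMeas (fun x => ⟪b x, T.normal i x⟫)
      ((surf (n + 1)).restrict (frontier (T.elem i))) :=
  (T.bddMeas_of_continuousOn (continuousOn_of_lipschitz hb i)).inner (T.bddMeas_normal i)

theorem bddMeas_advection_sq (hb : ∃ K, LipschitzOnWith K b (closure T.domain))
    (w : DGSpace (n + 1) N r) (i : Fin N) :
    BddMeas (fun x => ⟪b x, T.normal i x⟫ * val w i x ^ 2)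
      ((surf (n + 1)).restrict (frontier (T.elem i))) :=
  (bddMeas_advection hb i).mul
    (T.bddMeas_of_continuousOn ((continuous_val w i).pow 2).continuousOn)

theorem sum_integral_frontier (hb : ∃ K, LipschitzOnWith K b (closure T.domain))
    (w : DGSpace (n + 1) N r) :
    ∑ i, ∫ x in frontier (T.elem i), ⟪b x, T.normal i x⟫ * val w i x ^ 2 ∂(surf (n + 1)) =
      T.sumInterior (fun i j x => ⟪b x, T.normal i x⟫ * val w i x ^ 2 +
        ⟪b x, T.normal j x⟫ * val w j x ^ 2) +
      T.sumBoundary fun i x => ⟪b x, T.normal i x⟫ * val w i x ^ 2 := by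
  rw [Finset.sum_congr rfl fun i _ =>
    T.integral_frontier_elem i (bddMeas_advection_sq hb w i).integrable, Finset.sum_add_distrib,
    sum_ne_eq_sum_lt]
  congr 1
  refine Finset.sum_congr rfl fun i _ => Finset.sum_congr rfl fun j _ => ?_
  split_ifs with hij
  · rw [T.face_comm j i, integral_add]
    · exact T.integrableOn_face hij.ne
        (T.bddMeas_face_left hij.ne (bddMeas_advection_sq hb w i))
    · exact T.integrableOn_face hij.ne
        (T.bddMeas_face_right hij.ne (bddMeas_advection_sq hb w j))
  · rfl

theorem bddMeas_downstream (hb : ∃ K, LipschitzOnWith K b (closure T.domain))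
    (w : DGSpace (n + 1) N r) {i j : Fin N} (hij : i ≠ j) :
    BddMeas (T.downstream b w i j) ((surf (n + 1)).restrict (T.face i j)) := by
  unfold downstream
  refine BddMeas.ite ?_ (T.bddMeas_face_left hij (T.bddMeas_val w i j))
    (T.bddMeas_face_left hij (T.bddMeas_val w i i))
  exact nullMeasurableSet_lt aemeasurable_const
    (T.bddMeas_face_left hij (bddMeas_advection hb i)).aesm.aemeasurable

theorem integrable_advection_face (hb : ∃ K, LipschitzOnWith K b (closure T.domain))
    (w v : DGSpace (n + 1) N r) {i j : Fin N} (hij : i ≠ j) :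
    IntegrableOn (fun x => ⟪b x, T.jump w i j x⟫ * T.downstream b v i j x) (T.face i j)
      (surf (n + 1)) :=
  T.integrableOn_face hij (((T.bddMeas_face_left hij
    (T.bddMeas_of_continuousOn (continuousOn_of_lipschitz hb i))).inner
      (T.bddMeas_jump w hij)).mul (bddMeas_downstream hb v hij))

theorem integrable_advection_bdry (hb : ∃ K, LipschitzOnWith K b (closure T.domain))
    (w v : DGSpace (n + 1) N r) (i : Fin N) :
    IntegrableOn (fun x => if ⟪b x, T.normal i x⟫ ≤ 0 then
      ⟪b x, T.normal i x⟫ * val w i x * val v i x else 0) (T.bdryFace i) (surf (n + 1)) := by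
  refine BddMeas.integrable (BddMeas.ite ?_ (T.bddMeas_bdryFace
    (((bddMeas_advection hb i).mul (T.bddMeas_val w i i)).mul (T.bddMeas_val v i i)))
    (BddMeas.const 0))
  exact nullMeasurableSet_le (T.bddMeas_bdryFace (bddMeas_advection hb i)).aesm.aemeasurable
    aemeasurable_const

theorem bddMeas_elem_of_memLp (hc : MemLp c ∞ (volume.restrict T.domain)) (i : Fin N) :
    BddMeas c (volume.restrict (T.elem i)) :=
  BddMeas.of_memLp_top (hc.mono_measure (Measure.restrict_mono_set _ (T.elem_subset_domain i)))

theorem bddMeas_elem_advection (hb : ∃ K, LipschitzOnWith K b (closure T.domain))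
    (w v : DGSpace (n + 1) N r) (i : Fin N) :
    BddMeas (fun x => ⟪b x, grad w i x⟫ * val v i x) (volume.restrict (T.elem i)) :=
  ((T.bddMeas_elem_of_continuousOn (continuousOn_of_lipschitz hb i)).inner
    (T.bddMeas_elem_grad w i i)).mul (T.bddMeas_elem_val v i i)

theorem bddMeas_elem_reaction (hc : MemLp c ∞ (volume.restrict T.domain))
    (w v : DGSpace (n + 1) N r) (i : Fin N) :
    BddMeas (fun x => c x * val w i x * val v i x) (volume.restrict (T.elem i)) :=
  ((bddMeas_elem_of_memLp hc i).mul (T.bddMeas_elem_val w i i)).mul (T.bddMeas_elem_val v i i)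

theorem isBilin_formAR (hb : ∃ K, LipschitzOnWith K b (closure T.domain))
    (hc : MemLp c ∞ (volume.restrict T.domain)) : IsBilin (T.formAR (r := r) b c) := by
  unfold formAR
  refine IsBilin.sub (IsBilin.sub
    (T.isBilin_sumElem (F := fun w v i x =>
      ⟪b x, grad w i x⟫ * val v i x + c x * val w i x * val v i x) ?_ ?_)
    (T.isBilin_sumInterior (F := fun w v i j x =>
      ⟪b x, T.jump w i j x⟫ * T.downstream b v i j x) ?_ ?_))
    (T.isBilin_sumBoundary (F := fun w v i x => if ⟪b x, T.normal i x⟫ ≤ 0 then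
      ⟪b x, T.normal i x⟫ * val w i x * val v i x else 0) ?_ ?_)
  · intro i x
    constructor <;> intros <;> simp only [grad_add, grad_smul, val_add, val_smul,
      inner_add_right, real_inner_smul_right] <;> ring
  · exact fun i w v =>
      ((bddMeas_elem_advection hb w v i).add (bddMeas_elem_reaction hc w v i)).integrable
  · intro i j x
    constructor <;> intros <;> simp only [jump_add, jump_smul, downstream_add, downstream_smul,
      inner_add_right, real_inner_smul_right] <;> ring
  · exact fun i j hij w v => integrable_advection_face hb w v hij
  · intro i x
    split_ifs
    · constructor <;> intros <;> simp only [val_add, val_smul] <;> ring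
    · exact IsBilin.zero
  · exact fun i w v => integrable_advection_bdry hb w v i

theorem ae_jump_eq (w : DGSpace (n + 1) N r) {i j : Fin N} (hij : i ≠ j) :
    ∀ᵐ x ∂(surf (n + 1)).restrict (T.face i j),
      T.jump w i j x = (val w i x - val w j x) • T.normal i x := by
  filter_upwards [T.ae_normal_eq_neg hij] with x hx
  rw [jump, hx, smul_neg, sub_smul, sub_eq_add_neg]

/-- Since $(b\cdot\nabla w)w=\tfrac12b\cdot\nabla(w^2)$, integration by parts on each element moves
$-\tfrac12\nabla\cdot b$ into the reaction term and leaves half of the boundary flux. -/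
theorem sumElem_advection (hb : ∃ K, LipschitzOnWith K b (closure T.domain))
    (hc : MemLp c ∞ (volume.restrict T.domain))
    (hcb : ∀ᵐ x ∂volume.restrict T.domain, 0 ≤ c x - 1 / 2 * divergence b x)
    (w : DGSpace (n + 1) N r) :
    T.sumElem (fun i x => ⟪b x, grad w i x⟫ * val w i x + c x * val w i x * val w i x) =
      T.sumElem (fun i x => (√(c x - 1 / 2 * divergence b x) * val w i x) ^ 2) +
      1 / 2 * ∑ i, ∫ x in frontier (T.elem i), ⟪b x, T.normal i x⟫ * val w i x ^ 2
        ∂(surf (n + 1)) := by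
  rw [Finset.mul_sum, sumElem, sumElem, ← Finset.sum_add_distrib]
  refine Finset.sum_congr rfl fun i _ => ?_
  have h1 : BddMeas (fun x => divergence b x * val w i x ^ 2 +
      2 * (⟪b x, grad w i x⟫ * val w i x)) (volume.restrict (T.elem i)) :=
    ((bddMeas_divergence hb i).mul
      (T.bddMeas_elem_of_continuousOn ((continuous_val w i).pow 2).continuousOn)).add
      ((BddMeas.const 2).mul (bddMeas_elem_advection hb w w i))
  have h2 : BddMeas (fun x => (c x - 1 / 2 * divergence b x) * val w i x ^ 2)
      (volume.restrict (T.elem i)) :=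
    ((bddMeas_elem_of_memLp hc i).sub ((BddMeas.const (1 / 2)).mul
      (bddMeas_divergence hb i))).mul
      (T.bddMeas_elem_of_continuousOn ((continuous_val w i).pow 2).continuousOn)
  have h3 : ∫ x in T.elem i, (√(c x - 1 / 2 * divergence b x) * val w i x) ^ 2 =
      ∫ x in T.elem i, (c x - 1 / 2 * divergence b x) * val w i x ^ 2 := by
    refine integral_congr_ae ?_
    filter_upwards [ae_restrict_of_ae_restrict_of_subset (T.elem_subset_domain i) hcb] with x hx
    rw [mul_pow, Real.sq_sqrt hx]
  rw [h3, ← integral_elem_advection hb, ← integral_const_mul,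
    ← integral_add h2.integrable (h1.integrable.const_mul _)]
  refine integral_congr_ae (Eventually.of_forall fun x => ?_)
  ring

/-- Coercivity of the advection-reaction part. -/
theorem formAR_self (hb : ∃ K, LipschitzOnWith K b (closure T.domain))
    (hc : MemLp c ∞ (volume.restrict T.domain))
    (hcb : ∀ᵐ x ∂volume.restrict T.domain, 0 ≤ c x - 1 / 2 * divergence b x)
    (w : DGSpace (n + 1) N r) :
    T.formAR b c w w =
      T.sumElem (fun i x => (√(c x - 1 / 2 * divergence b x) * val w i x) ^ 2) +
      (T.sumInterior (fun i j x => 1 / 2 * (|⟪b x, T.normal i x⟫| * ‖T.jump w i j x‖ ^ 2)) +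
        T.sumBoundary (fun i x => 1 / 2 * (|⟪b x, T.normal i x⟫| * ‖T.jumpB w i x‖ ^ 2))) := by
  -- With $\beta=b\cdot n_i$ this is the pointwise identity $\beta(w_i-w_j)w^{\rm
  -- out}+\tfrac12|\beta|(w_i-w_j)^2=\tfrac12\beta(w_i^2-w_j^2)$, valid for either sign of $\beta$
  -- because the trace is taken downstream.
  have hI : T.sumInterior (fun i j x => ⟪b x, T.jump w i j x⟫ * T.downstream b w i j x) +
      T.sumInterior (fun i j x => 1 / 2 * (|⟪b x, T.normal i x⟫| * ‖T.jump w i j x‖ ^ 2)) =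
      1 / 2 * T.sumInterior (fun i j x => ⟪b x, T.normal i x⟫ * val w i x ^ 2 +
        ⟪b x, T.normal j x⟫ * val w j x ^ 2) := by
    rw [← T.sumInterior_const_mul, ← T.sumInterior_add
      (fun i j hij => integrable_advection_face hb w w hij)]
    · refine T.sumInterior_congr fun i j hij => ?_
      have hn := ae_restrict_of_ae_restrict_of_subset (T.face_subset_frontier hij.ne)
        (T.ae_norm_normal i)
      filter_upwards [ae_jump_eq w hij.ne, T.ae_normal_eq_neg hij.ne, hn] with x h1 h2 h3
      rw [h1, h2, downstream, norm_smul, h3, mul_one, inner_smul_right, inner_neg_right,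
        Real.norm_eq_abs, sq_abs]
      split_ifs with h
      · rw [abs_of_pos h]; ring
      · rw [abs_of_nonpos (not_lt.1 h)]; ring
    · intro i j hij
      refine T.integrableOn_face hij ((BddMeas.const _).mul (((T.bddMeas_face_left hij
        (bddMeas_advection hb i)).norm).mul ?_))
      simp only [pow_two]
      exact (T.bddMeas_jump w hij).norm.mul (T.bddMeas_jump w hij).norm
  -- The analogous identity on the boundary, where the inflow term turns $\tfrac12\beta w^2$ into
  -- $\tfrac12|\beta|w^2$.
  have hB : T.sumBoundary (fun i x => if ⟪b x, T.normal i x⟫ ≤ 0 then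
        ⟪b x, T.normal i x⟫ * val w i x * val w i x else 0) +
      T.sumBoundary (fun i x => 1 / 2 * (|⟪b x, T.normal i x⟫| * ‖T.jumpB w i x‖ ^ 2)) =
      1 / 2 * T.sumBoundary (fun i x => ⟪b x, T.normal i x⟫ * val w i x ^ 2) := by
    rw [← T.sumBoundary_const_mul, ← T.sumBoundary_add
      (fun i => integrable_advection_bdry hb w w i)]
    · refine T.sumBoundary_congr fun i => ?_
      filter_upwards [ae_restrict_of_ae_restrict_of_subset (T.bdryFace_subset_frontier i)
        (T.ae_norm_normal i)] with x h3
      rw [jumpB, norm_smul, h3, mul_one, Real.norm_eq_abs, sq_abs]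
      split_ifs with h
      · rw [abs_of_nonpos h]; ring
      · rw [abs_of_pos (not_le.1 h)]; ring
    · intro i
      refine BddMeas.integrable ((BddMeas.const _).mul (((T.bddMeas_bdryFace
        (bddMeas_advection hb i)).norm).mul ?_))
      simp only [pow_two]
      exact (T.bddMeas_jumpB w i).norm.mul (T.bddMeas_jumpB w i).norm
  rw [formAR, sumElem_advection hb hc hcb, sum_integral_frontier hb]
  linarith

end Mesh

/-! ### Traces on faces and continuity -/

/-- Along a line the polynomial becomes a univariate one, `q`, which has infinitely many roots. -/
theorem mvPolynomial_eval_line_eq_zero {d : ℕ} (p : MvPolynomial (Fin d) ℝ) (x w : Pt d)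
    (h : ∀ᶠ t : ℝ in 𝓝 0, MvPolynomial.eval (fun l => (x + t • w) l) p = 0) (t : ℝ) :
    MvPolynomial.eval (fun l => (x + t • w) l) p = 0 := by
  let q : Polynomial ℝ :=
    MvPolynomial.eval₂ Polynomial.C (fun l => Polynomial.C (x l) + Polynomial.X * Polynomial.C (w l)) p
  have hq : ∀ t, q.eval t = MvPolynomial.eval (fun l => (x + t • w) l) p := by
    intro t
    clear h
    induction p using MvPolynomial.induction_on with
    | C c => simp [q]
    | add p₁ p₂ h₁ h₂ => simp_all [q]
    | mul_X p k ih =>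
      simp only [q, MvPolynomial.eval₂_mul, MvPolynomial.eval₂_X, Polynomial.eval_mul, map_mul,
        MvPolynomial.eval_X] at ih ⊢
      rw [ih]
      congr 1
      simp only [Polynomial.eval_add, Polynomial.eval_C, Polynomial.eval_mul, Polynomial.eval_X,
        PiLp.add_apply, PiLp.smul_apply, smul_eq_mul]
  have hq0 : q = 0 := by
    refine Polynomial.eq_zero_of_infinite_isRoot q ?_
    refine (infinite_of_mem_nhds (0 : ℝ) h).mono fun t ht => ?_
    exact (hq t).trans ht
  rw [← hq, hq0, Polynomial.eval_zero]

namespace Mesh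

variable {n N r : ℕ} {T : Mesh (n + 1) N}

/-- The set where two continuous functions differ is open, and a nonempty relatively open piece of a
hyperplane has positive surface measure. Almost-everywhere equality thus becomes equality. -/
theorem eqOn_level_of_ae {f g : Pt (n + 1) → ℝ} (hf : Continuous f) (hg : Continuous g)
    {i : Fin N} {k : Fin (n + 2)} {s F : Set (Pt (n + 1))} (hs : IsOpen s)
    (hF : ∀ y ∈ s, T.level i k y = 0 → y ∈ F)
    (h : ∀ᵐ y ∂(surf (n + 1)).restrict F, f y = g y) {y : Pt (n + 1)} (hy : y ∈ s)
    (hk : T.level i k y = 0) : f y = g y := by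
  by_contra hne
  have hopen : IsOpen (s ∩ {z | f z ≠ g z}) := hs.inter (isOpen_ne_fun hf hg)
  have hpos := surf_hyperplane_inter_open_pos (T.norm_facetNormal i k) (c := T.facetOffset i k)
    hopen ⟨y, ⟨hy, hne⟩, sub_eq_zero.1 hk⟩
  refine hpos.ne' ?_
  rw [ae_iff] at h
  have h2 := Measure.le_restrict_apply F {y | ¬ f y = g y} (μ := surf (n + 1))
  rw [h] at h2
  refine measure_mono_null ?_ (le_antisymm h2 bot_le)
  rintro z ⟨⟨hz1, hz2⟩, hz3⟩
  exact ⟨hz2, hF z hz1 (sub_eq_zero.2 hz3)⟩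

/-- A polynomial that vanishes on a hyperplane near one of its points vanishes on it. -/
theorem eval_eq_zero_of_level (p : MvPolynomial (Fin (n + 1)) ℝ) {i : Fin N} {k : Fin (n + 2)}
    {x : Pt (n + 1)} (hx : T.level i k x = 0)
    (h : ∀ᶠ y : Pt (n + 1) in 𝓝 x, T.level i k y = 0 → MvPolynomial.eval (fun l => y l) p = 0)
    {y : Pt (n + 1)} (hy : T.level i k y = 0) : MvPolynomial.eval (fun l => y l) p = 0 := by
  have hin : ⟪T.facetNormal i k, y - x⟫ = (0 : ℝ) := by
    have := T.level_add i k x (y - x)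
    rw [add_sub_cancel, hx, hy] at this
    linarith
  have := mvPolynomial_eval_line_eq_zero p x (y - x) ?_ 1
  · simpa using this
  · have h1 : Tendsto (fun t : ℝ => x + t • (y - x)) (𝓝 0) (𝓝 x) := by
      have : Continuous fun t : ℝ => x + t • (y - x) := by fun_prop
      simpa using this.tendsto 0
    filter_upwards [h1.eventually h] with t ht
    exact ht (by rw [T.level_add, hx, inner_smul_right, hin, mul_zero, add_zero])

theorem mem_bdryFace_of_notMem_domain {i : Fin N} {x : Pt (n + 1)} (hx : x ∈ T.closedElem i)
    (hd : x ∉ T.domain) : x ∈ T.bdryFace i := by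
  refine ⟨hx, ?_⟩
  rw [frontier, T.isOpen_domain.interior_eq]
  exact ⟨T.closedElem_subset_closure i hx, hd⟩

/-- If the traces from two elements agree a.e. on their common face and vanish a.e. on their
boundary faces, then they agree on the whole intersection of the closed elements, provided these
share a piece of a hyperplane. -/
theorem val_eq_of_notMem_skeleton (v : DGSpace (n + 1) N r) {i j : Fin N} (hij : i ≠ j)
    (hF : ∀ᵐ x ∂(surf (n + 1)).restrict (T.face i j), val v i x = val v j x)
    {x : Pt (n + 1)} (hi : x ∈ T.closedElem i) (hj : x ∈ T.closedElem j) (hs : x ∉ T.skeleton)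
    (hB : x ∈ T.domain ∨ (∀ᵐ x ∂(surf (n + 1)).restrict (T.bdryFace i), val v i x = 0) ∧
      ∀ᵐ x ∂(surf (n + 1)).restrict (T.bdryFace j), val v j x = 0)
    {y : Pt (n + 1)} (hyi : y ∈ T.closedElem i) (hyj : y ∈ T.closedElem j) :
    val v i y = val v j y := by
  obtain ⟨k, hk⟩ := T.exists_isRegular_of_mem hij hi hj hs
  obtain ⟨l, hl⟩ := T.exists_isRegular_of_mem hij.symm hj hi hs
  have hneg := hk.level_eq_neg hij hl
  -- The two facet hyperplanes coincide with opposite orientation, so the closed elements meet only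
  -- inside this hyperplane.
  have hy : T.level i k y = 0 := by
    have h1 := T.mem_closedElem.1 hyi k
    have h2 := T.mem_closedElem.1 hyj l
    rw [hneg] at h2
    linarith
  obtain ⟨s, hs1, hs2, hs3⟩ := eventually_nhds_iff.1 (hk.eventually.and hl.eventually)
  have hmem : ∀ z ∈ s, T.level i k z = 0 → z ∈ T.closedElem i ∧ z ∈ T.closedElem j := by
    intro z hz hz0
    obtain ⟨h1, h2⟩ := hs1 z hz
    exact ⟨h1.1.2 hz0.ge, h2.1.2 (by rw [hneg, hz0, neg_zero])⟩
  have hloc : ∀ᶠ z : Pt (n + 1) in 𝓝 x, T.level i k z = 0 → val v i z = val v j z := by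
    rcases hB with hd | ⟨hBi, hBj⟩
    · filter_upwards [(hs2.inter T.isOpen_domain).mem_nhds ⟨hs3, hd⟩] with z hz hz0
      exact eqOn_level_of_ae (F := T.face i j) (continuous_val v i) (continuous_val v j)
        (hs2.inter T.isOpen_domain)
        (fun z hz hz0 => ⟨hmem z hz.1 hz0, hz.2⟩) hF hz hz0
    · filter_upwards [hs2.mem_nhds hs3] with z hz hz0
      -- At a point outside the domain, for example on a slit, the common piece of hyperplane may
      -- contain both face points and boundary points; on the latter both traces vanish.
      refine eqOn_level_of_ae (F := T.face i j ∪ (T.bdryFace i ∩ T.bdryFace j))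
        (continuous_val v i) (continuous_val v j) hs2 (fun z hz hz0 => ?_) ?_ hz hz0
      · by_cases hd : z ∈ T.domain
        · exact Or.inl ⟨hmem z hz hz0, hd⟩
        · exact Or.inr ⟨mem_bdryFace_of_notMem_domain (hmem z hz hz0).1 hd,
            mem_bdryFace_of_notMem_domain (hmem z hz hz0).2 hd⟩
      · rw [ae_restrict_union_iff]
        refine ⟨hF, ?_⟩
        filter_upwards [ae_restrict_of_ae_restrict_of_subset Set.inter_subset_left hBi,
          ae_restrict_of_ae_restrict_of_subset Set.inter_subset_right hBj] with z h1 h2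
        rw [h1, h2]
  have := eval_eq_zero_of_level (T := T)
    ((v i : MvPolynomial (Fin (n + 1)) ℝ) - (v j : MvPolynomial (Fin (n + 1)) ℝ)) hk.1 (y := y)
    (hloc.mono fun z hz hz0 => by rw [map_sub]; exact sub_eq_zero.2 (hz hz0)) hy
  rw [map_sub] at this
  exact sub_eq_zero.1 this

theorem val_eq_of_face_pos (v : DGSpace (n + 1) N r) {i j : Fin N} (hij : i ≠ j)
    (hF : ∀ᵐ x ∂(surf (n + 1)).restrict (T.face i j), val v i x = val v j x)
    (hpos : 0 < surf (n + 1) (T.face i j)) {y : Pt (n + 1)} (hyi : y ∈ T.closedElem i)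
    (hyj : y ∈ T.closedElem j) : val v i y = val v j y := by
  obtain ⟨x, hx, hs⟩ : ∃ x ∈ T.face i j, x ∉ T.skeleton := by
    by_contra hcon
    push Not at hcon
    exact hpos.ne' (measure_mono_null hcon T.surf_skeleton)
  exact val_eq_of_notMem_skeleton v hij hF hx.1.1 hx.1.2 hs (Or.inl hx.2) hyi hyj

/-- Near a regular boundary point that lies in no other element, an element has a boundary face. -/
theorem val_eq_zero_of_isRegular (v : DGSpace (n + 1) N r) {i : Fin N} {k : Fin (n + 2)}
    {x : Pt (n + 1)} (hk : T.IsRegular i k x) (hx : ∀ j, j ≠ i → x ∉ T.closedElem j)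
    (hB : ∀ᵐ x ∂(surf (n + 1)).restrict (T.bdryFace i), val v i x = 0)
    {y : Pt (n + 1)} (hy : T.level i k y = 0) : val v i y = 0 := by
  have h1 : ∀ᶠ z in 𝓝 x, ∀ j, j ≠ i → z ∉ T.closedElem j := by
    rw [eventually_all]
    intro j
    by_cases hj : j = i
    · exact Eventually.of_forall fun y h => absurd hj h
    · filter_upwards [(T.isClosed_closedElem j).isOpen_compl.mem_nhds (hx j hj)] with y hy _
        using hy
  have h2 : ∀ᶠ z in 𝓝 x, ∀ l, l ≠ k → 0 < T.level i l z := by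
    rw [eventually_all]
    intro l
    by_cases hl : l = k
    · exact Eventually.of_forall fun y h => absurd hl h
    · filter_upwards [(T.continuous_level i l).continuousAt.eventually
        (Ioi_mem_nhds (hk.2 l hl))] with y hy _ using hy
  obtain ⟨s, hs1, hs2, hs3⟩ := eventually_nhds_iff.1 (h1.and h2)
  refine eval_eq_zero_of_level (T := T) _ hk.1 ?_ hy
  filter_upwards [hs2.mem_nhds hs3] with z hz hz0
  refine eqOn_level_of_ae (continuous_val v i) continuous_const hs2 (fun z hz hz0 => ?_) hB hz hz0
  have hreg : T.IsRegular i k z := ⟨hz0, (hs1 z hz).2⟩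
  -- A nearby point of the facet inside the domain would lie in a second element, and near `x` there
  -- is none.
  refine mem_bdryFace_of_notMem_domain hreg.mem_closedElem fun hd => ?_
  obtain ⟨j, hj, hjz⟩ := hreg.exists_other
    (mem_of_superset (T.isOpen_domain.mem_nhds hd) subset_closure)
  exact (hs1 z hz).1 j hj hjz

/-- The links only provide a face of positive measure somewhere; polynomial rigidity carries the
equality from that face to `x`, which may be a vertex. -/
theorem val_eq_of_linked (v : DGSpace (n + 1) N r) {TC : Finset (Fin N)}
    (hF : ∀ i ∈ TC, ∀ j ∈ TC, i ≠ j →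
      ∀ᵐ x ∂(surf (n + 1)).restrict (T.face i j), val v i x = val v j x)
    {x : Pt (n + 1)} {i j : Fin N} (h : T.Linked TC x i j) : val v i x = val v j x := by
  induction h with
  | refl => rfl
  | @tail k l _ hkl ih =>
    obtain ⟨hk, hl, hxk, hxl, hpos⟩ := hkl
    rw [ih]
    by_cases hne : k = l
    · rw [hne]
    · exact val_eq_of_face_pos v hne (hF k hk l hl hne) hpos hxk hxl

/-- If the trace were nonzero at `x`, continuity would keep it nonzero on a ball, which contains a
boundary piece of positive measure where it vanishes almost everywhere. -/
theorem val_eq_zero_of_boundaryLinked (v : DGSpace (n + 1) N r) {TC : Finset (Fin N)}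
    (hF : ∀ i ∈ TC, ∀ j ∈ TC, i ≠ j →
      ∀ᵐ x ∂(surf (n + 1)).restrict (T.face i j), val v i x = val v j x)
    (hB : ∀ i ∈ TC, ∀ᵐ x ∂(surf (n + 1)).restrict (T.bdryFace i), val v i x = 0)
    {x : Pt (n + 1)} {i : Fin N} (h : T.BoundaryLinked TC x i) : val v i x = 0 := by
  obtain ⟨k, hk, hlink, hpos⟩ := h
  rw [val_eq_of_linked v hF hlink]
  by_contra hne
  obtain ⟨ε, hε, hball⟩ := Metric.mem_nhds_iff.1
    ((isOpen_ne_fun (continuous_val v k) continuous_const).mem_nhds hne)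
  refine (hpos ε hε).ne' ?_
  have h1 := hB k hk
  rw [ae_iff] at h1
  have h2 := Measure.le_restrict_apply (T.bdryFace k) {y | ¬ val v k y = 0} (μ := surf (n + 1))
  rw [h1] at h2
  refine measure_mono_null ?_ (le_antisymm h2 bot_le)
  exact fun z hz => ⟨hball hz.2, hz.1⟩

/-! ### Continuity around a point of a complete mesh -/

theorem ae_notMem_skeleton_volume : ∀ᵐ x ∂(volume : Measure (Pt (n + 1))), x ∉ T.skeleton := by
  have : volume T.skeleton = 0 := by
    simp only [skeleton, measure_iUnion_null_iff]
    intro i k l hkl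
    refine measure_mono_null (fun x hx => hx.1) (volume_affine_zero (T.level i k) ?_)
    obtain ⟨x, -, hx⟩ := T.exists_level_ne_zero (i := i) hkl.symm
    exact ⟨x, hx⟩
  exact measure_eq_zero_iff_ae_notMem.1 this

/-- From almost every point the segment to a given point off the skeleton avoids the skeleton. -/
theorem ae_segment_notMem_skeleton {q : Pt (n + 1)} (hq : q ∉ T.skeleton) :
    ∀ᵐ p ∂(volume : Measure (Pt (n + 1))), ∀ t : ℝ, AffineMap.lineMap p q t ∉ T.skeleton := by
  -- The condition says that the pairs formed by the levels `k` and `l` at `p` and at `q` are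
  -- linearly independent, so the line through these pairs misses the origin. For fixed `q` it
  -- excludes the zeros of a nonzero affine function of `p`.
  have h : ∀ᵐ p ∂(volume : Measure (Pt (n + 1))), ∀ i k l, k ≠ l →
      T.level i l q * T.level i k p - T.level i k q * T.level i l p ≠ 0 := by
    simp only [ae_all_iff]
    intro i k l hkl
    let G : Pt (n + 1) →ᵃ[ℝ] ℝ := T.level i l q • T.level i k - T.level i k q • T.level i l
    refine measure_eq_zero_iff_ae_notMem.1 (volume_affine_zero G ?_)
    by_cases hkq : T.level i k q = 0
    · obtain ⟨x, hx1, hx2⟩ := T.exists_level_ne_zero (i := i) hkl.symm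
      refine ⟨x, ?_⟩
      change T.level i l q * T.level i k x - T.level i k q * T.level i l x ≠ 0
      rw [hkq, zero_mul, sub_zero]
      exact mul_ne_zero (fun hl => hq (T.mem_skeleton.2 ⟨i, k, l, hkl, hkq, hl⟩)) hx2
    · obtain ⟨x, hx1, hx2⟩ := T.exists_level_ne_zero (i := i) hkl
      refine ⟨x, ?_⟩
      change T.level i l q * T.level i k x - T.level i k q * T.level i l x ≠ 0
      rw [hx1, mul_zero, zero_sub]
      exact neg_ne_zero.2 (mul_ne_zero hkq hx2)
  filter_upwards [h] with p hp t ht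
  obtain ⟨i, k, l, hkl, h1, h2⟩ := T.mem_skeleton.1 ht
  rw [AffineMap.apply_lineMap, AffineMap.lineMap_apply_ring] at h1 h2
  refine hp i k l hkl ?_
  have h3 : (1 - t) * (T.level i l q * T.level i k p - T.level i k q * T.level i l p) = 0 := by
    linear_combination T.level i l q * h1 - T.level i k q * h2
  have h4 : t * (T.level i l q * T.level i k p - T.level i k q * T.level i l p) = 0 := by
    linear_combination T.level i k p * h2 - T.level i l p * h1
  linear_combination h3 + h4

/-- Near `x` only those facet hyperplanes occur that contain `x`. -/
theorem exists_ball_level (T : Mesh (n + 1) N) (x : Pt (n + 1)) :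
    ∃ ε > 0, (∀ y ∈ Metric.ball x ε, ∀ i k, T.level i k y = 0 → T.level i k x = 0) ∧
      ∀ y ∈ Metric.ball x ε, ∀ i, y ∈ T.closedElem i → x ∈ T.closedElem i := by
  have h1 : ∀ᶠ y in 𝓝 x, ∀ i k, T.level i k y = 0 → T.level i k x = 0 := by
    simp only [eventually_all]
    intro i k
    by_cases h : T.level i k x = 0
    · exact Eventually.of_forall fun _ _ => h
    · filter_upwards [(isOpen_ne_fun (T.continuous_level i k) continuous_const).mem_nhds h]
        with y hy hy0 using absurd hy0 hy
  have h2 : ∀ᶠ y in 𝓝 x, ∀ i, y ∈ T.closedElem i → x ∈ T.closedElem i := by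
    simp only [eventually_all]
    intro i
    by_cases h : x ∈ T.closedElem i
    · exact Eventually.of_forall fun _ _ => h
    · filter_upwards [(T.isClosed_closedElem i).isOpen_compl.mem_nhds h] with y hy hy0
        using absurd hy0 hy
  obtain ⟨ε, hε, hball⟩ := Metric.eventually_nhds_iff_ball.1 (h1.and h2)
  exact ⟨ε, hε, fun y hy => (hball y hy).1, fun y hy => (hball y hy).2⟩

theorem eventually_mem_closedElem_imp (T : Mesh (n + 1) N) (y : Pt (n + 1)) :
    ∀ᶠ z in 𝓝 y, ∀ i, z ∈ T.closedElem i → y ∈ T.closedElem i := by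
  simp only [eventually_all]
  intro i
  by_cases h : y ∈ T.closedElem i
  · exact Eventually.of_forall fun _ _ => h
  · filter_upwards [(T.isClosed_closedElem i).isOpen_compl.mem_nhds h] with z hz hz0
      using absurd hz0 hz

/-- The value at `x` of the polynomial of an element containing `y` is locally constant in `y`
near `x` and off the skeleton, if one puts `0` outside the domain. -/
theorem exists_eventually_val_eq (v : DGSpace (n + 1) N r)
    (hF : ∀ i j, i ≠ j → ∀ᵐ x ∂(surf (n + 1)).restrict (T.face i j), val v i x = val v j x)
    (hB : ∀ i, ∀ᵐ x ∂(surf (n + 1)).restrict (T.bdryFace i), val v i x = 0)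
    {x y : Pt (n + 1)} (hy1 : ∀ i k, T.level i k y = 0 → T.level i k x = 0)
    (hy2 : ∀ i, y ∈ T.closedElem i → x ∈ T.closedElem i) (hs : y ∉ T.skeleton) :
    ∃ α : ℝ, ∀ᶠ z in 𝓝 y, (∀ i, z ∈ T.closedElem i → val v i x = α) ∧
      ((∀ i, z ∉ T.closedElem i) → α = 0) := by
  have hnear := T.eventually_mem_closedElem_imp y
  by_cases hy : ∃ i, y ∈ T.closedElem i
  · obtain ⟨i, hi⟩ := hy
    by_cases hii : y ∈ T.elem i
    · refine ⟨val v i x, ?_⟩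
      filter_upwards [(T.isOpen_elem i).mem_nhds hii] with z hz
      refine ⟨fun j hj => ?_, fun h => absurd (T.elem_subset_closedElem i hz) (h i)⟩
      by_cases hij : j = i
      · rw [hij]
      · exact absurd hz (T.notMem_elem_of_mem_closedElem hij hj)
    · obtain ⟨k, hk⟩ := T.exists_isRegular (T.mem_frontier_elem.2 ⟨hi, hii⟩) hs
      by_cases hj : ∃ j, j ≠ i ∧ y ∈ T.closedElem j
      · obtain ⟨j, hji, hj⟩ := hj
        obtain ⟨l, hl⟩ := T.exists_isRegular_of_mem hji hj hi hs
        have hneg := hk.level_eq_neg hji.symm hl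
        -- The two polynomials agree on the whole intersection of the closed elements, in particular
        -- at `x`, although the crossing takes place at `y`.
        have hval : val v i x = val v j x :=
          val_eq_of_notMem_skeleton v hji.symm (hF i j hji.symm) hi hj hs (Or.inr ⟨hB i, hB j⟩)
            (hy2 i hi) (hy2 j hj)
        refine ⟨val v i x, ?_⟩
        filter_upwards [hnear, hk.eventually, hl.eventually] with z hz h1 h2
        refine ⟨fun m hm => ?_, fun h => ?_⟩
        · by_cases hmi : m = i
          · rw [hmi]
          by_cases hmj : m = j
          · rw [hmj, hval]
          obtain ⟨p, hp⟩ := T.exists_isRegular_of_mem hmi (hz m hm) hi hs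
          exact (hk.false_of_three hji.symm (Ne.symm hmi) (Ne.symm hmj) hl hp).elim
        · rcases le_total 0 (T.level i k z) with h0 | h0
          · exact absurd (h1.1.2 h0) (h i)
          · exact absurd (h2.1.2 (by rw [hneg]; linarith)) (h j)
      · push Not at hj
        -- The crossed boundary facet lies in a hyperplane through `x`, so the vanishing on the
        -- facet reaches `x`.
        have hval : val v i x = 0 := val_eq_zero_of_isRegular v hk hj (hB i) (hy1 i k hk.1)
        refine ⟨0, ?_⟩
        filter_upwards [hnear] with z hz
        refine ⟨fun m hm => ?_, fun _ => rfl⟩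
        by_cases hmi : m = i
        · rw [hmi, hval]
        · exact absurd (hz m hm) (hj m hmi)
  · push Not at hy
    exact ⟨0, hnear.mono fun z hz => ⟨fun i hi => absurd (hz i hi) (hy i), fun _ => rfl⟩⟩

/-- For the whole mesh no chain of faces has to be assumed. Points `p` and `q` of the two elements
near `x` are joined by a segment that avoids the skeleton. Along it the value at `x` of the
polynomial of the current element is locally constant, hence constant. The value `0` outside the
closed elements lets the segment leave the domain, which the boundary condition makes consistent. -/
theorem val_eq_of_forall_face (v : DGSpace (n + 1) N r)
    (hF : ∀ i j, i ≠ j → ∀ᵐ x ∂(surf (n + 1)).restrict (T.face i j), val v i x = val v j x)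
    (hB : ∀ i, ∀ᵐ x ∂(surf (n + 1)).restrict (T.bdryFace i), val v i x = 0)
    {x : Pt (n + 1)} {i j : Fin N} (hi : x ∈ T.closedElem i) (hj : x ∈ T.closedElem j) :
    val v i x = val v j x := by
  classical
  obtain ⟨ε, hε, hball1, hball2⟩ := T.exists_ball_level x
  have hne : ∀ i, x ∈ T.closedElem i → (T.elem i ∩ Metric.ball x ε).Nonempty := by
    intro i hi
    rw [← T.closure_elem] at hi
    obtain ⟨y, hy1, hy2⟩ := mem_closure_iff.1 hi _ Metric.isOpen_ball (Metric.mem_ball_self hε)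
    exact ⟨y, hy2, hy1⟩
  obtain ⟨q, hqs, hqj, hqB⟩ := (Measure.dense_of_ae T.ae_notMem_skeleton_volume).exists_mem_open
    ((T.isOpen_elem j).inter Metric.isOpen_ball) (hne j hj)
  obtain ⟨p, hps, hpi, hpB⟩ := (Measure.dense_of_ae
    (T.ae_segment_notMem_skeleton hqs)).exists_mem_open
      ((T.isOpen_elem i).inter Metric.isOpen_ball) (hne i hi)
  -- The choice of an element containing `y` is harmless along the segment: off the skeleton all
  -- such elements give the same value at `x`.
  let φ : Pt (n + 1) → ℝ := fun y =>
    if h : ∃ m, y ∈ T.closedElem m then val v h.choose x else 0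
  have hφ : ∀ (y : Pt (n + 1)) (α : ℝ), (∀ m, y ∈ T.closedElem m → val v m x = α) →
      ((∀ m, y ∉ T.closedElem m) → α = 0) → φ y = α := by
    intro y α h1 h2
    by_cases h : ∃ m, y ∈ T.closedElem m
    · exact (dif_pos h).trans (h1 _ h.choose_spec)
    · exact (dif_neg h).trans (h2 (not_exists.1 h)).symm
  have hφe : ∀ (y : Pt (n + 1)) (m : Fin N), y ∈ T.elem m → φ y = val v m x := by
    intro y m hy
    refine hφ y _ (fun l hl => ?_) fun h => absurd (T.elem_subset_closedElem m hy) (h m)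
    by_cases hlm : l = m
    · rw [hlm]
    · exact absurd hy (T.notMem_elem_of_mem_closedElem hlm hl)
  have hloc : IsLocallyConstant fun t : unitInterval =>
      φ (AffineMap.lineMap p q (t : ℝ)) := by
    rw [IsLocallyConstant.iff_eventually_eq]
    intro t
    have hB' : (AffineMap.lineMap p q (t : ℝ) : Pt (n + 1)) ∈ Metric.ball x ε :=
      (convex_ball x ε).lineMap_mem hpB hqB t.2
    obtain ⟨α, hα⟩ := exists_eventually_val_eq v hF hB (hball1 _ hB') (hball2 _ hB') (hps t)
    have hcont : Continuous fun t : unitInterval =>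
        (AffineMap.lineMap p q (t : ℝ) : Pt (n + 1)) := by
      simp only [AffineMap.lineMap_apply_module]
      fun_prop
    have hα' : ∀ᶠ z in 𝓝 (AffineMap.lineMap p q (t : ℝ) : Pt (n + 1)), φ z = α :=
      hα.mono fun z hz => hφ z α hz.1 hz.2
    filter_upwards [hcont.continuousAt.eventually hα'] with s hs
    exact hs.trans hα'.self_of_nhds.symm
  have h01 : φ (AffineMap.lineMap p q (0 : ℝ)) = φ (AffineMap.lineMap p q (1 : ℝ)) :=
    hloc.apply_eq_of_preconnectedSpace 0 1
  rw [AffineMap.lineMap_apply_zero, AffineMap.lineMap_apply_one] at h01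
  rwa [hφe p i hpi, hφe q j hqj] at h01

/-! ### The continuous Galerkin space as the kernel of the penalty form -/

/-- In one direction the continuous function agrees with each polynomial up to the closure of its
element. In the other the face conditions give equality at every common point of the closed
elements, and the pieces glue over a finite closed cover. -/
theorem mem_cdGSpace_iff {TC : Finset (Fin N)} (hTC : TC = Finset.univ ∨ T.FaceConnected TC)
    {v : DGSpace (n + 1) N r} :
    v ∈ T.cdGSpace r TC ↔
      (∀ i ∈ TC, ∀ j ∈ TC, i ≠ j →
        ∀ᵐ x ∂(surf (n + 1)).restrict (T.face i j), val v i x = val v j x) ∧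
      ∀ i ∈ TC, ∀ᵐ x ∂(surf (n + 1)).restrict (T.bdryFace i), val v i x = 0 := by
  classical
  constructor
  · rintro ⟨⟨g, hg, hgv⟩, hB⟩
    refine ⟨fun i hi j hj _ => ?_, hB⟩
    have key : ∀ i ∈ TC, ∀ x ∈ T.closedElem i, g x = val v i x := by
      intro i hi x hx
      have hsub : T.closedElem i ⊆ T.closedRegion TC := Set.subset_biUnion_of_mem (u := T.closedElem) hi
      have : Set.EqOn g (val v i) (T.closedElem i) := by
        refine Set.EqOn.of_subset_closure (hgv i hi) (hg.mono hsub)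
          (continuous_val v i).continuousOn (T.elem_subset_closedElem i) ?_
        rw [T.closure_elem]
      exact this hx
    filter_upwards [ae_restrict_mem (T.measurableSet_face i j)] with x hx
    rw [← key i hi x hx.1.1, ← key j hj x hx.1.2]
  · rintro ⟨hF, hB⟩
    have key : ∀ i ∈ TC, ∀ j ∈ TC, ∀ x, x ∈ T.closedElem i → x ∈ T.closedElem j →
        val v i x = val v j x := by
      intro i hi j hj x hxi hxj
      rcases hTC with rfl | hTC
      · exact val_eq_of_forall_face v (fun i j => hF i (Finset.mem_univ i) j (Finset.mem_univ j))
          (fun i => hB i (Finset.mem_univ i)) hxi hxj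
      · rcases hTC i hi j hj x ⟨hxi, hxj⟩ with h | ⟨h1, h2⟩
        · exact val_eq_of_linked v hF h
        · rw [val_eq_zero_of_boundaryLinked v hF hB h1, val_eq_zero_of_boundaryLinked v hF hB h2]
    let g : Pt (n + 1) → ℝ := fun x =>
      if h : ∃ i : TC, x ∈ T.closedElem i then val v h.choose x else 0
    have hg : ∀ i ∈ TC, ∀ x ∈ T.closedElem i, g x = val v i x := by
      intro i hi x hx
      have h : ∃ i : TC, x ∈ T.closedElem i := ⟨⟨i, hi⟩, hx⟩
      exact (dif_pos h).trans (key _ h.choose.2 i hi x h.choose_spec hx)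
    refine ⟨⟨g, ?_, fun i hi x hx => hg i hi x (T.elem_subset_closedElem i hx)⟩, hB⟩
    have hunion : T.closedRegion TC = ⋃ i : TC, T.closedElem i := by
      ext x; simp [closedRegion]
    rw [hunion]
    refine LocallyFinite.continuousOn_iUnion (locallyFinite_of_finite _)
      (fun i => T.isClosed_closedElem i) fun i => ?_
    exact (continuous_val v i).continuousOn.congr fun x hx => hg i i.2 x hx

/-! ### The super-penalty form and its kernel -/

variable {a : Pt (n + 1) → Matrix (Fin (n + 1)) (Fin (n + 1)) ℝ} {TC : Finset (Fin N)}
  {Car Cd : ℝ}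

theorem isBilin_formS : IsBilin (T.formS (r := r) TC a Car Cd) := by
  unfold formS
  refine IsBilin.add
    (T.isBilin_sumInterior
      (F := fun w v i j x => if i ∈ TC ∧ j ∈ TC then
        T.penM r a Car Cd i j * ⟪T.jump w i j x, T.jump v i j x⟫ else 0) ?_ ?_)
    (T.isBilin_sumBoundary
      (F := fun w v i x => if i ∈ TC then
        T.penMB r a Car Cd i * ⟪T.jumpB w i x, T.jumpB v i x⟫ else 0) ?_ ?_)
  · intro i j x
    split_ifs
    · exact (isBilin_inner_jump i j x).const_mul _
    · exact IsBilin.zero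
  · intro i j hij w v
    split_ifs
    · exact (integrable_jump w v hij).const_mul _
    · exact integrableOn_zero
  · intro i x
    split_ifs
    · exact (isBilin_inner_jumpB i x).const_mul _
    · exact IsBilin.zero
  · intro i w v
    split_ifs
    · exact (integrable_jumpB w v i).const_mul _
    · exact integrableOn_zero

theorem formS_comm (w v : DGSpace (n + 1) N r) :
    T.formS TC a Car Cd w v = T.formS TC a Car Cd v w := by
  simp only [formS, real_inner_comm]

/-- The sign of `M` is known only on sets of positive surface measure; the other sets contribute a
zero integral. -/
theorem PenaltyPos.integral_interior_nonneg (hM : T.PenaltyPos r TC a Car Cd)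
    (w : DGSpace (n + 1) N r) (i j : Fin N) (hij : i < j) :
    0 ≤ ∫ x in T.face i j, (if i ∈ TC ∧ j ∈ TC then
      T.penM r a Car Cd i j * ⟪T.jump w i j x, T.jump w i j x⟫ else 0) ∂(surf (n + 1)) := by
  split_ifs with h
  · rcases eq_or_lt_of_le (zero_le (a := surf (n + 1) (T.face i j))) with h0 | h0
    · rw [Measure.restrict_eq_zero.2 h0.symm, integral_zero_measure]
    · exact integral_mul_inner_self_nonneg (hM.1 i h.1 j h.2 hij.ne h0).le
  · simp

theorem PenaltyPos.integral_boundary_nonneg (hM : T.PenaltyPos r TC a Car Cd)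
    (w : DGSpace (n + 1) N r) (i : Fin N) :
    0 ≤ ∫ x in T.bdryFace i, (if i ∈ TC then
      T.penMB r a Car Cd i * ⟪T.jumpB w i x, T.jumpB w i x⟫ else 0) ∂(surf (n + 1)) := by
  split_ifs with h
  · rcases eq_or_lt_of_le (zero_le (a := surf (n + 1) (T.bdryFace i))) with h0 | h0
    · rw [Measure.restrict_eq_zero.2 h0.symm, integral_zero_measure]
    · exact integral_mul_inner_self_nonneg (hM.2 i h h0).le
  · simp

theorem PenaltyPos.formS_nonneg (hM : T.PenaltyPos r TC a Car Cd) (w : DGSpace (n + 1) N r) :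
    0 ≤ T.formS TC a Car Cd w w :=
  add_nonneg (T.sumInterior_nonneg (hM.integral_interior_nonneg w))
    (T.sumBoundary_nonneg (hM.integral_boundary_nonneg w))

theorem ae_jump_eq_zero_iff (v : DGSpace (n + 1) N r) {i j : Fin N} (hij : i ≠ j) :
    (∀ᵐ x ∂(surf (n + 1)).restrict (T.face i j), T.jump v i j x = 0) ↔
      ∀ᵐ x ∂(surf (n + 1)).restrict (T.face i j), val v i x = val v j x := by
  refine eventually_congr ?_
  filter_upwards [ae_jump_eq v hij, ae_restrict_of_ae_restrict_of_subset
    (T.face_subset_frontier hij) (T.ae_norm_normal i)] with x h1 h2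
  have h3 : T.normal i x ≠ 0 := norm_ne_zero_iff.1 (by rw [h2]; exact one_ne_zero)
  rw [h1, smul_eq_zero, or_iff_left h3, sub_eq_zero]

theorem ae_jumpB_eq_zero_iff (v : DGSpace (n + 1) N r) (i : Fin N) :
    (∀ᵐ x ∂(surf (n + 1)).restrict (T.bdryFace i), T.jumpB v i x = 0) ↔
      ∀ᵐ x ∂(surf (n + 1)).restrict (T.bdryFace i), val v i x = 0 := by
  refine eventually_congr ?_
  filter_upwards [ae_restrict_of_ae_restrict_of_subset
    (T.bdryFace_subset_frontier i) (T.ae_norm_normal i)] with x h2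
  have h3 : T.normal i x ≠ 0 := norm_ne_zero_iff.1 (by rw [h2]; exact one_ne_zero)
  rw [jumpB, smul_eq_zero, or_iff_left h3]

/-- With `M` positive on the actual faces, `formS` vanishes on the diagonal exactly when all jumps
in the continuous region vanish almost everywhere; `Mesh.mem_cdGSpace_iff` translates this into
continuity. -/
theorem PenaltyPos.mem_cdGSpace_iff (hM : T.PenaltyPos r TC a Car Cd)
    (hTC : TC = Finset.univ ∨ T.FaceConnected TC) (v : DGSpace (n + 1) N r) :
    v ∈ T.cdGSpace r TC ↔ T.formS TC a Car Cd v v = 0 := by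
  rw [Mesh.mem_cdGSpace_iff hTC]
  constructor
  · rintro ⟨hF, hB⟩
    rw [formS, T.sumInterior_eq_zero, T.sumBoundary_eq_zero, add_zero]
    · intro i
      split_ifs with h
      · filter_upwards [(ae_jumpB_eq_zero_iff v i).2 (hB i h)] with x hx
        rw [hx, inner_zero_left, mul_zero]
      · exact Eventually.of_forall fun _ => rfl
    · intro i j hij
      split_ifs with h
      · filter_upwards [(ae_jump_eq_zero_iff v hij.ne).2 (hF i h.1 j h.2 hij.ne)] with x hx
        rw [hx, inner_zero_left, mul_zero]
      · exact Eventually.of_forall fun _ => rfl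
  · intro h
    obtain ⟨h1, h2⟩ := T.sumInterior_add_sumBoundary_eq_zero (hM.integral_interior_nonneg v)
      (hM.integral_boundary_nonneg v) h
    have hlt : ∀ i ∈ TC, ∀ j ∈ TC, i < j →
        ∀ᵐ x ∂(surf (n + 1)).restrict (T.face i j), val v i x = val v j x := by
      intro i hi j hj hij
      rcases eq_or_lt_of_le (zero_le (a := surf (n + 1) (T.face i j))) with h0 | h0
      · rw [Measure.restrict_eq_zero.2 h0.symm, ae_zero]
        exact eventually_bot
      · have h3 := h1 i j hij
        simp only [hi, hj, and_self, if_true] at h3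
        exact (ae_jump_eq_zero_iff v hij.ne).1 (ae_eq_zero_of_integral_mul_inner_self
          (hM.1 i hi j hj hij.ne h0).ne' (integrable_jump v v hij.ne) h3)
    refine ⟨fun i hi j hj hij => ?_, fun i hi => ?_⟩
    · rcases lt_or_gt_of_ne hij with hlt' | hlt'
      · exact hlt i hi j hj hlt'
      · rw [T.face_comm]
        exact (hlt j hj i hi hlt').mono fun x hx => hx.symm
    · rcases eq_or_lt_of_le (zero_le (a := surf (n + 1) (T.bdryFace i))) with h0 | h0
      · rw [Measure.restrict_eq_zero.2 h0.symm, ae_zero]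
        exact eventually_bot
      · have h3 := h2 i
        simp only [hi, if_true] at h3
        exact (ae_jumpB_eq_zero_iff v i).1 (ae_eq_zero_of_integral_mul_inner_self
          (hM.2 i hi h0).ne' (integrable_jumpB v v i) h3)

end Mesh

namespace Mesh

/-! ### Coercivity in the dG norm -/

variable {n N r : ℕ} {T : Mesh (n + 1) N}
  {a : Pt (n + 1) → Matrix (Fin (n + 1)) (Fin (n + 1)) ℝ} {b : Pt (n + 1) → Pt (n + 1)}
  {c f : Pt (n + 1) → ℝ}

theorem sumElem_nonneg {d : ℕ} {T : Mesh d N} {F : Fin N → Pt d → ℝ} (h : ∀ i x, 0 ≤ F i x) :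
    0 ≤ T.sumElem F :=
  Finset.sum_nonneg fun i _ => integral_nonneg (h i)

theorem formAR_self_nonneg (hb : ∃ K, LipschitzOnWith K b (closure T.domain))
    (hc : MemLp c ∞ (volume.restrict T.domain))
    (hcb : ∀ᵐ x ∂volume.restrict T.domain, 0 ≤ c x - 1 / 2 * divergence b x)
    (w : DGSpace (n + 1) N r) : 0 ≤ T.formAR b c w w := by
  rw [formAR_self hb hc hcb]
  refine add_nonneg (sumElem_nonneg fun i x => sq_nonneg _)
    (add_nonneg (T.sumInterior_nonneg fun i j _ => integral_nonneg fun x => ?_)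
      (T.sumBoundary_nonneg fun i => integral_nonneg fun x => ?_)) <;> dsimp only <;> positivity

/-- The squared norm is the diagonal of the form without its flux terms, so comparing it with the
form only requires controlling these terms. -/
theorem IsDiffusion.dGNorm_eq (ha : T.IsDiffusion a)
    (hb : ∃ K, LipschitzOnWith K b (closure T.domain))
    (hc : MemLp c ∞ (volume.restrict T.domain))
    (hcb : ∀ᵐ x ∂volume.restrict T.domain, 0 ≤ c x - 1 / 2 * divergence b x) (Cp : ℝ)
    (w : DGSpace (n + 1) N r) :
    T.dGNorm a b c Cp w =
      √(T.diffForm a w w + T.formAR b c w w + Cp * T.penaltyForm a w w) := by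
  have h1 : T.sumElem (fun i x => ‖op (matSqrt (a x)) (grad w i x)‖ ^ 2) = T.diffForm a w w := by
    refine T.sumElem_congr fun i => ?_
    filter_upwards [ha.ae_elem i] with x hx
    exact norm_op_matSqrt_sq hx.1 hx.2 _
  have h2 : T.sumInterior (fun i j x => Cp * T.scale r a i j * ‖T.jump w i j x‖ ^ 2) +
      T.sumBoundary (fun i x => Cp * T.scaleB r a i * ‖T.jumpB w i x‖ ^ 2) =
      Cp * T.penaltyForm a w w := by
    simp only [mul_assoc, sumInterior_const_mul, sumBoundary_const_mul, penaltyForm,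
      real_inner_self_eq_norm_sq, mul_add]
  rw [dGNorm, h1, h2, formAR_self hb hc hcb, add_assoc (T.diffForm a w w)]

theorem isLinear_formL (hf : MemLp f 2 (volume.restrict T.domain)) :
    IsLinearMap ℝ (T.formL (r := r) f) := by
  have hint : ∀ (w : DGSpace (n + 1) N r) (i : Fin N),
      IntegrableOn (fun x => f x * val w i x) (T.elem i) volume := by
    intro w i
    have h1 : Integrable f (volume.restrict (T.elem i)) :=
      (hf.mono_measure (Measure.restrict_mono_set _ (T.elem_subset_domain i))).integrable
        one_le_two
    exact ((T.bddMeas_elem_val w i i).mul_integrable h1).congr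
      (Eventually.of_forall fun x => mul_comm _ _)
  constructor
  · intro w v
    simp only [formL, val_add, mul_add]
    exact T.sumElem_add (hint w) (hint v)
  · intro t w
    simp only [formL, val_smul, smul_eq_mul, mul_left_comm _ t]
    exact T.sumElem_const_mul t _

end Mesh

end CdG

end

/-! ### Assembly of the theorem -/

theorem theorem3p1 {d N : ℕ} (hd : 1 ≤ d) (T : CdG.Mesh d N) (r : ℕ)
    (a : CdG.Pt d → Matrix (Fin d) (Fin d) ℝ) (ha : T.IsDiffusion a)
    (θ : ℝ) (hθ : θ = -1 ∨ θ = 0 ∨ θ = 1) :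
    ∃ C₀ : ℝ, 0 ≤ C₀ ∧ (θ = 1 → C₀ = 0) ∧
      ∀ (Cp Car Cd : ℝ) (b : CdG.Pt d → CdG.Pt d) (c f : CdG.Pt d → ℝ) (TC : Finset (Fin N)),
        C₀ ≤ Cp →
        (∃ K, LipschitzOnWith K b (closure T.domain)) →
        MemLp c ∞ (volume.restrict T.domain) →
        MemLp f 2 (volume.restrict T.domain) →
        (∀ᵐ x ∂volume.restrict T.domain, 0 ≤ c x - 1 / 2 * CdG.divergence b x) →
        (∀ w : CdG.DGSpace d N r, T.dGNorm a b c Cp w = 0 → w = 0) →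
        T.PenaltyPos r TC a Car Cd →
        (TC = Finset.univ ∨ T.FaceConnected TC) →
        ∃ (v : CdG.DGSpace d N r) (w : ℝ → CdG.DGSpace d N r),
          (∀ σ ≥ 0, ∀ u, T.IsCdGSolution TC a b c f θ Cp Car Cd σ u ↔ u = v) ∧
          (∀ σ ≥ 0, ∀ u, T.IsDGSolution TC a b c f θ Cp Car Cd σ u ↔ u = w σ) ∧
          Tendsto (fun σ => T.dGNorm a b c Cp (w σ - v)) atTop (𝓝 0) ∧
          ∀ p : Seminorm ℝ (CdG.DGSpace d N r),
            Tendsto (fun σ => p (w σ - v)) atTop (𝓝 0) := by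

  obtain ⟨n, rfl⟩ : ∃ n, d = n + 1 := ⟨d - 1, by omega⟩
  obtain ⟨C₀, hC₀, hθ₀, hcoer⟩ := ha.exists_coercive r hθ
  refine ⟨C₀, hC₀, hθ₀, ?_⟩
  intro Cp Car Cd b c f TC hCp hb hc hf hcb hnorm hM hTC
  have hB := (ha.isBilin_formD (r := r) θ Cp).add (CdG.Mesh.isBilin_formAR hb hc)
  -- Coercivity: the squared dG norm is at most twice the form, since the factor `2` is needed for
  -- diffusion only and the advection part is nonnegative.
  have hle : ∀ w : CdG.DGSpace (n + 1) N r,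
      T.diffForm a w w + T.formAR b c w w + Cp * T.penaltyForm a w w ≤ 2 * hB.toLin w w := by
    intro w
    have h1 := hcoer Cp hCp w
    have h2 := CdG.Mesh.formAR_self_nonneg hb hc hcb w
    rw [CdG.IsBilin.toLin_apply]
    linarith
  obtain ⟨v, w, hv, hw, hlim, hsemi⟩ := exists_penalty_limit hB.toLin
    (CdG.Mesh.isBilin_formS (T := T) (r := r) (a := a) (TC := TC) (Car := Car) (Cd := Cd)).toLin
    (fun w hw => by
      by_contra hcon
      refine hw (hnorm w ?_)
      rw [ha.dGNorm_eq hb hc hcb]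
      -- If the form were nonpositive at `w`, the quantity under the root would be too, and the dG
      -- norm of `w` would be zero.
      exact Real.sqrt_eq_zero_of_nonpos ((hle w).trans (by linarith)))
    CdG.Mesh.formS_comm hM.formS_nonneg (T.cdGSpace r TC) (hM.mem_cdGSpace_iff hTC)
    (CdG.Mesh.isLinear_formL (r := r) hf).mk'
  refine ⟨v, w, hv, hw, ?_, hsemi⟩
  refine squeeze_zero (fun σ => Real.sqrt_nonneg _)
    (g := fun σ => √(2 * hB.toLin (w σ - v) (w σ - v))) (fun σ => ?_) ?_
  · rw [ha.dGNorm_eq hb hc hcb]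
    exact Real.sqrt_le_sqrt (hle _)
  · simpa using (hlim.const_mul 2).sqrt
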